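/- **Theorem (Stability).** Let $\alpha,\beta,\gamma,\delta\in\mathbb R$ with $\gamma\neq0$, let $C,T>0$, and consider the Benjamin equation $$u_t=\mathcal J\,w,\qquad \mathcal J=-\partial_x,\qquad w=\alpha u+\beta\mathcal H[u_x]-\gamma u_{xx}+\delta u^2,\qquad u(0)=u_0,$$ where $\mathcal H$ is the Hilbert transform (Fourier multiplier $-i\,\mathrm{sgn}\,\xi$). For $\ell>0$ let $$\tau_m(x)=\sqrt{\tfrac{2\ell}{\pi}}\,\frac{(\ell+2ix)^m}{(\ell-2ix)^{m+1}},\qquad \phi_{2m}=\sqrt2\,\mathrm{Re}\,\tau_m,\qquad \phi_{2m+1}=\sqrt2\,\mathrm{Im}\,\tau_m\qquad(m\ge 0)$$ be the orthonormal Malmquist–Takenaka–Christov functions. For $n=2p-1$ let $\mathbb P_n=\mathrm{span}\{\phi_0,\dots,\phi_n\}$ with the $L^2(\mathbb R)$ inner product, let $\mathcal P_n$ be the $L^2(\mathbb R)$-orthogonal projection onto $\mathbb P_n$, let $\mathcal J_n=-\mathcal P_n\partial_x\mathcal P_n$ (which is invertible on $\mathbb P_n$), and let $\mathcal I_n[f]\in\mathbb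 P_n$ be the interpolant of $f$ at the $2p$ nodes $x_i=\frac{\ell}{2}\tan\bigl(\vartheta_p+\frac{i\pi}{2p}\bigr)$, $0\le i\le n$, where $\vartheta_p$ is any shift for which all nodes are finite (for instance $\vartheta_p=-\frac{\pi}{2}+\frac{\pi}{4p}$, the symmetric grid). The semi-discrete collocation solution $\bar u:[0,T]\to\mathbb P_n$ is defined by $$\bar u_t=\mathcal J_n\nabla\mathcal G_n(\bar u),\qquad \bar u(0)=\mathcal I_n[u_0],$$ $$\mathcal G_n(v)=\tfrac12\int_{\mathbb R}\Bigl(\alpha v^2-\beta v\,\mathcal H[\mathcal J_nv]+\gamma(\mathcal J_nv)^2+\tfrac{2\delta}{3}v\,\mathcal I_n[v^2]\Bigr)dx .$$ Let $u$ be a classical solution of the Benjamin equation on $[0,T]$ that is regular: $u(t)\in C^3(\mathbb R)\cap H^3(\mathbb R)$ for every $t\in[0,T]$, and $u\in C^1([0,T],H^2(\mathbb R))$. Put $\tilde u=\mathcal P_n[u]$, $e=\tilde u-\bar u$, $e_0=e(0)=\mathcal P_n[u_0]-\mathcal I_n[u_0]$, and for $v\in\mathbb P_n$ $$\mathcal E_n(v,t)=2\delta\langle\tilde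 u(t),\mathcal I_n[v^2]\rangle_{L^2(\mathbb R)},\qquad \mathcal D_n(v,t)=\langle v,d_n(t)\rangle_{L^2(\mathbb R)},\qquad \nabla_e\mathcal D_n=d_n,$$ $$d_n=\alpha(1-\mathcal P_n)[u]+\beta\mathcal H[(\partial_x+\mathcal J_n)u]-\gamma(\partial_{xx}-\mathcal J_n^2)[u]+\delta\bigl(u^2-\mathcal I_n[\tilde u^2]\bigr)+\mathcal J_n^{-1}(\mathcal P_n\mathcal J-\mathcal J_n\mathcal P_n)[w].$$ With this $\mathcal D_n$ the consistency error of the projected solution in the scheme is $\tilde u_t-\mathcal J_n\nabla\mathcal G_n(\tilde u)=\mathcal J_n[d_n]$. Let $$S_n=\|e_0\|_{L^2(\mathbb R)}+|\mathcal G_n(-e_0)|^{\frac12}+|\mathcal E_n(e_0,0)|^{\frac12}+|\mathcal D_n(e_0,0)|^{\frac12}+\|\nabla_e\mathcal D_n\|_{L^2([0,T]\times\mathbb R)}+\|\partial_t\nabla_e\mathcal D_n\|_{L^2([0,T]\times\mathbb R)} .$$ There is a constant $c>0$, depending only on $C$, $T$, $\alpha$, $\beta$, $\gamma$, $\delta$,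 such that the following holds for all $\ell>0$, all $\epsilon>0$, all admissible shifts and all such $u$. If $|\tilde u|\le C$ and $|\tilde u_t|\le C$ on $[0,T]\times\mathbb R$ for all sufficiently large $n=2p-1$, and $$S_n=\mathcal O\Bigl(\bigl(\tfrac{\ell n}{2}\bigr)^{-\frac{1+\epsilon}{4}}\Bigr)\qquad(n=2p-1\to\infty),$$ then for all sufficiently large $n=2p-1$ the semi-discrete solution $\bar u$ exists on $[0,T]$ and $$\|e\|_{C([0,T],L^2(\mathbb R))}\le c\,S_n .$$ -/

import Mathlib

open MeasureTheory Set Filter Topology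
open scoped FourierTransform Matrix

noncomputable section

namespace MTC

/-! ### Real `L²(ℝ)` and the Hilbert transform -/

/-- The class in `L²(ℝ; ℝ)` of a square integrable function (and `0` for any other function). -/
def toL2 (f : ℝ → ℝ) : Lp ℝ 2 (volume : Measure ℝ) :=
  open Classical in if h : MemLp f 2 volume then h.toLp f else 0

/-- The class in `L²(ℝ; ℂ)` of a square integrable function (and `0` for any other function). -/
def toL2C (f : ℝ → ℂ) : Lp ℂ 2 (volume : Measure ℝ) :=
  open Classical in if h : MemLp f 2 volume then h.toLp f else 0

/-- The Hilbert transform on `L²(ℝ)`: the Fourier multiplier with symbol `-i sgn ξ`. -/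
def hilbert (f : ℝ → ℝ) : ℝ → ℝ := fun x =>
  ((𝓕⁻ (toL2C fun ξ : ℝ =>
    -Complex.I * ((SignType.sign ξ : ℝ) : ℂ) * (𝓕 (toL2C fun y => (f y : ℂ))) ξ)) x).re

/-! ### Malmquist-Takenaka-Christov functions -/

/-- The complex Malmquist-Takenaka functions with scale `ℓ`, orthonormal in `L²(ℝ; ℂ)`. -/
def tau (ℓ : ℝ) (m : ℕ) (x : ℝ) : ℂ :=
  (√(2 * ℓ / Real.pi) : ℂ) * ((ℓ : ℂ) + 2 * Complex.I * x) ^ m /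
    ((ℓ : ℂ) - 2 * Complex.I * x) ^ (m + 1)

/-- The real orthonormal system: `φ_{2m} = √2 Re τ_m`, `φ_{2m+1} = √2 Im τ_m`. -/
def phi (ℓ : ℝ) (k : ℕ) (x : ℝ) : ℝ :=
  √2 * (if Even k then (tau ℓ (k / 2) x).re else (tau ℓ (k / 2) x).im)

/-- The space `ℙ_n = span {φ_0, …, φ_n}`, `n = 2p - 1`, in the coordinates of the orthonormal
basis `φ_0, …, φ_n`; its Euclidean inner product is the inner product of `L²(ℝ)`. -/
abbrev Coeff (p : ℕ) : Type := EuclideanSpace ℝ (Fin (2 * p))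

/-- The function with given coordinates. -/
def syn (ℓ : ℝ) {p : ℕ} (a : Coeff p) (x : ℝ) : ℝ := ∑ k : Fin (2 * p), a k * phi ℓ k x

/-- The orthogonal projection `𝒫_n` of `L²(ℝ)` onto `ℙ_n`. -/
def proj (ℓ : ℝ) (p : ℕ) (f : ℝ → ℝ) : Coeff p :=
  WithLp.toLp 2 fun k => ∫ x, f x * phi ℓ k x

/-- The collocation nodes: the images of an equispaced grid of `2p` points on the circle,
rotated by `ϑ`, under `θ ↦ (ℓ/2) tan (θ/2)`. -/
def node (ℓ : ℝ) (p : ℕ) (ϑ : ℝ) (i : ℕ) : ℝ :=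
  ℓ / 2 * Real.tan (ϑ + i * Real.pi / (2 * p))

/-- The interpolation operator `ℐ_n`: the element of `ℙ_n` with the values of `f` at the nodes. -/
def interp (ℓ : ℝ) (p : ℕ) (ϑ : ℝ) (f : ℝ → ℝ) : Coeff p :=
  WithLp.toLp 2
    ((Matrix.of fun i k : Fin (2 * p) => phi ℓ k (node ℓ p ϑ i))⁻¹ *ᵥ fun i => f (node ℓ p ϑ i))

/-- The matrix of `𝒥_n = -𝒫_n ∂_x 𝒫_n` in the basis `φ_0, …, φ_n`. -/
def Jmat (ℓ : ℝ) (p : ℕ) : Matrix (Fin (2 * p)) (Fin (2 * p)) ℝ :=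
  Matrix.of fun k j => -∫ x, deriv (phi ℓ j) x * phi ℓ k x

/-- The skew-symmetric operator `𝒥_n` on `ℙ_n`. -/
def J (ℓ : ℝ) {p : ℕ} (a : Coeff p) : Coeff p := WithLp.toLp 2 (Jmat ℓ p *ᵥ a.ofLp)

/-- The inverse of `𝒥_n` on `ℙ_n` (`𝒥_n` is non-degenerate since `n = 2p - 1`). -/
def Jinv (ℓ : ℝ) {p : ℕ} (a : Coeff p) : Coeff p := WithLp.toLp 2 ((Jmat ℓ p)⁻¹ *ᵥ a.ofLp)

/-! ### The Benjamin equation -/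

/-- The parameters of the Benjamin equation. -/
structure Params where
  α : ℝ
  β : ℝ
  γ : ℝ
  δ : ℝ

/-- The gradient `α v + β ℋ[v_x] - γ v_xx + δ v²` of the Hamiltonian
`½ ∫ (α v² + β v ℋ[v_x] + γ v_x² + (2δ/3) v³)`. -/
def gradHam (P : Params) (v : ℝ → ℝ) (x : ℝ) : ℝ :=
  P.α * v x + P.β * hilbert (deriv v) x - P.γ * iteratedDeriv 2 v x + P.δ * v x ^ 2

/-- The right-hand side `-∂_x (α v + β ℋ[v_x] - γ v_xx + δ v²)` of the Benjamin equation
(`ℋ` commutes with `∂_x`). -/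
def benjaminRHS (P : Params) (v : ℝ → ℝ) (x : ℝ) : ℝ :=
  -(P.α * deriv v x + P.β * hilbert (iteratedDeriv 2 v) x - P.γ * iteratedDeriv 3 v x
    + 2 * P.δ * v x * deriv v x)

/-- `u(t, x)` is a regular classical solution on `[0, T]` of
`u_t + ∂_x (α u + β ℋ[u_x] - γ u_xx + δ u²) = 0`: `u(t)` is of class `C³ ∩ H³` in `x`, and
`u` belongs to `C¹([0, T]; H²(ℝ))`. -/
structure IsClassicalSolution (P : Params) (T : ℝ) (u : ℝ → ℝ → ℝ) : Prop where
  contDiff : ∀ t ∈ Icc 0 T, ContDiff ℝ 3 (u t)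
  memLp : ∀ t ∈ Icc 0 T, ∀ j ≤ 3, MemLp (iteratedDeriv j (u t)) 2 volume
  contDiffOn_time : ∀ j ≤ 2,
    ContDiffOn ℝ 1 (fun t => toL2 (iteratedDeriv j (u t))) (Icc 0 T)
  equation : ∀ t ∈ Icc 0 T,
    HasDerivWithinAt (fun s => toL2 (u s)) (toL2 (benjaminRHS P (u t))) (Icc 0 T) t

/-! ### The collocation scheme -/

/-- The discrete Hamiltonian `𝒢_n` on `ℙ_n`. -/
def G (P : Params) (ℓ : ℝ) {p : ℕ} (ϑ : ℝ) (a : Coeff p) : ℝ :=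
  1 / 2 * ∫ x, (P.α * syn ℓ a x ^ 2 - P.β * (syn ℓ a x * hilbert (syn ℓ (J ℓ a)) x)
    + P.γ * syn ℓ (J ℓ a) x ^ 2
    + 2 * P.δ / 3 * (syn ℓ a x * syn ℓ (interp ℓ p ϑ fun y => syn ℓ a y ^ 2) x))

/-- `ū : [0, T] → ℙ_n` solves `ū_t = 𝒥_n ∇𝒢_n(ū)`, `ū(0) = ℐ_n[u₀]`. -/
def IsSemiDiscreteSolution (P : Params) (ℓ : ℝ) {p : ℕ} (ϑ T : ℝ) (u₀ : ℝ → ℝ)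
    (ubar : ℝ → Coeff p) : Prop :=
  ubar 0 = interp ℓ p ϑ u₀ ∧
    ∀ t ∈ Icc 0 T,
      HasDerivWithinAt ubar (J ℓ (gradient (G P ℓ ϑ) (ubar t))) (Icc 0 T) t

/-! ### The consistency functionals -/

/-- `ℰ_n(e, t) = 2δ ⟨ũ(t), ℐ_n[e²]⟩`, where `ũ(t) = 𝒫_n[v]`, `v = u(t)`. -/
def E (P : Params) (ℓ : ℝ) {p : ℕ} (ϑ : ℝ) (e : Coeff p) (v : ℝ → ℝ) : ℝ :=
  2 * P.δ * ∫ x, syn ℓ (proj ℓ p v) x * syn ℓ (interp ℓ p ϑ fun y => syn ℓ e y ^ 2) x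

/-- `α (1 - 𝒫_n)[v] + β ℋ[(∂_x + 𝒥_n) v] - γ (∂_xx - 𝒥_n²)[v] + δ (v² - ℐ_n[(𝒫_n v)²])`. -/
def residual (P : Params) (ℓ : ℝ) (p : ℕ) (ϑ : ℝ) (v : ℝ → ℝ) (x : ℝ) : ℝ :=
  P.α * (v x - syn ℓ (proj ℓ p v) x)
    + P.β * hilbert (fun y => deriv v y + syn ℓ (J ℓ (proj ℓ p v)) y) x
    - P.γ * (iteratedDeriv 2 v x - syn ℓ (J ℓ (J ℓ (proj ℓ p v))) x)
    + P.δ * (v x ^ 2 - syn ℓ (interp ℓ p ϑ fun y => syn ℓ (proj ℓ p v) y ^ 2) x)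

/-- The element `ρ` of `ℙ_n` with `𝒥_n ρ = (𝒫_n 𝒥 - 𝒥_n 𝒫_n)[w]`, where `𝒥 = -∂_x` and
`w = α v + β ℋ[v_x] - γ v_xx + δ v²`; that is, `𝒥_n ρ = -𝒫_n ∂_x (1 - 𝒫_n)[w]`. -/
def commutator (P : Params) (ℓ : ℝ) (p : ℕ) (v : ℝ → ℝ) : Coeff p :=
  Jinv ℓ (proj ℓ p (benjaminRHS P v) - J ℓ (proj ℓ p (gradHam P v)))

/-- The gradient in `L²(ℝ)` of the linear functional `𝒟_n(·, t)`, with `v = u(t)`. -/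
def gradD (P : Params) (ℓ : ℝ) (p : ℕ) (ϑ : ℝ) (v : ℝ → ℝ) (x : ℝ) : ℝ :=
  residual P ℓ p ϑ v x + syn ℓ (commutator P ℓ p v) x

/-- The linear functional `𝒟_n(e, t)`, with `v = u(t)`. -/
def D (P : Params) (ℓ : ℝ) {p : ℕ} (ϑ : ℝ) (e : Coeff p) (v : ℝ → ℝ) : ℝ :=
  ∫ x, syn ℓ e x * gradD P ℓ p ϑ v x

/-- The initial error `e₀ = 𝒫_n[u₀] - ℐ_n[u₀]`. -/
def initialError (ℓ : ℝ) (p : ℕ) (ϑ : ℝ) (u₀ : ℝ → ℝ) : Coeff p :=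
  proj ℓ p u₀ - interp ℓ p ϑ u₀

/-- The sum of the initial error and of the consistency terms:
`‖e₀‖ + |𝒢_n(-e₀)|^½ + |ℰ_n(e₀,0)|^½ + |𝒟_n(e₀,0)|^½ + ‖∇_e 𝒟_n‖ + ‖∂_t ∇_e 𝒟_n‖`, the last two
norms being those of `L²([0, T] × ℝ) = L²([0, T]; L²(ℝ))`. -/
def totalError (P : Params) (ℓ : ℝ) (p : ℕ) (ϑ T : ℝ) (u : ℝ → ℝ → ℝ) : ℝ :=
  ‖toL2 (syn ℓ (initialError ℓ p ϑ (u 0)))‖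
    + √|G P ℓ ϑ (-initialError ℓ p ϑ (u 0))|
    + √|E P ℓ ϑ (initialError ℓ p ϑ (u 0)) (u 0)|
    + √|D P ℓ ϑ (initialError ℓ p ϑ (u 0)) (u 0)|
    + √(∫ t in (0 : ℝ)..T, ‖toL2 (gradD P ℓ p ϑ (u t))‖ ^ 2)
    + √(∫ t in (0 : ℝ)..T,
        ‖derivWithin (fun s => toL2 (gradD P ℓ p ϑ (u s))) (Icc 0 T) t‖ ^ 2)

end MTC

end

/-! The proof is an energy method. Write `U` for the projected solution, `e` for its difference to
the discrete one, `Δ` for the projection of the consistency gradient onto ℙ_n. Subtracting the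
scheme from the projected equation gives `e' = J (∇G(U) - ∇G(U - e) + Δ)`, and the bracket is
exactly the gradient in `e` of the energy `F(e, t) = G(-e) + ½ E(e, t) + D(e, t)` (`field_sub`,
`Reg.energy_eq`). The error thus obeys a Hamiltonian system with time-dependent Hamiltonian. As `J`
is skew, `F` changes only through its explicit dependence on `t`, that is, through `U'` and `Δ'`,
and this change is quadratic in `e` up to the data (`Colloc.hasDerivWithinAt_energy`).

Since `γ ≠ 0`, the energy controls `‖J e‖²` up to `‖e‖²` and `‖Δ‖²` (`Colloc.norm_J_sq_le`).
Conversely the derivative of `‖e‖²` is bounded by `‖e‖²`, `‖J e‖²` and `‖Δ‖²`, because the linear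
terms of the scheme cancel by skewness (`Colloc.inner_field_le`). A Gronwall argument for the pair
closes (`coupled_gronwall`).

The only obstacle is the cubic term of `G`. A discrete Sobolev inequality bounds every value of `a`
in ℙ_n by `M (‖a‖ + ‖J a‖)` with `M` of order `p^(1/4)` (`abs_syn_le`), so the cubic term is
harmless as long as `M ‖e‖ ≤ 1`. A continuity argument keeps the error in this range when `S_n²` is
small against `M⁻²`, of order `p^(-1/2)` (`Colloc.bootstrap`). The assumed decay of `S_n` ensures
this for large `p` (`eventually_small`). Since `ℓ` and `p` enter only through `M`, and `M` only
through this smallness condition, the constant depends on neither.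

Three ingredients bring the concrete scheme into this form. Under the Cayley transform the basis
consists of powers of a point of the unit circle and the nodes are rotated roots of unity, so that
quadrature at the nodes is exact on products of two elements of ℙ_n. The functions `tau` have
one-sided Fourier transforms, so the Hilbert transform acts on ℙ_n as an isometry commuting with
`J`. Finally `Δ` is differentiable in time: products are handled by a bounded bilinear map on L²,
and the third space derivative occurs only projected, where integration by parts removes it. -/

noncomputable section
namespace MTC
open Complex ComplexConjugate

/-! ### The Cayley transform and products of basis functions -/

/-- The Cayley transform of the real line onto the unit circle. -/
def cay (ℓ x : ℝ) : ℂ := ((ℓ : ℂ) + 2 * I * x) / ((ℓ : ℂ) - 2 * I * x)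

/-- The common squared modulus of the functions `tau ℓ m`. -/
def wt (ℓ x : ℝ) : ℝ := 2 * ℓ / Real.pi / (ℓ ^ 2 + 4 * x ^ 2)

variable {ℓ : ℝ}

lemma den_ne (hℓ : 0 < ℓ) (x : ℝ) : (ℓ : ℂ) - 2 * I * x ≠ 0 := by
  intro h
  have := congrArg Complex.re h
  simp at this
  exact hℓ.ne' this

lemma num_ne (hℓ : 0 < ℓ) (x : ℝ) : (ℓ : ℂ) + 2 * I * x ≠ 0 := by
  intro h
  have := congrArg Complex.re h
  simp at this
  exact hℓ.ne' this

lemma den_mul_num (x : ℝ) :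
    ((ℓ : ℂ) - 2 * I * x) * ((ℓ : ℂ) + 2 * I * x) = ((ℓ ^ 2 + 4 * x ^ 2 : ℝ) : ℂ) := by
  push_cast
  linear_combination (-4 * (x : ℂ) ^ 2) * I_sq

lemma sq_pos (hℓ : 0 < ℓ) (x : ℝ) : 0 < ℓ ^ 2 + 4 * x ^ 2 := by positivity

lemma wt_pos (hℓ : 0 < ℓ) (x : ℝ) : 0 < wt ℓ x := by
  have := Real.pi_pos
  unfold wt; positivity

lemma cay_ne (hℓ : 0 < ℓ) (x : ℝ) : cay ℓ x ≠ 0 := div_ne_zero (num_ne hℓ x) (den_ne hℓ x)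

lemma conj_cay (x : ℝ) : conj (cay ℓ x) = (cay ℓ x)⁻¹ := by
  unfold cay
  rw [inv_div]
  simp [sub_eq_add_neg, conj_ofNat]

lemma norm_cay (hℓ : 0 < ℓ) (x : ℝ) : ‖cay ℓ x‖ = 1 := by
  have h : (‖cay ℓ x‖ : ℂ) ^ 2 = 1 := by
    rw [← Complex.mul_conj', conj_cay, mul_inv_cancel₀ (cay_ne hℓ x)]
  have h2 : ‖cay ℓ x‖ ^ 2 = 1 := by exact_mod_cast h
  nlinarith [norm_nonneg (cay ℓ x)]

lemma conj_tau (m : ℕ) (x : ℝ) : conj (tau ℓ m x) = (√(2 * ℓ / Real.pi) : ℂ) *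
    ((ℓ : ℂ) - 2 * I * x) ^ m / ((ℓ : ℂ) + 2 * I * x) ^ (m + 1) := by
  unfold tau
  simp [sub_eq_add_neg, conj_ofNat]

lemma sqrt_sq' (hℓ : 0 < ℓ) : (√(2 * ℓ / Real.pi) : ℂ) ^ 2 = ((2 * ℓ / Real.pi : ℝ) : ℂ) := by
  have := Real.pi_pos
  rw [← Complex.ofReal_pow, Real.sq_sqrt (by positivity)]

/-- All orthogonality relations, continuous and discrete, reduce through this formula and
`tau_mul_conj_tau` to integrals or sums of integer powers of a point on the unit circle. -/
lemma tau_mul_tau (hℓ : 0 < ℓ) (m k : ℕ) (x : ℝ) :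
    tau ℓ m x * tau ℓ k x = (wt ℓ x : ℂ) * cay ℓ x ^ ((m : ℤ) + k + 1) := by
  have h1 := den_ne hℓ x
  have h2 := num_ne hℓ x
  have h4 : (wt ℓ x : ℂ) = (√(2 * ℓ / Real.pi) : ℂ) ^ 2 /
      (((ℓ : ℂ) - 2 * I * x) * ((ℓ : ℂ) + 2 * I * x)) := by
    rw [sqrt_sq' hℓ, den_mul_num, ← Complex.ofReal_div]; rfl
  rw [h4]
  unfold tau cay
  have h5 : ((m : ℤ) + k + 1) = ((m + k + 1 : ℕ) : ℤ) := by push_cast; ring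
  rw [h5, zpow_natCast, div_pow]
  field_simp
  ring

lemma tau_mul_conj_tau (hℓ : 0 < ℓ) (m k : ℕ) (x : ℝ) :
    tau ℓ m x * conj (tau ℓ k x) = (wt ℓ x : ℂ) * cay ℓ x ^ ((m : ℤ) - k) := by
  have h1 := den_ne hℓ x
  have h2 := num_ne hℓ x
  have h4 : (wt ℓ x : ℂ) = (√(2 * ℓ / Real.pi) : ℂ) ^ 2 /
      (((ℓ : ℂ) - 2 * I * x) * ((ℓ : ℂ) + 2 * I * x)) := by
    rw [sqrt_sq' hℓ, den_mul_num, ← Complex.ofReal_div]; rfl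
  rw [h4, conj_tau, zpow_sub₀ (cay_ne hℓ x), zpow_natCast, zpow_natCast]
  unfold tau cay
  rw [div_pow, div_pow]
  field_simp
  ring

lemma norm_sq_tau (hℓ : 0 < ℓ) (m : ℕ) (x : ℝ) : ‖tau ℓ m x‖ ^ 2 = wt ℓ x := by
  have := tau_mul_conj_tau hℓ m m x
  rw [Complex.mul_conj'] at this
  simp only [sub_self, zpow_zero, mul_one] at this
  exact_mod_cast this

lemma tau_eq (hℓ : 0 < ℓ) (m : ℕ) (x : ℝ) : tau ℓ m x = tau ℓ 0 x * cay ℓ x ^ m := by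
  have h1 := den_ne hℓ x
  unfold tau cay
  rw [div_pow]
  field_simp
  ring

lemma one_add_cay (hℓ : 0 < ℓ) (x : ℝ) : 1 + cay ℓ x = 2 * ℓ / ((ℓ : ℂ) - 2 * I * x) := by
  have h1 := den_ne hℓ x
  unfold cay
  field_simp
  ring

lemma phi_even (m : ℕ) (x : ℝ) : phi ℓ (2 * m) x = √2 * (tau ℓ m x).re := by
  simp [phi]

lemma phi_odd (m : ℕ) (x : ℝ) : phi ℓ (2 * m + 1) x = √2 * (tau ℓ m x).im := by
  have : (2 * m + 1) / 2 = m := by omega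
  simp [phi, this]

lemma two_mul_re_mul (a b : ℂ) : 2 * (a.re * b.re) = (a * b).re + (a * conj b).re := by
  simp; ring
lemma two_mul_im_mul (a b : ℂ) : 2 * (a.im * b.im) = (a * conj b).re - (a * b).re := by
  simp; ring
lemma two_mul_re_mul_im (a b : ℂ) : 2 * (a.re * b.im) = (a * b).im - (a * conj b).im := by
  simp; ring

lemma sqrt_two_mul (a b : ℝ) : √2 * a * (√2 * b) = 2 * (a * b) := by
  have : √2 * √2 = 2 := Real.mul_self_sqrt (by norm_num)
  linear_combination (a * b) * this

lemma phi_even_mul_even (hℓ : 0 < ℓ) (m r : ℕ) (x : ℝ) : phi ℓ (2 * m) x * phi ℓ (2 * r) x =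
    wt ℓ x * (cay ℓ x ^ ((m : ℤ) + r + 1)).re + wt ℓ x * (cay ℓ x ^ ((m : ℤ) - r)).re := by
  rw [phi_even, phi_even, sqrt_two_mul, two_mul_re_mul, tau_mul_tau hℓ, tau_mul_conj_tau hℓ,
    re_ofReal_mul, re_ofReal_mul]

lemma phi_odd_mul_odd (hℓ : 0 < ℓ) (m r : ℕ) (x : ℝ) :
    phi ℓ (2 * m + 1) x * phi ℓ (2 * r + 1) x =
    wt ℓ x * (cay ℓ x ^ ((m : ℤ) - r)).re - wt ℓ x * (cay ℓ x ^ ((m : ℤ) + r + 1)).re := by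
  rw [phi_odd, phi_odd, sqrt_two_mul, two_mul_im_mul, tau_mul_tau hℓ, tau_mul_conj_tau hℓ,
    re_ofReal_mul, re_ofReal_mul]

lemma phi_even_mul_odd (hℓ : 0 < ℓ) (m r : ℕ) (x : ℝ) :
    phi ℓ (2 * m) x * phi ℓ (2 * r + 1) x =
    wt ℓ x * (cay ℓ x ^ ((m : ℤ) + r + 1)).im - wt ℓ x * (cay ℓ x ^ ((m : ℤ) - r)).im := by
  rw [phi_even, phi_odd, sqrt_two_mul, two_mul_re_mul_im, tau_mul_tau hℓ, tau_mul_conj_tau hℓ,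
    im_ofReal_mul, im_ofReal_mul]

/-! ### Continuous orthonormality -/

lemma hasDerivAt_cay (hℓ : 0 < ℓ) (x : ℝ) :
    HasDerivAt (cay ℓ) (cay ℓ x * (2 * Real.pi * I * wt ℓ x)) x := by
  have h1 := den_ne hℓ x
  have h2 := num_ne hℓ x
  have hx : HasDerivAt (fun y : ℝ => (y : ℂ)) 1 x := Complex.ofRealCLM.hasDerivAt
  have hn : HasDerivAt (fun y : ℝ => (ℓ : ℂ) + 2 * I * y) (2 * I * 1) x :=
    (hx.const_mul (2 * I)).const_add _
  have hd : HasDerivAt (fun y : ℝ => (ℓ : ℂ) - 2 * I * y) (-(2 * I * 1)) x :=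
    (hx.const_mul (2 * I)).const_sub _
  have h := hn.div hd h1
  have hpi : (Real.pi : ℂ) ≠ 0 := by exact_mod_cast Real.pi_ne_zero
  have h4 : (wt ℓ x : ℂ) = (2 * ℓ / Real.pi) /
      (((ℓ : ℂ) - 2 * I * x) * ((ℓ : ℂ) + 2 * I * x)) := by
    rw [den_mul_num, wt]; push_cast; rfl
  refine h.congr_deriv ?_
  rw [h4]
  unfold cay
  field_simp
  ring

lemma tendsto_cay (hℓ : 0 < ℓ) {F : Filter ℝ} (hF : Tendsto (fun x : ℝ => |x|) F atTop) :
    Tendsto (cay ℓ) F (𝓝 (-1)) := by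
  have h : cay ℓ = fun x : ℝ => 2 * ℓ / ((ℓ : ℂ) - 2 * I * x) - 1 := by
    ext x; rw [← one_add_cay hℓ]; ring
  rw [h]
  have h0 : Tendsto (fun x : ℝ => 2 * ℓ / ((ℓ : ℂ) - 2 * I * x)) F (𝓝 0) := by
    rw [tendsto_zero_iff_norm_tendsto_zero]
    have hb : Tendsto (fun x : ℝ => ℓ / |x|) F (𝓝 0) := hF.const_div_atTop ℓ
    refine squeeze_zero' (Eventually.of_forall fun _ => norm_nonneg _) ?_ hb
    filter_upwards [hF.eventually_gt_atTop 0] with x hx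
    rw [norm_div]
    have h3 : 2 * |x| ≤ ‖(ℓ : ℂ) - 2 * I * x‖ := by
      have := Complex.abs_im_le_norm ((ℓ : ℂ) - 2 * I * x)
      simpa [abs_mul] using this
    have h4 : ‖(2 * ℓ : ℂ)‖ = 2 * ℓ := by simp [abs_of_pos hℓ]
    rw [h4, div_le_div_iff₀ (by linarith) hx]
    nlinarith
  simpa using h0.sub_const 1

lemma wt_eq (hℓ : 0 < ℓ) (x : ℝ) : wt ℓ x = 2 / (Real.pi * ℓ) * (1 + (2 / ℓ * x) ^ 2)⁻¹ := by
  have := Real.pi_pos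
  unfold wt; field_simp; ring

lemma integrable_wt (hℓ : 0 < ℓ) : Integrable (wt ℓ) := by
  have h := (integrable_inv_one_add_sq.comp_mul_left' (R := 2 / ℓ) (by positivity)).const_mul
    (2 / (Real.pi * ℓ))
  exact h.congr (Eventually.of_forall fun x => (wt_eq hℓ x).symm)

lemma integral_wt (hℓ : 0 < ℓ) : ∫ x, wt ℓ x = 1 := by
  have := Real.pi_pos
  simp_rw [wt_eq hℓ]
  rw [integral_const_mul, Measure.integral_comp_mul_left (fun y => (1 + y ^ 2)⁻¹),
    integral_univ_inv_one_add_sq, abs_of_pos (by positivity)]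
  simp only [smul_eq_mul]
  field_simp

lemma continuous_cay (hℓ : 0 < ℓ) : Continuous (cay ℓ) :=
  continuous_iff_continuousAt.2 fun x => (hasDerivAt_cay hℓ x).continuousAt

lemma integrable_wt_mul (hℓ : 0 < ℓ) (s : ℤ) :
    Integrable fun x => (wt ℓ x : ℂ) * cay ℓ x ^ s := by
  refine (integrable_wt hℓ).ofReal.mul_bdd (c := 1) ?_ ?_
  · exact ((continuous_cay hℓ).zpow₀ s fun x => Or.inl (cay_ne hℓ x)).aestronglyMeasurable
  · exact Eventually.of_forall fun x => by simp [norm_zpow, norm_cay hℓ]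

/-- The weight is the normalized angle measure of the circle: `cay' = 2πi · wt · cay`. For `s ≠ 0` a
multiple of `cay ^ s` is therefore a primitive, and it has the same limit at both ends of the line
because `cay` tends to `-1` at both. -/
lemma integral_wt_mul (hℓ : 0 < ℓ) (s : ℤ) :
    ∫ x, (wt ℓ x : ℂ) * cay ℓ x ^ s = if s = 0 then 1 else 0 := by
  have hpi : (Real.pi : ℂ) ≠ 0 := by exact_mod_cast Real.pi_ne_zero
  split_ifs with hs
  · simp only [hs, zpow_zero, mul_one]
    rw [integral_complex_ofReal, integral_wt hℓ, ofReal_one]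
  have hsC : (s : ℂ) ≠ 0 := by exact_mod_cast hs
  have hd : ∀ x, HasDerivAt (fun x => cay ℓ x ^ s / (s * (2 * Real.pi * I)))
      ((wt ℓ x : ℂ) * cay ℓ x ^ s) x := fun x => by
    have h := ((hasDerivAt_zpow s (cay ℓ x) (Or.inl (cay_ne hℓ x))).comp x
      (hasDerivAt_cay hℓ x)).div_const (s * (2 * Real.pi * I))
    refine h.congr_deriv ?_
    have := cay_ne hℓ x
    rw [zpow_sub_one₀ this]
    field_simp
  have hc : ContinuousAt (fun z : ℂ => z ^ s / (s * (2 * Real.pi * I))) (-1) :=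
    (continuousAt_zpow₀ _ _ (Or.inl (by norm_num))).div_const _
  have := integral_of_hasDerivAt_of_tendsto hd (integrable_wt_mul hℓ s)
    (hc.tendsto.comp (tendsto_cay hℓ tendsto_abs_atBot_atTop))
    (hc.tendsto.comp (tendsto_cay hℓ tendsto_abs_atTop_atTop))
  simpa using this

lemma integrable_wt_re (hℓ : 0 < ℓ) (s : ℤ) : Integrable fun x => wt ℓ x * (cay ℓ x ^ s).re := by
  have := (integrable_wt_mul hℓ s).re
  simpa [RCLike.re_eq_complex_re, re_ofReal_mul] using this

lemma integrable_wt_im (hℓ : 0 < ℓ) (s : ℤ) : Integrable fun x => wt ℓ x * (cay ℓ x ^ s).im := by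
  have := (integrable_wt_mul hℓ s).im
  simpa [RCLike.im_eq_complex_im, im_ofReal_mul] using this

lemma integral_wt_re (hℓ : 0 < ℓ) (s : ℤ) :
    ∫ x, wt ℓ x * (cay ℓ x ^ s).re = if s = 0 then 1 else 0 := by
  have := integral_re (integrable_wt_mul hℓ s)
  rw [integral_wt_mul hℓ] at this
  simp only [RCLike.re_eq_complex_re, re_ofReal_mul] at this
  rw [this]
  split_ifs <;> simp

lemma integral_wt_im (hℓ : 0 < ℓ) (s : ℤ) :
    ∫ x, wt ℓ x * (cay ℓ x ^ s).im = 0 := by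
  have := integral_im (integrable_wt_mul hℓ s)
  rw [integral_wt_mul hℓ] at this
  simp only [RCLike.im_eq_complex_im, im_ofReal_mul] at this
  rw [this]
  split_ifs <;> simp

lemma integrable_phi_mul (hℓ : 0 < ℓ) (j k : ℕ) : Integrable fun x => phi ℓ j x * phi ℓ k x := by
  obtain ⟨m, rfl | rfl⟩ := Nat.even_or_odd' j <;> obtain ⟨r, rfl | rfl⟩ := Nat.even_or_odd' k
  · simp_rw [phi_even_mul_even hℓ]
    exact (integrable_wt_re hℓ _).add (integrable_wt_re hℓ _)
  · simp_rw [phi_even_mul_odd hℓ]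
    exact (integrable_wt_im hℓ _).sub (integrable_wt_im hℓ _)
  · simp_rw [mul_comm (phi ℓ (2 * m + 1) _), phi_even_mul_odd hℓ]
    exact (integrable_wt_im hℓ _).sub (integrable_wt_im hℓ _)
  · simp_rw [phi_odd_mul_odd hℓ]
    exact (integrable_wt_re hℓ _).sub (integrable_wt_re hℓ _)

lemma integral_phi_mul (hℓ : 0 < ℓ) (j k : ℕ) :
    ∫ x, phi ℓ j x * phi ℓ k x = if j = k then 1 else 0 := by
  obtain ⟨m, rfl | rfl⟩ := Nat.even_or_odd' j <;> obtain ⟨r, rfl | rfl⟩ := Nat.even_or_odd' k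
  · simp_rw [phi_even_mul_even hℓ]
    rw [integral_add (integrable_wt_re hℓ _) (integrable_wt_re hℓ _), integral_wt_re hℓ,
      integral_wt_re hℓ, if_neg (by omega), zero_add]
    exact if_congr (by omega) rfl rfl
  · simp_rw [phi_even_mul_odd hℓ]
    rw [integral_sub (integrable_wt_im hℓ _) (integrable_wt_im hℓ _), integral_wt_im hℓ,
      integral_wt_im hℓ, if_neg (by omega), sub_zero]
  · simp_rw [mul_comm (phi ℓ (2 * m + 1) _), phi_even_mul_odd hℓ]
    rw [integral_sub (integrable_wt_im hℓ _) (integrable_wt_im hℓ _), integral_wt_im hℓ,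
      integral_wt_im hℓ, if_neg (by omega), sub_zero]
  · simp_rw [phi_odd_mul_odd hℓ]
    rw [integral_sub (integrable_wt_re hℓ _) (integrable_wt_re hℓ _), integral_wt_re hℓ,
      integral_wt_re hℓ, if_neg (c := (m : ℤ) + r + 1 = 0) (by omega), sub_zero]
    exact if_congr (by omega) rfl rfl

end MTC
end

noncomputable section
namespace MTC
open Complex ComplexConjugate

variable {ℓ : ℝ} {p : ℕ}

/-! ### Discrete orthonormality and interpolation -/

/-- `cay` sends `(ℓ/2) tan θ` to `exp (2iθ)`, so the nodes correspond to `2p` equispaced points of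
the circle. The condition on the cosine excludes the pole of the tangent, where `Real.tan` has the
value zero. -/
lemma cay_node (hℓ : 0 < ℓ) {ϑ : ℝ} {i : ℕ} (hc : Real.cos (ϑ + i * Real.pi / (2 * p)) ≠ 0) :
    cay ℓ (node ℓ p ϑ i) = exp (2 * I * ϑ) * exp (2 * Real.pi * I / (2 * p : ℕ)) ^ i := by
  have hℓ' : (ℓ : ℂ) ≠ 0 := by exact_mod_cast hℓ.ne'
  have hR : exp (2 * I * ϑ) * exp (2 * Real.pi * I / (2 * p : ℕ)) ^ i =
      exp (2 * I * ((ϑ + i * Real.pi / (2 * p) : ℝ) : ℂ)) := by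
    rw [← Complex.exp_nat_mul, ← Complex.exp_add]
    congr 1
    push_cast
    rcases Nat.eq_zero_or_pos p with rfl | hp
    · simp
    · have : (p : ℂ) ≠ 0 := by exact_mod_cast hp.ne'
      field_simp
  rw [hR]
  unfold node
  generalize ϑ + i * Real.pi / (2 * p) = θ at hc ⊢
  have hcC : (Real.cos θ : ℂ) ≠ 0 := by exact_mod_cast hc
  have hcC' : Complex.cos θ ≠ 0 := by rwa [← ofReal_cos]
  have h1 : (ℓ : ℂ) + 2 * I * ((ℓ / 2 * Real.tan θ : ℝ) : ℂ) =
      ℓ / Real.cos θ * exp (θ * I) := by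
    rw [Real.tan_eq_sin_div_cos, exp_mul_I, ← ofReal_cos, ← ofReal_sin]
    push_cast
    field_simp
  have h2 : (ℓ : ℂ) - 2 * I * ((ℓ / 2 * Real.tan θ : ℝ) : ℂ) =
      ℓ / Real.cos θ * exp (-(θ * I)) := by
    rw [Real.tan_eq_sin_div_cos, ← neg_mul, exp_mul_I, Complex.cos_neg, Complex.sin_neg,
      ← ofReal_cos, ← ofReal_sin]
    push_cast
    field_simp
    ring_nf
  have hd : (ℓ : ℂ) / Real.cos θ ≠ 0 := div_ne_zero hℓ' hcC
  unfold cay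
  rw [h1, h2, mul_div_mul_left _ _ hd, ← Complex.exp_sub]
  congr 1
  ring

/-- The sum is geometric with ratio a power of a primitive `2p`-th root of unity. It vanishes unless
`2p` divides `s`, and `|s| < 2p` leaves only `s = 0`. -/
lemma sum_cay_node (hℓ : 0 < ℓ) (hp : 0 < p) {ϑ : ℝ}
    (hc : ∀ i < 2 * p, Real.cos (ϑ + i * Real.pi / (2 * p)) ≠ 0) {s : ℤ} (hs : |s| < 2 * p) :
    ∑ i : Fin (2 * p), (1 / (2 * p) : ℂ) * cay ℓ (node ℓ p ϑ i) ^ s = if s = 0 then 1 else 0 := by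
  have hpC : (p : ℂ) ≠ 0 := by exact_mod_cast hp.ne'
  rw [← Finset.mul_sum]
  split_ifs with h0
  · simp only [h0, zpow_zero, Finset.sum_const, Finset.card_univ, Fintype.card_fin, nsmul_eq_mul]
    push_cast
    field_simp
  set ζ := exp (2 * Real.pi * I / (2 * p : ℕ)) with hζ
  have hprim : IsPrimitiveRoot ζ (2 * p) := isPrimitiveRoot_exp (2 * p) (by omega)
  have h1 : ∀ i : Fin (2 * p), cay ℓ (node ℓ p ϑ i) ^ s = exp (2 * I * ϑ) ^ s * (ζ ^ s) ^ (i : ℕ) := by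
    intro i
    rw [cay_node hℓ (hc i i.2), mul_zpow, ← zpow_natCast (ζ ^ s), ← zpow_natCast, ← zpow_mul,
      ← zpow_mul, mul_comm s]
  have hne : ζ ^ s ≠ 1 := by
    intro h
    rw [hprim.zpow_eq_one_iff_dvd] at h
    push_cast at h
    exact h0 (Int.eq_zero_of_abs_lt_dvd h hs)
  have hpow : (ζ ^ s) ^ (2 * p) = 1 := by
    rw [← zpow_natCast, ← zpow_mul, mul_comm, zpow_mul, zpow_natCast, hprim.pow_eq_one, one_zpow]
  have hg : ∑ i : Fin (2 * p), (ζ ^ s) ^ (i : ℕ) = 0 := by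
    rw [Fin.sum_univ_eq_sum_range (fun i => (ζ ^ s) ^ i), geom_sum_eq hne, hpow]
    simp
  simp_rw [h1]
  rw [← Finset.mul_sum, hg, mul_zero, mul_zero]

/-- The quadrature weight belonging to a node. -/
def qw (ℓ : ℝ) (p : ℕ) (x : ℝ) : ℝ := 1 / (2 * p) / wt ℓ x

lemma qw_nonneg (hℓ : 0 < ℓ) (x : ℝ) : 0 ≤ qw ℓ p x := by
  have := wt_pos hℓ x
  unfold qw; positivity

lemma qw_mul_wt (hℓ : 0 < ℓ) (x y : ℝ) : qw ℓ p x * (wt ℓ x * y) = 1 / (2 * p) * y := by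
  have := (wt_pos hℓ x).ne'
  unfold qw; field_simp

lemma sum_node_re (hℓ : 0 < ℓ) (hp : 0 < p) {ϑ : ℝ}
    (hc : ∀ i < 2 * p, Real.cos (ϑ + i * Real.pi / (2 * p)) ≠ 0) {s : ℤ} (hs : |s| < 2 * p) :
    ∑ i : Fin (2 * p), (1 / (2 * p) : ℝ) * (cay ℓ (node ℓ p ϑ i) ^ s).re
      = if s = 0 then 1 else 0 := by
  have := congrArg Complex.re (sum_cay_node hℓ hp hc hs)
  rw [re_sum] at this
  have h2 : ∀ w : ℂ, ((1 / (2 * p) : ℂ) * w).re = (1 / (2 * p) : ℝ) * w.re := fun w => by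
    rw [← re_ofReal_mul]; push_cast; rfl
  simp_rw [h2] at this
  rw [this]
  split_ifs <;> simp

lemma sum_node_im (hℓ : 0 < ℓ) (hp : 0 < p) {ϑ : ℝ}
    (hc : ∀ i < 2 * p, Real.cos (ϑ + i * Real.pi / (2 * p)) ≠ 0) {s : ℤ} (hs : |s| < 2 * p) :
    ∑ i : Fin (2 * p), (1 / (2 * p) : ℝ) * (cay ℓ (node ℓ p ϑ i) ^ s).im = 0 := by
  have := congrArg Complex.im (sum_cay_node hℓ hp hc hs)
  rw [im_sum] at this
  have h2 : ∀ w : ℂ, ((1 / (2 * p) : ℂ) * w).im = (1 / (2 * p) : ℝ) * w.im := fun w => by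
    rw [← im_ofReal_mul]; push_cast; rfl
  simp_rw [h2] at this
  rw [this]
  split_ifs <;> simp

lemma sum_phi_mul (hℓ : 0 < ℓ) {ϑ : ℝ}
    (hc : ∀ i < 2 * p, Real.cos (ϑ + i * Real.pi / (2 * p)) ≠ 0) {j k : ℕ}
    (hj : j < 2 * p) (hk : k < 2 * p) :
    ∑ i : Fin (2 * p), qw ℓ p (node ℓ p ϑ i) *
      (phi ℓ j (node ℓ p ϑ i) * phi ℓ k (node ℓ p ϑ i)) = if j = k then 1 else 0 := by
  have hp : 0 < p := by omega
  obtain ⟨m, rfl | rfl⟩ := Nat.even_or_odd' j <;> obtain ⟨r, rfl | rfl⟩ := Nat.even_or_odd' k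
  all_goals
    -- Both indices are at most `p - 1`, so `m + r + 1 ≤ 2p - 1`: the highest frequency in a product
    -- of two basis functions is just below the number of nodes, and there is no aliasing.
    have hs1 : |(m : ℤ) + r + 1| < 2 * p := by rw [abs_lt]; omega
    have hs2 : |(m : ℤ) - r| < 2 * p := by rw [abs_lt]; omega
    have hs3 : |(r : ℤ) + m + 1| < 2 * p := by rw [abs_lt]; omega
    have hs4 : |(r : ℤ) - m| < 2 * p := by rw [abs_lt]; omega
  · simp_rw [phi_even_mul_even hℓ, mul_add, qw_mul_wt hℓ, Finset.sum_add_distrib]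
    rw [sum_node_re hℓ hp hc hs1, sum_node_re hℓ hp hc hs2, if_neg (by omega), zero_add]
    exact if_congr (by omega) rfl rfl
  · simp_rw [phi_even_mul_odd hℓ, mul_sub, qw_mul_wt hℓ, Finset.sum_sub_distrib]
    rw [sum_node_im hℓ hp hc hs1, sum_node_im hℓ hp hc hs2, if_neg (by omega), sub_zero]
  · simp_rw [mul_comm (phi ℓ (2 * m + 1) _), phi_even_mul_odd hℓ, mul_sub, qw_mul_wt hℓ,
      Finset.sum_sub_distrib]
    rw [sum_node_im hℓ hp hc hs3, sum_node_im hℓ hp hc hs4, if_neg (by omega), sub_zero]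
  · simp_rw [phi_odd_mul_odd hℓ, mul_sub, qw_mul_wt hℓ, Finset.sum_sub_distrib]
    rw [sum_node_re hℓ hp hc hs1, sum_node_re hℓ hp hc hs2,
      if_neg (c := (m : ℤ) + r + 1 = 0) (by omega), sub_zero]
    exact if_congr (by omega) rfl rfl

/-- Discrete orthonormality makes the weighted transpose of the collocation matrix its left inverse,
so interpolation is the discrete analogue of the projection. -/
lemma interp_apply (hℓ : 0 < ℓ) {ϑ : ℝ}
    (hc : ∀ i < 2 * p, Real.cos (ϑ + i * Real.pi / (2 * p)) ≠ 0) (f : ℝ → ℝ) (k : Fin (2 * p)) :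
    interp ℓ p ϑ f k =
      ∑ i : Fin (2 * p), qw ℓ p (node ℓ p ϑ i) * phi ℓ k (node ℓ p ϑ i) * f (node ℓ p ϑ i) := by
  have hB : (Matrix.of fun k i : Fin (2 * p) => qw ℓ p (node ℓ p ϑ i) * phi ℓ k (node ℓ p ϑ i)) *
      (Matrix.of fun i k : Fin (2 * p) => phi ℓ k (node ℓ p ϑ i)) = 1 := by
    ext j k
    rw [Matrix.mul_apply, Matrix.one_apply]
    simp only [Matrix.of_apply, mul_assoc]
    rw [sum_phi_mul hℓ hc j.2 k.2]
    exact if_congr Fin.ext_iff.symm rfl rfl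
  unfold interp
  rw [Matrix.inv_eq_left_inv hB]
  rfl

/-! ### Synthesis -/

/-- Evaluation at a point as a continuous linear functional of the coordinates. -/
def evL (ℓ : ℝ) (p : ℕ) (x : ℝ) : Coeff p →L[ℝ] ℝ :=
  LinearMap.toContinuousLinearMap
    { toFun := fun a => syn ℓ a x
      map_add' := fun a b => by simp [syn, add_mul, Finset.sum_add_distrib]
      map_smul' := fun c a => by simp [syn, mul_assoc, Finset.mul_sum] }

@[simp] lemma evL_apply (a : Coeff p) (x : ℝ) : evL ℓ p x a = syn ℓ a x := rfl

lemma coeff_inner (a b : Coeff p) : inner ℝ a b = ∑ k, a k * b k := by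
  simp [PiLp.inner_apply, mul_comm]

/-- This identity turns every interpolation term of the scheme into a weighted sum over the nodes,
where products may be rearranged pointwise. -/
lemma inner_interp (hℓ : 0 < ℓ) {ϑ : ℝ}
    (hc : ∀ i < 2 * p, Real.cos (ϑ + i * Real.pi / (2 * p)) ≠ 0) (f : ℝ → ℝ) (a : Coeff p) :
    inner ℝ (interp ℓ p ϑ f) a =
      ∑ i : Fin (2 * p), qw ℓ p (node ℓ p ϑ i) * f (node ℓ p ϑ i) * syn ℓ a (node ℓ p ϑ i) := by
  rw [coeff_inner]
  simp_rw [interp_apply hℓ hc, syn, Finset.sum_mul, Finset.mul_sum]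
  rw [Finset.sum_comm]
  exact Finset.sum_congr rfl fun i _ => Finset.sum_congr rfl fun k _ => by ring

lemma sum_qw_syn_mul (hℓ : 0 < ℓ) {ϑ : ℝ}
    (hc : ∀ i < 2 * p, Real.cos (ϑ + i * Real.pi / (2 * p)) ≠ 0) (a b : Coeff p) :
    ∑ i : Fin (2 * p), qw ℓ p (node ℓ p ϑ i) *
      (syn ℓ a (node ℓ p ϑ i) * syn ℓ b (node ℓ p ϑ i)) = inner ℝ a b := by
  rw [coeff_inner]
  simp_rw [syn, Finset.sum_mul_sum, Finset.mul_sum]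
  rw [Finset.sum_comm]
  refine Finset.sum_congr rfl fun j _ => ?_
  rw [Finset.sum_comm]
  have : ∀ k : Fin (2 * p), ∑ i : Fin (2 * p), qw ℓ p (node ℓ p ϑ i) *
      (a j * phi ℓ j (node ℓ p ϑ i) * (b k * phi ℓ k (node ℓ p ϑ i))) =
      a j * b k * if (j : ℕ) = k then 1 else 0 := fun k => by
    rw [← sum_phi_mul hℓ hc j.2 k.2, Finset.mul_sum]
    exact Finset.sum_congr rfl fun i _ => by ring
  simp_rw [this, ← Fin.ext_iff]
  simp

lemma integrable_syn_mul (hℓ : 0 < ℓ) (a b : Coeff p) :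
    Integrable fun x => syn ℓ a x * syn ℓ b x := by
  simp_rw [syn, Finset.sum_mul_sum]
  refine integrable_finsetSum _ fun j _ => integrable_finsetSum _ fun k _ => ?_
  exact ((integrable_phi_mul hℓ j k).const_mul (a j * b k)).congr
    (Eventually.of_forall fun x => by ring)

lemma integral_syn_mul (hℓ : 0 < ℓ) (a b : Coeff p) :
    ∫ x, syn ℓ a x * syn ℓ b x = inner ℝ a b := by
  have hi : ∀ j k : Fin (2 * p), Integrable fun x => a j * phi ℓ j x * (b k * phi ℓ k x) :=
    fun j k => ((integrable_phi_mul hℓ j k).const_mul (a j * b k)).congr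
      (Eventually.of_forall fun x => by ring)
  simp_rw [syn, Finset.sum_mul_sum]
  rw [integral_finsetSum _ fun j _ => integrable_finsetSum _ fun k _ => hi j k, coeff_inner]
  refine Finset.sum_congr rfl fun j _ => ?_
  rw [integral_finsetSum _ fun k _ => hi j k]
  have : ∀ k : Fin (2 * p), ∫ x, a j * phi ℓ j x * (b k * phi ℓ k x) =
      a j * b k * if (j : ℕ) = k then 1 else 0 := fun k => by
    rw [← integral_phi_mul hℓ, ← integral_const_mul]
    exact integral_congr_ae (Eventually.of_forall fun x => by ring)
  simp_rw [this, ← Fin.ext_iff]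
  simp

end MTC
end

noncomputable section
namespace MTC
open Complex ComplexConjugate

variable {ℓ : ℝ} {p : ℕ}

/-! ### Derivatives of the basis functions -/

/-- The right-hand side is `|1 + cay|²`, because `cay` has modulus one. The weight thus becomes a
multiplier with coefficients 1, 2, 1 in powers of `cay`. -/
lemma wt_eq_cay (hℓ : 0 < ℓ) (x : ℝ) :
    ((2 * Real.pi * ℓ * wt ℓ x : ℝ) : ℂ) = 2 + cay ℓ x + (cay ℓ x)⁻¹ := by
  have h1 := den_ne hℓ x
  have h2 := num_ne hℓ x
  have hpi : (Real.pi : ℂ) ≠ 0 := by exact_mod_cast Real.pi_ne_zero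
  have h4 : (wt ℓ x : ℂ) = (2 * ℓ / Real.pi) /
      (((ℓ : ℂ) - 2 * I * x) * ((ℓ : ℂ) + 2 * I * x)) := by
    rw [den_mul_num, wt]; push_cast; rfl
  push_cast
  rw [h4]
  unfold cay
  field_simp
  ring

lemma hasDerivAt_tau_zero (hℓ : 0 < ℓ) (x : ℝ) :
    HasDerivAt (tau ℓ 0) (tau ℓ 0 x * (I / ℓ * (1 + cay ℓ x))) x := by
  have h1 := den_ne hℓ x
  have hℓ' : (ℓ : ℂ) ≠ 0 := by exact_mod_cast hℓ.ne'
  have hx : HasDerivAt (fun y : ℝ => (y : ℂ)) 1 x := Complex.ofRealCLM.hasDerivAt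
  have hd : HasDerivAt (fun y : ℝ => (ℓ : ℂ) - 2 * I * y) (-(2 * I * 1)) x :=
    (hx.const_mul (2 * I)).const_sub _
  have h := (hd.inv h1).const_mul (√(2 * ℓ / Real.pi) : ℂ)
  have he : tau ℓ 0 = fun y : ℝ => (√(2 * ℓ / Real.pi) : ℂ) *
      (fun y : ℝ => (ℓ : ℂ) - 2 * I * y)⁻¹ y := by
    ext y; simp [tau, div_eq_mul_inv]
  rw [he]
  refine h.congr_deriv ?_
  rw [one_add_cay hℓ]
  simp only [Pi.inv_apply]
  field_simp

/-- Writing `tau ℓ m = tau ℓ 0 * cay ^ m`, the power contributes `m (2 + cay + cay⁻¹)` and `tau ℓ 0`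
contributes `1 + cay`, both times `i/ℓ`. For `m = 0` the truncated index `m - 1` carries the
coefficient zero. -/
lemma hasDerivAt_tau (hℓ : 0 < ℓ) (m : ℕ) (x : ℝ) :
    HasDerivAt (tau ℓ m) (I / ℓ * (m * tau ℓ (m - 1) x + (2 * m + 1) * tau ℓ m x
      + (m + 1) * tau ℓ (m + 1) x)) x := by
  have hℓ' : (ℓ : ℂ) ≠ 0 := by exact_mod_cast hℓ.ne'
  have hz := cay_ne hℓ x
  have he : tau ℓ m = tau ℓ 0 * cay ℓ ^ m := by ext y; exact tau_eq hℓ m y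
  have h := (hasDerivAt_tau_zero hℓ x).mul ((hasDerivAt_cay hℓ x).pow m)
  have hw := wt_eq_cay hℓ x
  push_cast at hw
  have hw' : 2 * Real.pi * I * (wt ℓ x : ℂ) = I / ℓ * (2 + cay ℓ x + (cay ℓ x)⁻¹) := by
    rw [← hw]; field_simp
  rw [tau_eq hℓ m x, tau_eq hℓ (m - 1) x, tau_eq hℓ (m + 1) x]
  rw [he]
  refine h.congr_deriv ?_
  rw [hw']
  simp only [Pi.pow_apply]
  rcases m with _ | m
  · simp; ring
  · simp only [Nat.add_sub_cancel]
    push_cast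
    field_simp
    ring

lemma deriv_phi_even (hℓ : 0 < ℓ) (m : ℕ) (x : ℝ) :
    HasDerivAt (phi ℓ (2 * m)) (-(1 / ℓ) * (m * phi ℓ (2 * (m - 1) + 1) x
      + (2 * m + 1) * phi ℓ (2 * m + 1) x + (m + 1) * phi ℓ (2 * (m + 1) + 1) x)) x := by
  have h := (Complex.reCLM.hasFDerivAt.comp_hasDerivAt x (hasDerivAt_tau hℓ m x)).const_mul (√2)
  have he : phi ℓ (2 * m) = fun y => √2 * (Complex.reCLM ∘ tau ℓ m) y := by
    ext y; exact phi_even m y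
  rw [he]
  refine h.congr_deriv ?_
  rw [phi_odd, phi_odd, phi_odd]
  have h1 : I / (ℓ : ℂ) = ((1 / ℓ : ℝ) : ℂ) * I := by push_cast; ring
  have h2 : (m : ℂ) = ((m : ℝ) : ℂ) := by push_cast; rfl
  simp only [reCLM_apply, h1, h2, mul_assoc, re_ofReal_mul, I_mul_re]
  simp
  ring

lemma deriv_phi_odd (hℓ : 0 < ℓ) (m : ℕ) (x : ℝ) :
    HasDerivAt (phi ℓ (2 * m + 1)) (1 / ℓ * (m * phi ℓ (2 * (m - 1)) x
      + (2 * m + 1) * phi ℓ (2 * m) x + (m + 1) * phi ℓ (2 * (m + 1)) x)) x := by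
  have h := (Complex.imCLM.hasFDerivAt.comp_hasDerivAt x (hasDerivAt_tau hℓ m x)).const_mul (√2)
  have he : phi ℓ (2 * m + 1) = fun y => √2 * (Complex.imCLM ∘ tau ℓ m) y := by
    ext y; exact phi_odd m y
  rw [he]
  refine h.congr_deriv ?_
  rw [phi_even, phi_even, phi_even]
  have h1 : I / (ℓ : ℂ) = ((1 / ℓ : ℝ) : ℂ) * I := by push_cast; ring
  have h2 : (m : ℂ) = ((m : ℝ) : ℂ) := by push_cast; rfl
  simp only [imCLM_apply, h1, h2, mul_assoc, im_ofReal_mul, I_mul_im]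
  simp
  ring

/-! ### The matrix of the discrete derivative -/

/-- The tridiagonal Laguerre matrix. -/
def lag (r m : ℕ) : ℝ :=
  if r = m then 2 * m + 1 else if r = m + 1 then m + 1 else if m = r + 1 then m else 0

lemma lag_symm (r m : ℕ) : lag r m = lag m r := by
  unfold lag
  split_ifs <;> first | omega | (subst_vars; push_cast; ring)

lemma lag_eq (r m : ℕ) : lag r m = m * (if m - 1 = r then 1 else 0) +
    (2 * m + 1) * (if m = r then 1 else 0) + (m + 1) * (if m + 1 = r then 1 else 0) := by
  unfold lag
  rcases m with _ | m
  · split_ifs <;> first | omega | simp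
  · split_ifs <;> first | omega | simp

lemma integral_comb (hℓ : 0 < ℓ) (c a₁ a₂ a₃ : ℝ) (i₁ i₂ i₃ k : ℕ) :
    ∫ x, c * (a₁ * phi ℓ i₁ x + a₂ * phi ℓ i₂ x + a₃ * phi ℓ i₃ x) * phi ℓ k x =
      c * (a₁ * (if i₁ = k then 1 else 0) + a₂ * (if i₂ = k then 1 else 0)
        + a₃ * (if i₃ = k then 1 else 0)) := by
  have h : ∀ x, c * (a₁ * phi ℓ i₁ x + a₂ * phi ℓ i₂ x + a₃ * phi ℓ i₃ x) * phi ℓ k x =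
      c * (a₁ * (phi ℓ i₁ x * phi ℓ k x) + a₂ * (phi ℓ i₂ x * phi ℓ k x)
        + a₃ * (phi ℓ i₃ x * phi ℓ k x)) := fun x => by ring
  have i1 := (integrable_phi_mul hℓ i₁ k).const_mul a₁
  have i2 := (integrable_phi_mul hℓ i₂ k).const_mul a₂
  have i3 := (integrable_phi_mul hℓ i₃ k).const_mul a₃
  simp_rw [h]
  have e1 := integral_add (i1.add i2) i3
  have e2 := integral_add i1 i2
  simp only [Pi.add_apply] at e1 e2
  rw [integral_const_mul, e1, e2, integral_const_mul, integral_const_mul, integral_const_mul,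
    integral_phi_mul hℓ, integral_phi_mul hℓ, integral_phi_mul hℓ]

lemma integral_deriv_odd_even (hℓ : 0 < ℓ) (r m : ℕ) :
    -∫ x, deriv (phi ℓ (2 * m)) x * phi ℓ (2 * r + 1) x = lag r m / ℓ := by
  simp_rw [fun x => (deriv_phi_even hℓ m x).deriv, integral_comb hℓ, lag_eq]
  have e1 : (2 * (m - 1) + 1 = 2 * r + 1) = (m - 1 = r) := by simp
  have e2 : (2 * m + 1 = 2 * r + 1) = (m = r) := by simp
  have e3 : (2 * (m + 1) + 1 = 2 * r + 1) = (m + 1 = r) := by simp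
  simp only [e1, e2, e3]
  ring

lemma integral_deriv_even_odd (hℓ : 0 < ℓ) (r m : ℕ) :
    -∫ x, deriv (phi ℓ (2 * m + 1)) x * phi ℓ (2 * r) x = -(lag r m / ℓ) := by
  simp_rw [fun x => (deriv_phi_odd hℓ m x).deriv, integral_comb hℓ, lag_eq]
  have e1 : (2 * (m - 1) = 2 * r) = (m - 1 = r) := by simp
  have e2 : (2 * m = 2 * r) = (m = r) := by simp
  have e3 : (2 * (m + 1) = 2 * r) = (m + 1 = r) := by simp
  simp only [e1, e2, e3]
  ring

lemma integral_deriv_even_even (hℓ : 0 < ℓ) (r m : ℕ) :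
    -∫ x, deriv (phi ℓ (2 * m)) x * phi ℓ (2 * r) x = 0 := by
  simp_rw [fun x => (deriv_phi_even hℓ m x).deriv, integral_comb hℓ]
  rw [if_neg (by omega), if_neg (by omega), if_neg (by omega)]
  ring

lemma integral_deriv_odd_odd (hℓ : 0 < ℓ) (r m : ℕ) :
    -∫ x, deriv (phi ℓ (2 * m + 1)) x * phi ℓ (2 * r + 1) x = 0 := by
  simp_rw [fun x => (deriv_phi_odd hℓ m x).deriv, integral_comb hℓ]
  rw [if_neg (by omega), if_neg (by omega), if_neg (by omega)]
  ring

/-- Differentiation exchanges the even and the odd family with opposite signs, through one and the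
same symmetric matrix `lag`. -/
lemma Jmat_skew (hℓ : 0 < ℓ) (k j : Fin (2 * p)) : Jmat ℓ p k j = -Jmat ℓ p j k := by
  simp only [Jmat, Matrix.of_apply]
  obtain ⟨m, h | h⟩ := Nat.even_or_odd' (j : ℕ) <;> obtain ⟨r, h' | h'⟩ := Nat.even_or_odd' (k : ℕ)
  · rw [h, h', integral_deriv_even_even hℓ, integral_deriv_even_even hℓ, neg_zero]
  · rw [h, h', integral_deriv_odd_even hℓ, integral_deriv_even_odd hℓ, lag_symm, neg_neg]
  · rw [h, h', integral_deriv_odd_even hℓ, integral_deriv_even_odd hℓ, lag_symm]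
  · rw [h, h', integral_deriv_odd_odd hℓ, integral_deriv_odd_odd hℓ, neg_zero]

/-- The operator `J` as a continuous linear map. -/
def JL (ℓ : ℝ) (p : ℕ) : Coeff p →L[ℝ] Coeff p :=
  LinearMap.toContinuousLinearMap
    { toFun := fun a => J ℓ a
      map_add' := fun a b => by
        simp only [J, WithLp.ofLp_add, Matrix.mulVec_add]; rfl
      map_smul' := fun c a => by
        simp only [J, WithLp.ofLp_smul, Matrix.mulVec_smul]; rfl }

@[simp] lemma JL_apply (a : Coeff p) : JL ℓ p a = J ℓ a := rfl

lemma J_apply (a : Coeff p) (k : Fin (2 * p)) : J ℓ a k = ∑ j, Jmat ℓ p k j * a j := rfl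

lemma inner_J_left (hℓ : 0 < ℓ) (a b : Coeff p) : inner ℝ (J ℓ a) b = -inner ℝ a (J ℓ b) := by
  simp_rw [coeff_inner, J_apply, Finset.sum_mul, Finset.mul_sum]
  rw [Finset.sum_comm, ← Finset.sum_neg_distrib]
  refine Finset.sum_congr rfl fun j _ => ?_
  rw [← Finset.sum_neg_distrib]
  refine Finset.sum_congr rfl fun k _ => ?_
  rw [Jmat_skew hℓ k j]
  ring

/-! ### Complex coordinates -/

/-- The coordinates extended by zero. -/
def cext (a : Coeff p) (k : ℕ) : ℝ := if h : k < 2 * p then a ⟨k, h⟩ else 0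

/-- The complex coordinates `a_{2m} - i a_{2m+1}`. -/
def cc (a : Coeff p) (m : ℕ) : ℂ := cext a (2 * m) - I * cext a (2 * m + 1)

lemma cext_of_le (a : Coeff p) {k : ℕ} (h : 2 * p ≤ k) : cext a k = 0 := by
  simp [cext, not_lt.2 h]

lemma cc_of_le (a : Coeff p) {m : ℕ} (h : p ≤ m) : cc a m = 0 := by
  simp [cc, cext_of_le a (show 2 * p ≤ 2 * m by omega),
    cext_of_le a (show 2 * p ≤ 2 * m + 1 by omega)]

lemma cext_val (a : Coeff p) (k : Fin (2 * p)) : cext a k = a k := by simp [cext]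

lemma sum_range_two_mul {M : Type*} [AddCommMonoid M] (f : ℕ → M) (n : ℕ) :
    ∑ k ∈ Finset.range (2 * n), f k = ∑ m ∈ Finset.range n, (f (2 * m) + f (2 * m + 1)) := by
  induction n with
  | zero => simp
  | succ n ih =>
    rw [show 2 * (n + 1) = 2 * n + 1 + 1 by ring, Finset.sum_range_succ, Finset.sum_range_succ, ih,
      Finset.sum_range_succ, add_assoc]

lemma sum_coeff (a : Coeff p) (f : ℕ → ℝ) : ∑ k : Fin (2 * p), f k * a k =
    ∑ m ∈ Finset.range p, (f (2 * m) * cext a (2 * m) + f (2 * m + 1) * cext a (2 * m + 1)) := by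
  rw [← sum_range_two_mul (fun k => f k * cext a k), Finset.sum_range]
  simp only [cext_val]

lemma cext_sum (a : Coeff p) {k : ℕ} (hk : k < 2 * p) : cext (J ℓ a) k =
    ∑ m ∈ Finset.range p,
      ((-∫ x, deriv (phi ℓ (2 * m)) x * phi ℓ k x) * cext a (2 * m)
        + (-∫ x, deriv (phi ℓ (2 * m + 1)) x * phi ℓ k x) * cext a (2 * m + 1)) := by
  rw [← sum_coeff a fun j => -∫ x, deriv (phi ℓ j) x * phi ℓ k x, cext, dif_pos hk, J_apply]
  rfl

lemma sum_lag (y : ℕ → ℝ) (hy : ∀ m, p ≤ m → y m = 0) {r : ℕ} (hr : r < p) :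
    ∑ m ∈ Finset.range p, lag r m * y m = r * y (r - 1) + (2 * r + 1) * y r + (r + 1) * y (r + 1) := by
  simp_rw [lag_symm r, lag_eq, add_mul, Finset.sum_add_distrib, mul_assoc, ite_mul, one_mul,
    zero_mul, mul_ite, mul_zero, Finset.sum_ite_eq]
  have h1 : r ∈ Finset.range p := Finset.mem_range.2 hr
  have h2 : r - 1 ∈ Finset.range p := Finset.mem_range.2 (by omega)
  simp only [if_pos h1, if_pos h2]
  by_cases h : r + 1 ∈ Finset.range p
  · simp only [if_pos h]
  · simp only [if_neg h, hy (r + 1) (by simpa using h)]; ring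

/-- The even-to-odd and odd-to-even blocks differ only in sign, so they merge into one complex
tridiagonal operator. Truncation to ℙ_n is encoded by the coordinate of index `p` being zero. -/
lemma cc_J (hℓ : 0 < ℓ) (a : Coeff p) {r : ℕ} (hr : r < p) :
    cc (J ℓ a) r = -(I / ℓ) * (r * cc a (r - 1) + (2 * r + 1) * cc a r + (r + 1) * cc a (r + 1)) := by
  have h0 : cext (J ℓ a) (2 * r) = -(1 / ℓ) * (r * cext a (2 * (r - 1) + 1) +
      (2 * r + 1) * cext a (2 * r + 1) + (r + 1) * cext a (2 * (r + 1) + 1)) := by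
    rw [cext_sum a (by omega)]
    simp only [integral_deriv_even_even hℓ, integral_deriv_even_odd hℓ]
    rw [← sum_lag (fun m => cext a (2 * m + 1)) (fun m hm => cext_of_le a (by omega)) hr,
      Finset.mul_sum]
    exact Finset.sum_congr rfl fun m _ => by ring
  have h1 : cext (J ℓ a) (2 * r + 1) = 1 / ℓ * (r * cext a (2 * (r - 1)) +
      (2 * r + 1) * cext a (2 * r) + (r + 1) * cext a (2 * (r + 1))) := by
    rw [cext_sum a (by omega)]
    simp only [integral_deriv_odd_odd hℓ, integral_deriv_odd_even hℓ]
    rw [← sum_lag (fun m => cext a (2 * m)) (fun m hm => cext_of_le a (by omega)) hr,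
      Finset.mul_sum]
    exact Finset.sum_congr rfl fun m _ => by ring
  unfold cc
  rw [h0, h1]
  push_cast
  generalize (cext a (2 * (r - 1)) : ℂ) = x1
  generalize (cext a (2 * (r - 1) + 1) : ℂ) = x2
  generalize (cext a (2 * r) : ℂ) = x3
  generalize (cext a (2 * r + 1) : ℂ) = x4
  generalize (cext a (2 * (r + 1)) : ℂ) = x5
  generalize (cext a (2 * (r + 1) + 1) : ℂ) = x6
  linear_combination (-(1 / (ℓ : ℂ)) * (r * x2 + (2 * r + 1) * x4 + (r + 1) * x6)) * I_sq

lemma cc_re (a : Coeff p) (m : ℕ) : (cc a m).re = cext a (2 * m) := by simp [cc]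
lemma cc_im (a : Coeff p) (m : ℕ) : (cc a m).im = -cext a (2 * m + 1) := by simp [cc]

lemma ext_cc {a b : Coeff p} (h : ∀ m < p, cc a m = cc b m) : a = b := by
  ext k
  obtain ⟨m, hm | hm⟩ := Nat.even_or_odd' (k : ℕ)
  · have := congrArg Complex.re (h m (by omega))
    rwa [cc_re, cc_re, ← hm, cext_val, cext_val] at this
  · have := congrArg Complex.im (h m (by omega))
    rw [cc_im, cc_im, ← hm, cext_val, cext_val] at this
    linarith

lemma inner_eq_cc (a b : Coeff p) :
    inner ℝ a b = ∑ m ∈ Finset.range p, (cc a m * conj (cc b m)).re := by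
  rw [coeff_inner]
  have := sum_coeff b (cext a)
  simp only [cext_val] at this
  rw [this]
  refine Finset.sum_congr rfl fun m _ => ?_
  simp [cc_re, cc_im]

lemma norm_sq_eq_cc (a : Coeff p) : ‖a‖ ^ 2 = ∑ m ∈ Finset.range p, ‖cc a m‖ ^ 2 := by
  rw [← real_inner_self_eq_norm_sq, inner_eq_cc]
  refine Finset.sum_congr rfl fun m _ => ?_
  rw [Complex.mul_conj']
  norm_cast

lemma syn_eq_cc (a : Coeff p) (x : ℝ) :
    syn ℓ a x = √2 * (∑ m ∈ Finset.range p, cc a m * tau ℓ m x).re := by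
  unfold syn
  have := sum_coeff a (fun k => phi ℓ k x)
  simp only [mul_comm (phi ℓ _ x)] at this
  rw [this, re_sum, Finset.mul_sum]
  refine Finset.sum_congr rfl fun m _ => ?_
  rw [phi_even, phi_odd, mul_re, cc_re, cc_im]
  ring

/-! ### Invertibility of the discrete derivative -/

/-- In the kernel the three-term recurrence determines everything from `cc a 0`, namely `cc a r =
(-1)^r cc a 0` up to and including `r = p`. The coordinate of index `p` is zero, hence so is `cc a
0`. -/
lemma J_injective (hℓ : 0 < ℓ) {a : Coeff p} (ha : J ℓ a = 0) : a = 0 := by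
  have hℓ' : (ℓ : ℂ) ≠ 0 := by exact_mod_cast hℓ.ne'
  have hz : ∀ m, cc (0 : Coeff p) m = 0 := fun m => by simp [cc, cext]
  have hrec : ∀ r < p, (r : ℂ) * cc a (r - 1) + (2 * r + 1) * cc a r + (r + 1) * cc a (r + 1) = 0 := by
    intro r hr
    have := cc_J hℓ a hr
    rw [ha, hz, eq_comm, mul_eq_zero] at this
    exact this.resolve_left (neg_ne_zero.2 (div_ne_zero I_ne_zero hℓ'))
  have hs : ∀ r ≤ p, cc a r = (-1) ^ r * cc a 0 := by
    intro r
    induction r using Nat.strong_induction_on with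
    | _ r ih =>
      intro hr
      rcases r with _ | r
      · simp
      have h1 := hrec r (by omega)
      have hne : (r : ℂ) + 1 ≠ 0 := by exact_mod_cast Nat.succ_ne_zero r
      apply mul_left_cancel₀ hne
      rcases r with _ | r
      · simp at h1 ⊢
        linear_combination h1
      · rw [ih (r + 1) (by omega) (by omega), Nat.add_sub_cancel,
          ih r (by omega) (by omega)] at h1
        push_cast at h1 ⊢
        linear_combination h1
  have h0 : cc a 0 = 0 := by
    have := hs p le_rfl
    rw [cc_of_le a le_rfl, eq_comm, mul_eq_zero] at this
    exact this.resolve_left (pow_ne_zero _ (by norm_num))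
  refine ext_cc fun m hm => ?_
  rw [hz, hs m hm.le, h0, mul_zero]

lemma J_Jinv (hℓ : 0 < ℓ) (a : Coeff p) : J ℓ (Jinv ℓ a) = a := by
  have hu : IsUnit (Jmat ℓ p) := by
    rw [← Matrix.mulVec_injective_iff_isUnit]
    intro x y hxy
    have h : J ℓ (WithLp.toLp 2 (x - y) : Coeff p) = 0 := by
      have : Jmat ℓ p *ᵥ (x - y) = 0 := by
        rw [Matrix.mulVec_sub]; exact sub_eq_zero.2 hxy
      simp [J, this]
    have := congrArg WithLp.ofLp (J_injective hℓ h)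
    exact sub_eq_zero.1 (by simpa using this)
  have hd : IsUnit (Jmat ℓ p).det := (Matrix.isUnit_iff_isUnit_det _).1 hu
  simp [J, Jinv, Matrix.mulVec_mulVec, Matrix.mul_nonsing_inv _ hd]

end MTC
end

noncomputable section
namespace MTC
open Complex ComplexConjugate

variable {ℓ : ℝ} {p : ℕ}

/-! ### The Hilbert transform in coordinates -/

/-- The rotation `φ_{2m} ↦ φ_{2m+1}`, `φ_{2m+1} ↦ -φ_{2m}` of the coordinate space. -/
def hil (p : ℕ) : Coeff p →L[ℝ] Coeff p :=
  LinearMap.toContinuousLinearMap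
    { toFun := fun a => WithLp.toLp 2 fun k : Fin (2 * p) =>
        if Even (k : ℕ) then -cext a (k + 1) else cext a (k - 1)
      map_add' := fun a b => by
        ext k
        simp only [cext, PiLp.add_apply]
        split_ifs <;> simp [add_comm]
      map_smul' := fun c a => by
        ext k
        simp only [cext, PiLp.smul_apply]
        split_ifs <;> simp }

lemma hil_apply (a : Coeff p) (k : Fin (2 * p)) :
    hil p a k = if Even (k : ℕ) then -cext a (k + 1) else cext a (k - 1) := rfl

lemma cc_hil (a : Coeff p) (m : ℕ) : cc (hil p a) m = -I * cc a m := by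
  by_cases hm : m < p
  · have h0 : cext (hil p a) (2 * m) = -cext a (2 * m + 1) := by
      rw [cext, dif_pos (by omega), hil_apply]; simp
    have h1 : cext (hil p a) (2 * m + 1) = cext a (2 * m) := by
      rw [cext, dif_pos (by omega), hil_apply]; simp
    unfold cc
    rw [h0, h1]
    push_cast
    linear_combination (-(cext a (2 * m + 1) : ℂ)) * I_sq
  · rw [cc_of_le _ (not_lt.1 hm), cc_of_le _ (not_lt.1 hm), mul_zero]

lemma norm_hil (a : Coeff p) : ‖hil p a‖ = ‖a‖ := by
  have : ‖hil p a‖ ^ 2 = ‖a‖ ^ 2 := by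
    simp_rw [norm_sq_eq_cc, cc_hil]; simp
  exact (pow_left_inj₀ (norm_nonneg _) (norm_nonneg _) two_ne_zero).1 this

lemma inner_hil_left (a b : Coeff p) : inner ℝ (hil p a) b = -inner ℝ a (hil p b) := by
  simp_rw [inner_eq_cc, cc_hil]
  rw [← Finset.sum_neg_distrib]
  refine Finset.sum_congr rfl fun m _ => ?_
  rw [← neg_re]
  congr 1
  simp
  ring

/-- In complex coordinates `hil` is multiplication by `-i`, and `J` is complex linear. -/
lemma J_hil (hℓ : 0 < ℓ) (a : Coeff p) : J ℓ (hil p a) = hil p (J ℓ a) := by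
  refine ext_cc fun m hm => ?_
  rw [cc_hil, cc_J hℓ _ hm, cc_J hℓ _ hm, cc_hil, cc_hil, cc_hil]
  ring

/-! ### The supremum bound -/

lemma sum_inv_sq_le (n : ℕ) : ∑ m ∈ Finset.range n, ((1 : ℝ) / (m + 1)) ^ 2 ≤ 2 := by
  have h : ∀ n : ℕ, ∑ m ∈ Finset.range (n + 1), ((1 : ℝ) / (m + 1)) ^ 2 ≤ 2 - 1 / ((n : ℝ) + 1) := by
    intro n
    induction n with
    | zero => norm_num
    | succ n ih =>
      rw [Finset.sum_range_succ]
      have : ((1 : ℝ) / ((n + 1 : ℕ) + 1)) ^ 2 ≤ 1 / (n + 1) - 1 / ((n + 1 : ℕ) + 1) := by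
        push_cast
        rw [div_sub_div _ _ (by positivity) (by positivity), div_pow,
          div_le_div_iff₀ (by positivity) (by positivity)]
        nlinarith [(Nat.cast_nonneg n : (0 : ℝ) ≤ n)]
      linarith
  rcases n with _ | n
  · simp
  · exact (h n).trans (by linarith [show (0 : ℝ) ≤ 1 / (n + 1) by positivity])

/-- Cauchy–Schwarz against the square-summable sequence `1/(m+1)`: the bound does not grow with `n`.
The factor `3/2` is a rational upper bound of `√2`. -/
lemma sum_div_le (f : ℕ → ℝ) (n : ℕ) {B : ℝ} (hB : 0 ≤ B)
    (hf : ∑ m ∈ Finset.range n, f m ^ 2 ≤ B ^ 2) :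
    ∑ m ∈ Finset.range n, f m * (1 / (m + 1)) ≤ 3 / 2 * B := by
  have h := Finset.sum_mul_sq_le_sq_mul_sq (Finset.range n) f fun m => (1 : ℝ) / (m + 1)
  have h2 : (∑ m ∈ Finset.range n, f m * (1 / (m + 1))) ^ 2 ≤ (3 / 2 * B) ^ 2 := by
    refine h.trans ?_
    have := mul_le_mul hf (sum_inv_sq_le n) (Finset.sum_nonneg fun _ _ => by positivity)
      (by positivity)
    nlinarith [sq_nonneg B]
  exact le_of_abs_le (abs_le_of_sq_le_sq h2 (by positivity))

/-- Summation by parts for the Laguerre recurrence against a geometric sequence. -/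
lemma sum_lag_geom (α : ℕ → ℂ) (n : ℕ) (hα : α (n + 1) = 0) {z : ℂ} (hz : z ≠ 0) :
    (2 + z + z⁻¹) * ∑ m ∈ Finset.range (n + 1), α m * z ^ m =
      ∑ m ∈ Finset.range (n + 1), (1 / ((m : ℂ) + 1)) *
        ((m * α (m - 1) + (2 * m + 1) * α m + (m + 1) * α (m + 1)) * z ^ m)
      + z * (α n * z ^ n) + z⁻¹ * α 0
      + ∑ m ∈ Finset.range (n + 1), (1 / ((m : ℂ) + 1)) * (α m * z ^ m)
      + ∑ m ∈ Finset.range n, (1 / ((m : ℂ) + 2)) * (z * (α m * z ^ m)) := by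
  -- After division by `m + 1` the coefficients `m`, `2m + 1`, `m + 1` become 1, 2, 1 up to errors
  -- of order `1/m`. The leading part reproduces multiplication by `2 + z + z⁻¹`; the errors give
  -- the last two sums of the formula, the ends of the range its two boundary terms.
  have e1 : ∑ m ∈ Finset.range (n + 1), (1 / ((m : ℂ) + 1)) *
        ((m * α (m - 1) + (2 * m + 1) * α m + (m + 1) * α (m + 1)) * z ^ m) =
      (∑ m ∈ Finset.range (n + 1), (m / ((m : ℂ) + 1)) * (α (m - 1) * z ^ m))
      + (∑ m ∈ Finset.range (n + 1), (2 * (α m * z ^ m) - (1 / ((m : ℂ) + 1)) * (α m * z ^ m)))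
      + ∑ m ∈ Finset.range (n + 1), z⁻¹ * (α (m + 1) * z ^ (m + 1)) := by
    rw [← Finset.sum_add_distrib, ← Finset.sum_add_distrib]
    refine Finset.sum_congr rfl fun m _ => ?_
    have : (m : ℂ) + 1 ≠ 0 := by exact_mod_cast Nat.succ_ne_zero m
    field_simp
    ring
  have e2 : ∑ m ∈ Finset.range (n + 1), (m / ((m : ℂ) + 1)) * (α (m - 1) * z ^ m) =
      z * ∑ m ∈ Finset.range n, α m * z ^ m
      - ∑ m ∈ Finset.range n, (1 / ((m : ℂ) + 2)) * (z * (α m * z ^ m)) := by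
    rw [Finset.sum_range_succ', Finset.mul_sum, ← Finset.sum_sub_distrib]
    simp only [Nat.cast_zero, zero_div, zero_mul, add_zero]
    refine Finset.sum_congr rfl fun m _ => ?_
    have : (m : ℂ) + 2 ≠ 0 := by exact_mod_cast (show m + 2 ≠ 0 by omega)
    simp only [Nat.add_sub_cancel]
    push_cast
    rw [show (m : ℂ) + 1 + 1 = m + 2 by ring]
    field_simp
    ring
  have e3 : ∑ m ∈ Finset.range (n + 1), z⁻¹ * (α (m + 1) * z ^ (m + 1)) =
      z⁻¹ * (∑ m ∈ Finset.range (n + 1), α m * z ^ m) - z⁻¹ * α 0 := by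
    rw [← Finset.mul_sum]
    have h1 := Finset.sum_range_succ (fun m => α m * z ^ m) (n + 1)
    rw [Finset.sum_range_succ' (fun m => α m * z ^ m) (n + 1), hα] at h1
    simp only [pow_zero, mul_one, zero_mul, add_zero] at h1
    rw [← h1]
    ring
  rw [e1, e2, e3, Finset.sum_sub_distrib, ← Finset.mul_sum,
    Finset.sum_range_succ (fun m => α m * z ^ m) n]
  ring

lemma norm_le_of_sum {α : ℕ → ℂ} {n m : ℕ} {B : ℝ} (hB : 0 ≤ B)
    (h : ∑ m ∈ Finset.range n, ‖α m‖ ^ 2 ≤ B ^ 2) (hm : m < n) : ‖α m‖ ≤ B := by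
  have h1 := Finset.single_le_sum (f := fun m => ‖α m‖ ^ 2) (fun _ _ => by positivity)
    (Finset.mem_range.2 hm)
  exact (pow_le_pow_iff_left₀ (norm_nonneg _) hB two_ne_zero).1 (h1.trans h)

/-- Each term of the summation by parts is either a single coefficient or a sum weighted by at most
`1/(m+1)`, so the bound is uniform in `n`. The five contributions add up to `5 A + (3/2) B`. -/
lemma norm_cay_sum_le (α : ℕ → ℂ) (n : ℕ) (hα : α (n + 1) = 0) {z : ℂ} (hz : ‖z‖ = 1) {A B : ℝ}
    (hA : 0 ≤ A) (hB : 0 ≤ B) (hA2 : ∑ m ∈ Finset.range (n + 1), ‖α m‖ ^ 2 ≤ A ^ 2)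
    (hB2 : ∑ m ∈ Finset.range (n + 1),
      ‖m * α (m - 1) + (2 * m + 1) * α m + (m + 1) * α (m + 1)‖ ^ 2 ≤ B ^ 2) :
    ‖2 + z + z⁻¹‖ * ‖∑ m ∈ Finset.range (n + 1), α m * z ^ m‖ ≤ 5 * (A + B) := by
  have hz0 : z ≠ 0 := by rintro rfl; simp at hz
  rw [← norm_mul, sum_lag_geom α n hα hz0]
  have hcast : ∀ m : ℕ, ‖(1 / ((m : ℂ) + 1))‖ = 1 / ((m : ℝ) + 1) := fun m => by
    rw [norm_div, norm_one]
    congr 1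
    have : ((m : ℂ) + 1) = ((m + 1 : ℕ) : ℂ) := by push_cast; rfl
    rw [this, Complex.norm_natCast]; push_cast; rfl
  have hcast2 : ∀ m : ℕ, ‖(1 / ((m : ℂ) + 2))‖ ≤ 1 / ((m : ℝ) + 1) := fun m => by
    rw [norm_div, norm_one]
    have : ((m : ℂ) + 2) = ((m + 2 : ℕ) : ℂ) := by push_cast; rfl
    rw [this, Complex.norm_natCast]; push_cast
    exact one_div_le_one_div_of_le (by positivity) (by linarith)
  have t1 : ‖∑ m ∈ Finset.range (n + 1), (1 / ((m : ℂ) + 1)) *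
        ((m * α (m - 1) + (2 * m + 1) * α m + (m + 1) * α (m + 1)) * z ^ m)‖ ≤ 3 / 2 * B := by
    refine (norm_sum_le _ _).trans (le_trans (le_of_eq ?_) (sum_div_le _ _ hB hB2))
    refine Finset.sum_congr rfl fun m _ => ?_
    rw [norm_mul, hcast, norm_mul, norm_pow, hz, one_pow, mul_one, mul_comm]
  have t2 : ‖z * (α n * z ^ n)‖ ≤ A := by
    rw [norm_mul, norm_mul, norm_pow, hz, one_pow, mul_one, one_mul]
    exact norm_le_of_sum hA hA2 (Nat.lt_succ_self n)
  have t3 : ‖z⁻¹ * α 0‖ ≤ A := by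
    rw [norm_mul, norm_inv, hz, inv_one, one_mul]
    exact norm_le_of_sum hA hA2 (Nat.succ_pos n)
  have t4 : ‖∑ m ∈ Finset.range (n + 1), (1 / ((m : ℂ) + 1)) * (α m * z ^ m)‖ ≤ 3 / 2 * A := by
    refine (norm_sum_le _ _).trans (le_trans (le_of_eq ?_) (sum_div_le (fun m => ‖α m‖) _ hA hA2))
    refine Finset.sum_congr rfl fun m _ => ?_
    rw [norm_mul, hcast, norm_mul, norm_pow, hz, one_pow, mul_one, mul_comm]
  have t5 : ‖∑ m ∈ Finset.range n, (1 / ((m : ℂ) + 2)) * (z * (α m * z ^ m))‖ ≤ 3 / 2 * A := by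
    have hA3 : ∑ m ∈ Finset.range n, ‖α m‖ ^ 2 ≤ A ^ 2 := by
      rw [Finset.sum_range_succ] at hA2
      linarith [sq_nonneg ‖α n‖]
    refine (norm_sum_le _ _).trans (le_trans (Finset.sum_le_sum ?_)
      (sum_div_le (fun m => ‖α m‖) _ hA hA3))
    intro m _
    rw [norm_mul, norm_mul, norm_mul, norm_pow, hz, one_pow, mul_one, one_mul, mul_comm]
    exact mul_le_mul_of_nonneg_left (hcast2 m) (norm_nonneg _)
  refine (norm_add_le _ _).trans ?_
  refine (add_le_add_left ((norm_add_le _ _).trans (add_le_add_left ((norm_add_le _ _).trans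
    (add_le_add_left (norm_add_le _ _) _)) _)) _).trans ?_
  linarith

/-- The constant in the discrete Sobolev inequality. -/
def supC (ℓ : ℝ) (p : ℕ) : ℝ := √(5 * (1 + ℓ) / (Real.pi * ℓ) * √p)

/-- With `A` the polynomial of the coordinates at `z = cay ℓ x`, the squared value is at most `2 wt
|A|²`. One factor `|A|` is paired with the weight and bounded uniformly in `p` by summation by
parts; the other costs `√p` by Cauchy–Schwarz. This is the origin of the growth `p^(1/4)` of `supC`.
-/
lemma abs_syn_le (hℓ : 0 < ℓ) (a : Coeff p) (x : ℝ) :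
    |syn ℓ a x| ≤ supC ℓ p * (‖a‖ + ‖J ℓ a‖) := by
  have hpi := Real.pi_pos
  rcases Nat.eq_zero_or_pos p with rfl | hp0
  · simp [syn]; unfold supC; positivity
  obtain ⟨n, hp⟩ : ∃ n, p = n + 1 := ⟨p - 1, by omega⟩
  set z := cay ℓ x with hz
  set A := ∑ m ∈ Finset.range p, cc a m * z ^ m with hA
  have hcov : ∑ m ∈ Finset.range p, cc a m * tau ℓ m x = tau ℓ 0 x * A := by
    rw [hA, Finset.mul_sum]
    exact Finset.sum_congr rfl fun m _ => by rw [tau_eq hℓ m x]; ring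
  have hb : ∑ m ∈ Finset.range p,
      ‖m * cc a (m - 1) + (2 * m + 1) * cc a m + (m + 1) * cc a (m + 1)‖ ^ 2 ≤
        (ℓ * ‖J ℓ a‖) ^ 2 := by
    rw [mul_pow, norm_sq_eq_cc, Finset.mul_sum]
    refine Finset.sum_le_sum fun m hm => le_of_eq ?_
    rw [cc_J hℓ a (Finset.mem_range.1 hm), norm_mul, norm_neg, norm_div, norm_I, norm_real,
      Real.norm_of_nonneg hℓ.le, mul_pow]
    field_simp
  have h1 := norm_cay_sum_le (B := ℓ * ‖J ℓ a‖) (cc a) n (cc_of_le a hp.le) (norm_cay hℓ x) (norm_nonneg a)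
    (by positivity) (by rw [← hp]; exact (norm_sq_eq_cc a).ge) (by rw [← hp]; exact hb)
  rw [← hz, ← hp, ← hA] at h1
  have h2 : ‖2 + z + z⁻¹‖ = 2 * Real.pi * ℓ * wt ℓ x := by
    have := wt_pos hℓ x
    rw [hz, ← wt_eq_cay hℓ, norm_real, Real.norm_of_nonneg (by positivity)]
  have h3 : ‖A‖ ≤ √p * ‖a‖ := by
    have := Finset.sum_mul_sq_le_sq_mul_sq (Finset.range p) (fun _ => (1 : ℝ)) fun m => ‖cc a m‖
    rw [← norm_sq_eq_cc] at this
    simp only [one_mul, one_pow, Finset.sum_const, Finset.card_range, nsmul_eq_mul, mul_one] at this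
    have h4 : ‖A‖ ≤ ∑ m ∈ Finset.range p, ‖cc a m‖ := by
      refine (norm_sum_le _ _).trans (le_of_eq (Finset.sum_congr rfl fun m _ => ?_))
      rw [norm_mul, norm_pow, hz, norm_cay hℓ, one_pow, mul_one]
    refine h4.trans (le_of_abs_le (abs_le_of_sq_le_sq ?_ (by positivity)))
    rw [mul_pow, Real.sq_sqrt (by positivity)]
    exact this
  have h5 : syn ℓ a x ^ 2 ≤ 2 * (wt ℓ x * ‖A‖ ^ 2) := by
    rw [syn_eq_cc, hcov, mul_pow, Real.sq_sqrt (by norm_num), ← norm_sq_tau hℓ 0 x, ← mul_pow,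
      ← norm_mul]
    have := Complex.abs_re_le_norm (tau ℓ 0 x * A)
    have h6 : (tau ℓ 0 x * A).re ^ 2 ≤ ‖tau ℓ 0 x * A‖ ^ 2 := by
      rw [← sq_abs]; gcongr
    linarith
  rw [h2] at h1
  have h7 : syn ℓ a x ^ 2 ≤ (supC ℓ p * (‖a‖ + ‖J ℓ a‖)) ^ 2 := by
    -- The two factors `‖A‖` are separated here: the first, with the weight, is bounded by `h1`, the
    -- second by `h3`.
    have e : wt ℓ x * ‖A‖ ^ 2 = 1 / (2 * Real.pi * ℓ) * (2 * Real.pi * ℓ * wt ℓ x * ‖A‖) * ‖A‖ := by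
      field_simp
    have h8 : wt ℓ x * ‖A‖ ^ 2 ≤
        1 / (2 * Real.pi * ℓ) * (5 * (‖a‖ + ℓ * ‖J ℓ a‖)) * (√p * ‖a‖) := by
      rw [e]; gcongr
    rw [mul_pow, supC, Real.sq_sqrt (by positivity)]
    refine h5.trans ((mul_le_mul_of_nonneg_left h8 zero_le_two).trans ?_)
    have e2 : 2 * (1 / (2 * Real.pi * ℓ) * (5 * (‖a‖ + ℓ * ‖J ℓ a‖)) * (√p * ‖a‖)) =
        5 / (Real.pi * ℓ) * √p * ((‖a‖ + ℓ * ‖J ℓ a‖) * ‖a‖) := by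
      field_simp
    have e3 : 5 * (1 + ℓ) / (Real.pi * ℓ) * √p * (‖a‖ + ‖J ℓ a‖) ^ 2 =
        5 / (Real.pi * ℓ) * √p * ((1 + ℓ) * (‖a‖ + ‖J ℓ a‖) ^ 2) := by ring
    rw [e2, e3]
    refine mul_le_mul_of_nonneg_left ?_ (by positivity)
    have ha := norm_nonneg a
    have hj := norm_nonneg (J ℓ a)
    have h9 : ‖a‖ + ℓ * ‖J ℓ a‖ ≤ (1 + ℓ) * (‖a‖ + ‖J ℓ a‖) := by nlinarith
    calc (‖a‖ + ℓ * ‖J ℓ a‖) * ‖a‖ ≤ ((1 + ℓ) * (‖a‖ + ‖J ℓ a‖)) * (‖a‖ + ‖J ℓ a‖) := by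
          gcongr; linarith
      _ = _ := by ring
  exact abs_le_of_sq_le_sq h7 (by unfold supC; positivity)

end MTC
end

noncomputable section
namespace MTC
open Complex ComplexConjugate

variable {ℓ : ℝ} {p : ℕ}

/-! ### Classes of square integrable functions -/

lemma toL2_eq {f : ℝ → ℝ} (h : MemLp f 2 volume) : toL2 f = h.toLp f := dif_pos h

lemma toL2C_eq {f : ℝ → ℂ} (h : MemLp f 2 volume) : toL2C f = h.toLp f := dif_pos h

lemma coeFn_toL2 {f : ℝ → ℝ} (h : MemLp f 2 volume) : toL2 f =ᵐ[volume] f := by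
  rw [toL2_eq h]; exact h.coeFn_toLp

lemma coeFn_toL2C {f : ℝ → ℂ} (h : MemLp f 2 volume) : toL2C f =ᵐ[volume] f := by
  rw [toL2C_eq h]; exact h.coeFn_toLp

lemma toL2_coe (f : Lp ℝ 2 (volume : Measure ℝ)) : toL2 f = f := by
  rw [toL2_eq (Lp.memLp f), Lp.toLp_coeFn]

lemma toL2_congr {f g : ℝ → ℝ} (h : f =ᵐ[volume] g) : toL2 f = toL2 g := by
  by_cases hf : MemLp f 2 volume
  · have hg : MemLp g 2 volume := (memLp_congr_ae h).1 hf
    rw [toL2_eq hf, toL2_eq hg, MemLp.toLp_eq_toLp_iff]; exact h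
  · have hg : ¬ MemLp g 2 volume := fun hg => hf ((memLp_congr_ae h).2 hg)
    rw [toL2, toL2, dif_neg hf, dif_neg hg]

lemma toL2C_congr {f g : ℝ → ℂ} (h : f =ᵐ[volume] g) : toL2C f = toL2C g := by
  by_cases hf : MemLp f 2 volume
  · have hg : MemLp g 2 volume := (memLp_congr_ae h).1 hf
    rw [toL2C_eq hf, toL2C_eq hg, MemLp.toLp_eq_toLp_iff]; exact h
  · have hg : ¬ MemLp g 2 volume := fun hg => hf ((memLp_congr_ae h).2 hg)
    rw [toL2C, toL2C, dif_neg hf, dif_neg hg]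

lemma toL2_add {f g : ℝ → ℝ} (hf : MemLp f 2 volume) (hg : MemLp g 2 volume) :
    toL2 (fun x => f x + g x) = toL2 f + toL2 g := by
  rw [toL2_eq hf, toL2_eq hg, ← MemLp.toLp_add]; exact toL2_eq (hf.add hg)

lemma toL2_sub {f g : ℝ → ℝ} (hf : MemLp f 2 volume) (hg : MemLp g 2 volume) :
    toL2 (fun x => f x - g x) = toL2 f - toL2 g := by
  rw [toL2_eq hf, toL2_eq hg, ← MemLp.toLp_sub]; exact toL2_eq (hf.sub hg)

lemma toL2_const_mul {f : ℝ → ℝ} (c : ℝ) (hf : MemLp f 2 volume) :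
    toL2 (fun x => c * f x) = c • toL2 f := by
  rw [toL2_eq hf, ← MemLp.toLp_const_smul]; exact toL2_eq (hf.const_smul c)

lemma toL2C_add {f g : ℝ → ℂ} (hf : MemLp f 2 volume) (hg : MemLp g 2 volume) :
    toL2C (fun x => f x + g x) = toL2C f + toL2C g := by
  rw [toL2C_eq hf, toL2C_eq hg, ← MemLp.toLp_add]; exact toL2C_eq (hf.add hg)

lemma toL2C_const_mul {f : ℝ → ℂ} (c : ℂ) (hf : MemLp f 2 volume) :
    toL2C (fun x => c * f x) = c • toL2C f := by
  rw [toL2C_eq hf, ← MemLp.toLp_const_smul]; exact toL2C_eq (hf.const_smul c)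

/-! ### The Hilbert transform as a bounded operator -/

lemma memLp_sign_mul (F : Lp ℂ 2 (volume : Measure ℝ)) :
    MemLp (fun ξ : ℝ => -I * ((SignType.sign ξ : ℝ) : ℂ) * F ξ) 2 volume := by
  refine (Lp.memLp F).of_le ?_ (Eventually.of_forall fun ξ => ?_)
  · refine AEStronglyMeasurable.mul ?_ (Lp.aestronglyMeasurable F)
    refine (Measurable.const_mul (Complex.measurable_ofReal.comp ?_) _).aestronglyMeasurable
    have : (fun ξ : ℝ => ((SignType.sign ξ : SignType) : ℝ)) =
        fun ξ => if 0 < ξ then 1 else if ξ < 0 then -1 else 0 := by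
      ext ξ
      rcases lt_trichotomy ξ 0 with h | h | h
      · simp [h, h.not_gt]
      · simp [h]
      · simp [h]
    rw [this]
    exact Measurable.ite measurableSet_Ioi measurable_const
      (Measurable.ite measurableSet_Iio measurable_const measurable_const)
  · rw [norm_mul, norm_mul, norm_neg, norm_I, one_mul]
    refine mul_le_of_le_one_left (norm_nonneg _) ?_
    rcases lt_trichotomy ξ 0 with h | h | h <;> simp [h]

/-- Multiplication by the symbol `-i sgn ξ` on `L²(ℝ; ℂ)`. -/
def signMul : Lp ℂ 2 (volume : Measure ℝ) →L[ℂ] Lp ℂ 2 (volume : Measure ℝ) :=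
  LinearMap.mkContinuous
    { toFun := fun F => toL2C fun ξ => -I * ((SignType.sign ξ : ℝ) : ℂ) * F ξ
      map_add' := fun F G => by
        rw [← toL2C_add (memLp_sign_mul F) (memLp_sign_mul G)]
        refine toL2C_congr ?_
        filter_upwards [Lp.coeFn_add F G] with ξ h
        simp only [h, Pi.add_apply]; ring
      map_smul' := fun c F => by
        rw [RingHom.id_apply, ← toL2C_const_mul c (memLp_sign_mul F)]
        refine toL2C_congr ?_
        filter_upwards [Lp.coeFn_smul c F] with ξ h
        simp only [h, Pi.smul_apply, smul_eq_mul]; ring } 1 fun F => by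
    rw [one_mul]
    refine Lp.norm_le_norm_of_ae_le ?_
    filter_upwards [coeFn_toL2C (memLp_sign_mul F)] with ξ h
    simp only [LinearMap.coe_mk, AddHom.coe_mk, h]
    rw [norm_mul, norm_mul, norm_neg, norm_I, one_mul]
    refine mul_le_of_le_one_left (norm_nonneg _) ?_
    rcases lt_trichotomy ξ 0 with h | h | h <;> simp [h]

/-- The Hilbert transform on `L²(ℝ; ℂ)`. -/
def hilC : Lp ℂ 2 (volume : Measure ℝ) →L[ℂ] Lp ℂ 2 (volume : Measure ℝ) :=
  ((Lp.fourierTransformₗᵢ ℝ ℂ).symm.toContinuousLinearEquiv.toContinuousLinearMap).comp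
    (signMul.comp (Lp.fourierTransformₗᵢ ℝ ℂ).toContinuousLinearEquiv.toContinuousLinearMap)

lemma hilC_apply (F : Lp ℂ 2 (volume : Measure ℝ)) : hilC F = 𝓕⁻ (signMul (𝓕 F)) := rfl

lemma hilbert_eq (f : ℝ → ℝ) : hilbert f = fun x => (hilC (toL2C fun y => (f y : ℂ)) x).re := rfl

lemma memLp_hilbert (f : ℝ → ℝ) : MemLp (hilbert f) 2 volume :=
  (Lp.memLp (hilC (toL2C fun y => (f y : ℂ)))).re

/-- The Hilbert transform on `L²(ℝ; ℝ)`. -/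
def hilR : Lp ℝ 2 (volume : Measure ℝ) →L[ℝ] Lp ℝ 2 (volume : Measure ℝ) :=
  (Complex.reCLM.compLpL 2 volume).comp
    ((hilC.restrictScalars ℝ).comp (Complex.ofRealCLM.compLpL 2 volume))

lemma toL2_hilbert {f : ℝ → ℝ} (hf : MemLp f 2 volume) : toL2 (hilbert f) = hilR (toL2 f) := by
  have h1 : Complex.ofRealCLM.compLpL 2 volume (toL2 f) = toL2C fun y => (f y : ℂ) := by
    have hfC : MemLp (fun y => (f y : ℂ)) 2 volume := hf.ofReal
    refine Lp.ext ?_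
    filter_upwards [Complex.ofRealCLM.coeFn_compLpL (toL2 f), coeFn_toL2C hfC,
      coeFn_toL2 hf] with x h1 h2 h3
    rw [h1, h2, h3]; rfl
  have h2 : hilR (toL2 f) = Complex.reCLM.compLpL 2 volume (hilC (toL2C fun y => (f y : ℂ))) := by
    rw [← h1]; rfl
  rw [h2]
  refine Lp.ext ?_
  filter_upwards [Complex.reCLM.coeFn_compLpL (hilC (toL2C fun y => (f y : ℂ))),
    coeFn_toL2 (memLp_hilbert f)] with x h3 h4
  rw [h3, h4]; rfl

/-! ### The Fourier transform on the intersection of `L¹` and `L²` -/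

/-- L² embeds injectively into the tempered distributions, so it suffices to test against Schwartz
functions. There the claim is the multiplication formula, which moves the inverse transform from the
test function to the integrable `g`. -/
lemma fourierInv_toL2C {g : ℝ → ℂ} (h1 : Integrable g) (h2 : MemLp g 2 volume)
    (h3 : MemLp (𝓕⁻ g) 2 volume) : 𝓕⁻ (toL2C g) = toL2C (𝓕⁻ g) := by
  have hinj : Function.Injective (Lp.toTemperedDistributionCLM ℂ (volume : Measure ℝ) 2) :=
    LinearMap.ker_eq_bot.1 Lp.ker_toTemperedDistributionCLM_eq_bot
  apply hinj
  rw [Lp.toTemperedDistributionCLM_apply, Lp.toTemperedDistributionCLM_apply,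
    ← Lp.fourierInv_toTemperedDistribution_eq]
  ext ψ
  rw [TemperedDistribution.fourierInv_apply, Lp.toTemperedDistribution_apply,
    Lp.toTemperedDistribution_apply]
  have e1 : ∫ x, 𝓕⁻ ψ x • toL2C g x = ∫ x, 𝓕⁻ (⇑ψ) x • g x := by
    refine integral_congr_ae ?_
    filter_upwards [coeFn_toL2C h2] with x hx
    rw [hx, SchwartzMap.fourierInv_coe]
  have e2 : ∫ x, ψ x • toL2C (𝓕⁻ g) x = ∫ x, ψ x • 𝓕⁻ g x := by
    refine integral_congr_ae ?_
    filter_upwards [coeFn_toL2C h3] with x hx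
    rw [hx]
  rw [e1, e2]
  have hc : Continuous fun q : ℝ × ℝ => (-innerₗ ℝ) q.1 q.2 :=
    (continuous_inner (𝕜 := ℝ) (E := ℝ)).neg
  have := VectorFourier.integral_fourierIntegral_smul_eq_flip (e := Real.fourierChar)
    (μ := volume) (ν := volume) (L := -innerₗ ℝ) Real.continuous_fourierChar hc
    (SchwartzMap.integrable ψ) h1
  have hflip : (-innerₗ ℝ : ℝ →ₗ[ℝ] ℝ →ₗ[ℝ] ℝ).flip = -innerₗ ℝ := by
    ext; simp
  rw [hflip] at this
  exact this

/-! ### Laplace integrals of monomials -/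

lemma integrableOn_pow_mul_exp (m : ℕ) {c : ℂ} (hc : 0 < c.re) :
    IntegrableOn (fun t : ℝ => (t : ℂ) ^ m * exp (-c * t)) (Ioi 0) := by
  have h := integrableOn_rpow_mul_exp_neg_mul_rpow (p := 1) (s := m) (b := c.re)
    (by have := (Nat.cast_nonneg m : (0 : ℝ) ≤ m); linarith) one_pos hc
  refine h.mono' ?_ ?_
  · exact (Continuous.aestronglyMeasurable (by fun_prop))
  · refine (ae_restrict_iff' measurableSet_Ioi).2 (Eventually.of_forall fun t ht => ?_)
    rw [norm_mul, norm_pow, norm_real, Real.norm_of_nonneg (le_of_lt ht), Complex.norm_exp,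
      Real.rpow_natCast, Real.rpow_one]
    simp

lemma tendsto_pow_mul_exp (m : ℕ) {c : ℂ} (hc : 0 < c.re) :
    Tendsto (fun t : ℝ => (t : ℂ) ^ m * exp (-c * t)) atTop (𝓝 0) := by
  rw [tendsto_zero_iff_norm_tendsto_zero]
  have h := Real.tendsto_pow_mul_exp_neg_atTop_nhds_zero m
  have h2 := (h.comp (tendsto_id.const_mul_atTop hc)).const_mul ((1 / c.re) ^ m)
  rw [mul_zero] at h2
  refine h2.congr' ?_
  filter_upwards [eventually_ge_atTop 0] with t ht
  rw [norm_mul, norm_pow, norm_real, Real.norm_of_nonneg ht, Complex.norm_exp]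
  simp only [Function.comp, id]
  rw [mul_pow, ← mul_assoc, ← mul_assoc, ← mul_pow, one_div_mul_cancel hc.ne', one_pow, one_mul]
  simp

lemma integral_pow_mul_exp (m : ℕ) {c : ℂ} (hc : 0 < c.re) :
    ∫ t in Ioi (0 : ℝ), (t : ℂ) ^ m * exp (-c * t) = m.factorial / c ^ (m + 1) := by
  have hc0 : c ≠ 0 := by rintro rfl; simp at hc
  induction m with
  | zero =>
    have := integral_exp_mul_complex_Ioi (a := -c) (by simpa using hc) 0
    simp only [pow_zero, one_mul, this]
    simp
  | succ m ih =>
    have hd : ∀ t ∈ Ici (0 : ℝ), HasDerivAt (fun t : ℝ => (t : ℂ) ^ (m + 1) * exp (-c * t))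
        ((m + 1) * ((t : ℂ) ^ m * exp (-c * t)) - c * ((t : ℂ) ^ (m + 1) * exp (-c * t))) t := by
      intro t _
      have hx : HasDerivAt (fun y : ℝ => (y : ℂ)) 1 t := Complex.ofRealCLM.hasDerivAt
      have h1 := (hx.pow (m + 1)).mul ((hx.const_mul (-c)).cexp)
      refine h1.congr_deriv ?_
      simp only [Pi.pow_apply, Nat.add_sub_cancel]
      push_cast
      ring
    have i1 := (integrableOn_pow_mul_exp m hc).const_mul ((m : ℂ) + 1)
    have i2 := (integrableOn_pow_mul_exp (m + 1) hc).const_mul c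
    have h := integral_Ioi_of_hasDerivAt_of_tendsto' hd (i1.sub i2) (tendsto_pow_mul_exp (m + 1) hc)
    rw [integral_sub i1 i2, integral_const_mul, integral_const_mul, ih] at h
    simp only [ofReal_zero, ne_eq, Nat.add_eq_zero_iff, one_ne_zero, and_false, not_false_eq_true,
      zero_pow, zero_mul, sub_zero] at h
    have h2 : c * ∫ t in Ioi (0 : ℝ), (t : ℂ) ^ (m + 1) * exp (-c * t) =
        (m + 1) * (m.factorial / c ^ (m + 1)) := by linear_combination -h
    apply mul_left_cancel₀ hc0
    rw [h2, Nat.factorial_succ]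
    push_cast
    field_simp
    ring

end MTC
end

noncomputable section
namespace MTC
open Complex ComplexConjugate

variable {ℓ : ℝ} {p : ℕ}

/-! ### Eigenfunctions of the Hilbert transform -/

/-- A square integrable eigenfunction of the Hilbert transform. -/
def IsEig (c : ℂ) (f : ℝ → ℂ) : Prop := MemLp f 2 volume ∧ hilC (toL2C f) = c • toL2C f

lemma IsEig.add {c : ℂ} {f g : ℝ → ℂ} (hf : IsEig c f) (hg : IsEig c g) :
    IsEig c fun x => f x + g x :=
  ⟨hf.1.add hg.1, by rw [toL2C_add hf.1 hg.1, map_add, hf.2, hg.2, smul_add]⟩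

lemma IsEig.const_mul {c : ℂ} {f : ℝ → ℂ} (a : ℂ) (hf : IsEig c f) : IsEig c fun x => a * f x :=
  ⟨hf.1.const_smul a, by rw [toL2C_const_mul a hf.1, map_smul, hf.2, smul_comm]⟩

lemma IsEig.sum {c : ℂ} {ι : Type*} (s : Finset ι) {f : ι → ℝ → ℂ} (hf : ∀ i ∈ s, IsEig c (f i)) :
    IsEig c fun x => ∑ i ∈ s, f i x := by
  classical
  induction s using Finset.induction_on with
  | empty =>
    have h0 : toL2C (fun _ => 0) = 0 := by
      have := toL2C_const_mul 0 (Lp.memLp (0 : Lp ℂ 2 (volume : Measure ℝ)))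
      simpa using this
    simp only [Finset.sum_empty]
    exact ⟨MemLp.zero, by rw [h0, map_zero, smul_zero]⟩
  | insert i s hi ih =>
    simp only [Finset.sum_insert hi]
    exact (hf i (Finset.mem_insert_self i s)).add
      (ih fun j hj => hf j (Finset.mem_insert_of_mem hj))

/-- The Hilbert transform is diagonal on the Fourier side; its symbol is constant on each half-line,
so a function whose Fourier transform lives on one half-line is an eigenfunction. -/
lemma isEig_fourierInv {c : ℂ} {g : ℝ → ℂ} (h1 : Integrable g) (h2 : MemLp g 2 volume)
    (h3 : MemLp (𝓕⁻ g) 2 volume)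
    (h : ∀ ξ : ℝ, -I * ((SignType.sign ξ : ℝ) : ℂ) * g ξ = c * g ξ) : IsEig c (𝓕⁻ g) := by
  refine ⟨h3, ?_⟩
  have hs : signMul (toL2C g) = c • toL2C g := by
    rw [← toL2C_const_mul c h2]
    refine toL2C_congr ?_
    filter_upwards [coeFn_toL2C h2] with ξ hξ
    rw [hξ, h]
  rw [← fourierInv_toL2C h1 h2 h3, hilC_apply, FourierTransform.fourier_fourierInv_eq, hs,
    FourierTransform.fourierInv_smul]

lemma norm_sq_den (x : ℝ) : ‖(ℓ : ℂ) - 2 * I * x‖ ^ 2 = ℓ ^ 2 + 4 * x ^ 2 := by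
  rw [← Complex.normSq_eq_norm_sq, Complex.normSq_apply]
  simp
  ring

lemma memLp_of_norm_sq_le (hℓ : 0 < ℓ) {f : ℝ → ℂ} (hf : Continuous f) (K : ℝ)
    (h : ∀ x, ‖f x‖ ^ 2 ≤ K * wt ℓ x) : MemLp f 2 volume := by
  rw [memLp_two_iff_integrable_sq_norm hf.aestronglyMeasurable]
  refine ((integrable_wt hℓ).const_mul K).mono' (hf.norm.pow 2).aestronglyMeasurable
    (Eventually.of_forall fun x => ?_)
  rw [Real.norm_of_nonneg (by positivity)]
  exact h x

lemma memLp_pole (hℓ : 0 < ℓ) (k : ℕ) :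
    MemLp (fun x : ℝ => 1 / ((ℓ : ℂ) - 2 * I * x) ^ (k + 1)) 2 volume := by
  have hpi := Real.pi_pos
  refine memLp_of_norm_sq_le hℓ ?_ (Real.pi / (2 * ℓ) * (1 / (ℓ ^ 2) ^ k)) fun x => ?_
  · exact continuous_const.div (by fun_prop) fun x => pow_ne_zero _ (den_ne hℓ x)
  · rw [norm_div, norm_one, norm_pow, div_pow, one_pow, ← pow_mul, mul_comm (k + 1), pow_mul,
      norm_sq_den, wt, pow_succ]
    have e : Real.pi / (2 * ℓ) * (1 / (ℓ ^ 2) ^ k) * (2 * ℓ / Real.pi / (ℓ ^ 2 + 4 * x ^ 2)) =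
        1 / ((ℓ ^ 2) ^ k * (ℓ ^ 2 + 4 * x ^ 2)) := by
      have := (sq_pos hℓ x).ne'
      field_simp
    rw [e]
    have h1 : ℓ ^ 2 ≤ ℓ ^ 2 + 4 * x ^ 2 := by nlinarith [sq_nonneg x]
    have := sq_pos hℓ x
    gcongr

/-- The Fourier transform of a function with a single pole in the lower half-plane. -/
def poleFT (ℓ : ℝ) (k : ℕ) : ℝ → ℂ :=
  indicator (Ioi 0) fun t : ℝ => (t : ℂ) ^ k * exp (-((Real.pi * ℓ : ℝ) : ℂ) * t)

lemma integrable_poleFT (hℓ : 0 < ℓ) (k : ℕ) : Integrable (poleFT ℓ k) := by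
  have := Real.pi_pos
  rw [poleFT, integrable_indicator_iff measurableSet_Ioi]
  exact integrableOn_pow_mul_exp k (by rw [ofReal_re]; positivity)

lemma memLp_poleFT (hℓ : 0 < ℓ) (k : ℕ) : MemLp (poleFT ℓ k) 2 volume := by
  have hpi := Real.pi_pos
  rw [memLp_two_iff_integrable_sq_norm (integrable_poleFT hℓ k).aestronglyMeasurable]
  have h : Integrable (indicator (Ioi 0) fun t : ℝ =>
      (t : ℂ) ^ (2 * k) * exp (-((2 * (Real.pi * ℓ) : ℝ) : ℂ) * t)) := by
    rw [integrable_indicator_iff measurableSet_Ioi]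
    exact integrableOn_pow_mul_exp (2 * k) (by rw [ofReal_re]; positivity)
  refine h.norm.congr (Eventually.of_forall fun t => ?_)
  by_cases ht : t ∈ Ioi (0 : ℝ)
  · simp only [poleFT, indicator_of_mem ht]
    rw [norm_mul, norm_mul, mul_pow, norm_pow, norm_pow, ← pow_mul, mul_comm k 2, ← norm_pow (exp _),
      ← Complex.exp_nat_mul]
    congr 3
    push_cast
    ring
  · simp only [poleFT, indicator_of_notMem ht]
    simp

lemma fourierInv_poleFT (hℓ : 0 < ℓ) (k : ℕ) (x : ℝ) :
    𝓕⁻ (poleFT ℓ k) x = k.factorial / (Real.pi : ℂ) ^ (k + 1) *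
      (1 / ((ℓ : ℂ) - 2 * I * x) ^ (k + 1)) := by
  have hpi := Real.pi_pos
  have hc : 0 < ((Real.pi : ℂ) * ((ℓ : ℂ) - 2 * I * x)).re := by
    rw [re_ofReal_mul]
    simp
    positivity
  have h := integral_pow_mul_exp k hc
  rw [Real.fourierInv_eq']
  have e : ∀ t : ℝ, exp ((↑(2 * Real.pi * inner ℝ t x) : ℂ) * I) • poleFT ℓ k t =
      indicator (Ioi 0) (fun t : ℝ => (t : ℂ) ^ k *
        exp (-((Real.pi : ℂ) * ((ℓ : ℂ) - 2 * I * x)) * t)) t := by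
    intro t
    by_cases ht : t ∈ Ioi (0 : ℝ)
    · simp only [poleFT, indicator_of_mem ht, smul_eq_mul]
      rw [mul_left_comm, ← Complex.exp_add]
      congr 2
      simp
      ring
    · simp only [poleFT, indicator_of_notMem ht, smul_zero]
  simp_rw [e]
  rw [integral_indicator measurableSet_Ioi, h, mul_pow]
  have h1 := den_ne hℓ x
  have h2 : (Real.pi : ℂ) ≠ 0 := by exact_mod_cast hpi.ne'
  field_simp

lemma pi_pow_ne (k : ℕ) : (k.factorial : ℂ) / (Real.pi : ℂ) ^ (k + 1) ≠ 0 :=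
  div_ne_zero (by exact_mod_cast k.factorial_ne_zero)
    (pow_ne_zero _ (by exact_mod_cast Real.pi_ne_zero))

/-- The inverse Fourier transform of `poleFT ℓ k` is a Laplace integral, a nonzero multiple of this
pole function. The factor `1 *` matches the parameter `s` of `isEig_ratio`, which also serves the
reflected case `s = -1`. -/
lemma isEig_pole (hℓ : 0 < ℓ) (k : ℕ) :
    IsEig (-I) fun x : ℝ => 1 / ((ℓ : ℂ) - 2 * I * ((1 * x : ℝ) : ℂ)) ^ (k + 1) := by
  have hF : 𝓕⁻ (poleFT ℓ k) = fun x : ℝ => k.factorial / (Real.pi : ℂ) ^ (k + 1) *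
      (1 / ((ℓ : ℂ) - 2 * I * x) ^ (k + 1)) := funext (fourierInv_poleFT hℓ k)
  have h := isEig_fourierInv (c := -I) (integrable_poleFT hℓ k) (memLp_poleFT hℓ k)
    (by rw [hF]; exact (memLp_pole hℓ k).const_mul _) fun ξ => by
      by_cases ht : ξ ∈ Ioi (0 : ℝ)
      · rw [sign_pos ht]; simp
      · simp only [poleFT, indicator_of_notMem ht, mul_zero]
  have h2 := h.const_mul (k.factorial / (Real.pi : ℂ) ^ (k + 1))⁻¹
  simp only [hF, inv_mul_cancel_left₀ (pi_pow_ne k)] at h2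
  simpa using h2

lemma isEig_pole_neg (hℓ : 0 < ℓ) (k : ℕ) :
    IsEig I fun x : ℝ => 1 / ((ℓ : ℂ) - 2 * I * ((-1 * x : ℝ) : ℂ)) ^ (k + 1) := by
  have hF : 𝓕⁻ (fun x => poleFT ℓ k (-x)) = fun x : ℝ => k.factorial / (Real.pi : ℂ) ^ (k + 1) *
      (1 / ((ℓ : ℂ) - 2 * I * ((-1 * x : ℝ) : ℂ)) ^ (k + 1)) := by
    ext x
    have := Real.fourierInv_comp_linearIsometry (LinearIsometryEquiv.neg ℝ) (poleFT ℓ k) x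
    rw [show (fun x => poleFT ℓ k (-x)) = poleFT ℓ k ∘ (LinearIsometryEquiv.neg ℝ (E := ℝ))
      from rfl, this, fourierInv_poleFT hℓ k]
    simp
  have hm := (memLp_pole hℓ k).comp_measurePreserving (Measure.measurePreserving_neg volume)
  have h := isEig_fourierInv (c := I) (g := fun x => poleFT ℓ k (-x)) (integrable_poleFT hℓ k).comp_neg
    ((memLp_poleFT hℓ k).comp_measurePreserving (Measure.measurePreserving_neg volume))
    (by
      rw [hF]
      refine MemLp.const_mul ?_ _
      simpa [Function.comp_def] using hm) fun ξ => by
      by_cases ht : -ξ ∈ Ioi (0 : ℝ)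
      · rw [sign_neg (by simpa using ht)]; simp
      · simp only [poleFT, indicator_of_notMem ht, mul_zero]
  have h2 := h.const_mul (k.factorial / (Real.pi : ℂ) ^ (k + 1))⁻¹
  simp only [hF, inv_mul_cancel_left₀ (pi_pow_ne k)] at h2
  exact h2

/-- Induction by partial fractions: one factor of the numerator is replaced through `ℓ + 2iy = 2ℓ -
(ℓ - 2iy)`, which leaves a combination of two ratios of lower numerator degree. -/
lemma isEig_ratio (hℓ : 0 < ℓ) {c : ℂ} {s : ℝ}
    (h : ∀ k : ℕ, IsEig c fun x : ℝ => 1 / ((ℓ : ℂ) - 2 * I * ((s * x : ℝ) : ℂ)) ^ (k + 1)) (m : ℕ) :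
    ∀ k ≥ m, IsEig c fun x : ℝ => ((ℓ : ℂ) + 2 * I * ((s * x : ℝ) : ℂ)) ^ m /
      ((ℓ : ℂ) - 2 * I * ((s * x : ℝ) : ℂ)) ^ (k + 1) := by
  induction m with
  | zero => intro k _; simpa only [pow_zero] using h k
  | succ m ih =>
    intro k hk
    obtain ⟨k, rfl⟩ : ∃ j, k = j + 1 := ⟨k - 1, by omega⟩
    have h1 := ((ih (k + 1) (by omega)).const_mul (2 * ℓ)).add ((ih k (by omega)).const_mul (-1))
    convert h1 using 2 with x
    have := den_ne hℓ (s * x)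
    field_simp
    ring

lemma isEig_tau (hℓ : 0 < ℓ) (m : ℕ) : IsEig (-I) (tau ℓ m) := by
  have := (isEig_ratio hℓ (isEig_pole hℓ) m m le_rfl).const_mul (√(2 * ℓ / Real.pi) : ℂ)
  convert this using 2 with x
  unfold tau
  rw [one_mul, mul_div_assoc]

lemma isEig_conj_tau (hℓ : 0 < ℓ) (m : ℕ) : IsEig I fun x => conj (tau ℓ m x) := by
  have := (isEig_ratio hℓ (isEig_pole_neg hℓ) m m le_rfl).const_mul (√(2 * ℓ / Real.pi) : ℂ)
  convert this using 2 with x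
  rw [conj_tau, mul_div_assoc]
  push_cast
  ring_nf

/-- `syn ℓ a` is the sum of a combination of the `tau ℓ m` and its conjugate, with eigenvalues `-i`
and `i`. The transform replaces `√2 Re W` by `√2 Im W = √2 Re (-i W)`, which on coordinates is
multiplication by `-i`. The equality is almost everywhere because `hilbert` is defined through an L²
class. -/
lemma hilbert_syn (hℓ : 0 < ℓ) (a : Coeff p) : hilbert (syn ℓ a) =ᵐ[volume] syn ℓ (hil p a) := by
  set W : ℝ → ℂ := fun x => ∑ m ∈ Finset.range p, cc a m * tau ℓ m x with hW
  have h1 : IsEig (-I) W := IsEig.sum _ fun m _ => (isEig_tau hℓ m).const_mul _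
  have h2 : IsEig I fun x => conj (W x) := by
    have : IsEig I fun x => ∑ m ∈ Finset.range p, conj (cc a m) * conj (tau ℓ m x) :=
      IsEig.sum _ fun m _ => (isEig_conj_tau hℓ m).const_mul _
    simpa [hW] using this
  have hs : (fun y => (syn ℓ a y : ℂ)) =
      fun y => (√2 / 2 : ℂ) * W y + (√2 / 2 : ℂ) * conj (W y) := by
    ext y
    rw [syn_eq_cc, ← mul_add, Complex.add_conj]
    push_cast
    ring
  have h1' := h1.const_mul (√2 / 2)
  have h2' := h2.const_mul (√2 / 2)
  have hH : hilC (toL2C fun y => (syn ℓ a y : ℂ)) =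
      toL2C fun y => -I * ((√2 / 2 : ℂ) * W y) + I * ((√2 / 2 : ℂ) * conj (W y)) := by
    rw [hs, toL2C_add h1'.1 h2'.1, map_add, h1'.2, h2'.2, ← toL2C_const_mul _ h1'.1,
      ← toL2C_const_mul _ h2'.1, toL2C_add (h1'.1.const_mul _) (h2'.1.const_mul _)]
  rw [hilbert_eq, hH]
  filter_upwards [coeFn_toL2C ((h1'.1.const_mul (-I)).add (h2'.1.const_mul I))] with x hx
  have e1 : -I * ((√2 / 2 : ℂ) * W x) + I * ((√2 / 2 : ℂ) * conj (W x)) =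
      ((√2 * (W x).im : ℝ) : ℂ) := by
    have := Complex.sub_conj (W x)
    push_cast at this ⊢
    linear_combination (-I * (√2 / 2)) * this - (√2 * (W x).im : ℂ) * I_sq
  have hx' : (toL2C fun y => -I * ((√2 / 2 : ℂ) * W y) + I * ((√2 / 2 : ℂ) * conj (W y))) x =
      -I * ((√2 / 2 : ℂ) * W x) + I * ((√2 / 2 : ℂ) * conj (W x)) := hx
  rw [hx', e1, ofReal_re, syn_eq_cc]
  simp_rw [cc_hil, mul_assoc, ← Finset.mul_sum]
  congr 1
  rw [show ∑ m ∈ Finset.range p, cc a m * tau ℓ m x = W x from rfl]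
  simp

end MTC
end

noncomputable section
namespace MTC

/-! ### Gronwall estimates -/

/-- The differential Gronwall inequality is applied to the right-hand side of the hypothesis, whose
derivative `K * y` is at most `K` times itself. -/
lemma gronwall_integral {y : ℝ → ℝ} {A K τ : ℝ} (hτ : 0 ≤ τ) (hy : ContinuousOn y (Icc 0 τ))
    (hK : 0 ≤ K) (h : ∀ t ∈ Icc 0 τ, y t ≤ A + K * ∫ s in (0 : ℝ)..t, y s) :
    y τ ≤ A * Real.exp (K * τ) := by
  have hyint : ∀ t ∈ Icc 0 τ, IntervalIntegrable y volume 0 t := fun t ht =>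
    (hy.mono (by rw [uIcc_of_le ht.1]; exact Icc_subset_Icc_right ht.2)).intervalIntegrable
  have hder : ∀ t ∈ Icc 0 τ, HasDerivWithinAt (fun t => A + K * ∫ s in (0 : ℝ)..t, y s) (K * y t)
      (Icc 0 τ) t := fun t ht => by
    have : Fact (t ∈ Icc 0 τ) := ⟨ht⟩
    have := intervalIntegral.integral_hasDerivWithinAt_right (s := Icc 0 τ) (t := Icc 0 τ) (hyint t ht)
      (hy.stronglyMeasurableAtFilter_nhdsWithin measurableSet_Icc t) (hy t ht)
    exact (this.const_mul K).const_add A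
  have hg := le_gronwallBound_of_liminf_deriv_right_le (K := K) (δ := A) (ε := 0)
    (f := fun t => A + K * ∫ s in (0 : ℝ)..t, y s) (f' := fun t => K * y t) (a := 0) (b := τ)
    (fun t ht => (hder t ht).continuousWithinAt)
    (fun t ht r hr => by
      have h1 : HasDerivWithinAt (fun t => A + K * ∫ s in (0 : ℝ)..t, y s) (K * y t) (Ici t) t :=
        (hder t ⟨ht.1, ht.2.le⟩).mono_of_mem_nhdsWithin
          (mem_of_superset (Icc_mem_nhdsGE ht.2) (Icc_subset_Icc_left ht.1))
      exact h1.liminf_right_slope_le hr)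
    (by simp) (fun t ht => by
      rw [add_zero]
      exact mul_le_mul_of_nonneg_left (h t ⟨ht.1, ht.2.le⟩) hK) τ ⟨hτ, le_rfl⟩
  rw [gronwallBound_ε0, sub_zero] at hg
  exact (h τ ⟨hτ, le_rfl⟩).trans hg

lemma sub_le_integral_of_hasDerivWithinAt {y y' φ : ℝ → ℝ} {τ : ℝ} (hτ : 0 ≤ τ)
    (hy : ∀ t ∈ Icc 0 τ, HasDerivWithinAt y (y' t) (Icc 0 τ) t) (hφ : ContinuousOn φ (Icc 0 τ))
    (h : ∀ t ∈ Icc 0 τ, y' t ≤ φ t) : y τ - y 0 ≤ ∫ t in (0 : ℝ)..τ, φ t :=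
  intervalIntegral.sub_le_integral_of_hasDeriv_right_of_le hτ
    (fun t ht => (hy t ht).continuousWithinAt)
    (fun t ht => (hy t ⟨ht.1.le, ht.2.le⟩).mono_of_mem_nhdsWithin
      (mem_of_superset (Icc_mem_nhdsGT ht.2) (Icc_subset_Icc_left ht.1.le)))
    hφ.integrableOn_Icc (fun t ht => h t ⟨ht.1.le, ht.2.le⟩)

lemma continuousOn_integrable {f : ℝ → ℝ} {τ t : ℝ} (hf : ContinuousOn f (Icc 0 τ))
    (ht : t ∈ Icc 0 τ) : IntervalIntegrable f volume 0 t :=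
  (hf.mono (by rw [uIcc_of_le ht.1]; exact Icc_subset_Icc_right ht.2)).intervalIntegrable

/-- Coupled estimate for a squared norm `y` and an energy `F` controlling a seminorm `j`. -/
lemma coupled_gronwall {y y' F F' j f g : ℝ → ℝ} {k₁ k₂ k₃ τ T : ℝ} (hτ : 0 ≤ τ) (hτT : τ ≤ T)
    (h1 : 0 ≤ k₁) (h2 : 0 ≤ k₂) (h3 : 0 ≤ k₃) (hy0 : ∀ t ∈ Icc 0 τ, 0 ≤ y t)
    (hy : ∀ t ∈ Icc 0 τ, HasDerivWithinAt y (y' t) (Icc 0 τ) t)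
    (hF : ∀ t ∈ Icc 0 τ, HasDerivWithinAt F (F' t) (Icc 0 τ) t)
    (hf : ContinuousOn f (Icc 0 T)) (hg : ContinuousOn g (Icc 0 T))
    (hy' : ∀ t ∈ Icc 0 τ, y' t ≤ k₁ * (y t + j t ^ 2 + f t ^ 2))
    (hF' : ∀ t ∈ Icc 0 τ, |F' t| ≤ k₃ * y t + g t ^ 2)
    (hj : ∀ t ∈ Icc 0 τ, j t ^ 2 ≤ k₂ * (|F t| + y t + f t ^ 2)) :
    y τ ≤ (y 0 + k₁ * (1 + k₂) * (∫ t in (0 : ℝ)..T, f t ^ 2)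
      + k₁ * k₂ * T * (|F 0| + ∫ t in (0 : ℝ)..T, g t ^ 2))
      * Real.exp ((k₁ * (1 + k₂) + k₁ * k₂ * k₃ * T) * T) := by
  have hT : 0 ≤ T := hτ.trans hτT
  have hyc : ContinuousOn y (Icc 0 τ) := fun t ht => (hy t ht).continuousWithinAt
  have hfc : ContinuousOn (fun t => f t ^ 2) (Icc 0 T) := hf.pow 2
  have hgc : ContinuousOn (fun t => g t ^ 2) (Icc 0 T) := hg.pow 2
  have hTT : T ∈ Icc 0 T := ⟨hT, le_rfl⟩
  set Fi := ∫ t in (0 : ℝ)..T, f t ^ 2 with hFi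
  set Gi := ∫ t in (0 : ℝ)..T, g t ^ 2 with hGi
  have hmono : ∀ φ : ℝ → ℝ, ContinuousOn φ (Icc 0 T) → (∀ t, 0 ≤ φ t) → ∀ t ∈ Icc 0 τ,
      ∫ s in (0 : ℝ)..t, φ s ≤ ∫ s in (0 : ℝ)..T, φ s := fun φ hφ hp t ht =>
    intervalIntegral.integral_mono_interval le_rfl ht.1 (ht.2.trans hτT)
      (Eventually.of_forall hp) (continuousOn_integrable hφ hTT)
  have hFi0 : 0 ≤ Fi := intervalIntegral.integral_nonneg hT fun t _ => sq_nonneg _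
  have hGi0 : 0 ≤ Gi := intervalIntegral.integral_nonneg hT fun t _ => sq_nonneg _
  have hY : ∀ s t, 0 ≤ s → s ≤ t → t ≤ τ →
      ∫ r in (0 : ℝ)..s, y r ≤ ∫ r in (0 : ℝ)..t, y r := fun s t hs hst ht =>
    intervalIntegral.integral_mono_interval le_rfl hs hst
      ((ae_restrict_iff' measurableSet_Ioc).2 (Eventually.of_forall fun r hr =>
        hy0 r ⟨hr.1.le, hr.2.trans ht⟩))
      (continuousOn_integrable hyc ⟨hs.trans hst, ht⟩)
  -- The bound on `|F'|` is integrated for `F` and for `-F`, since the energy has no definite sign.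
  have hFb : ∀ t ∈ Icc 0 τ, |F t| ≤ |F 0| + k₃ * (∫ s in (0 : ℝ)..t, y s) + Gi := by
    intro t ht
    have hsub : Icc 0 t ⊆ Icc 0 τ := Icc_subset_Icc_right ht.2
    have hc : ContinuousOn (fun s => k₃ * y s + g s ^ 2) (Icc 0 t) :=
      ((hyc.mono hsub).const_mul k₃).add (hgc.mono (Icc_subset_Icc_right (ht.2.trans hτT)))
    have ha := sub_le_integral_of_hasDerivWithinAt ht.1
      (fun s hs => (hF s (hsub hs)).mono hsub) hc
      (fun s hs => (le_abs_self _).trans (hF' s (hsub hs)))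
    have hb := sub_le_integral_of_hasDerivWithinAt (y := fun s => -F s) ht.1
      (fun s hs => ((hF s (hsub hs)).mono hsub).neg) hc
      (fun s hs => (neg_le_abs _).trans (hF' s (hsub hs)))
    have hi : ∫ s in (0 : ℝ)..t, (k₃ * y s + g s ^ 2) =
        k₃ * (∫ s in (0 : ℝ)..t, y s) + ∫ s in (0 : ℝ)..t, g s ^ 2 := by
      rw [intervalIntegral.integral_add ((continuousOn_integrable hyc ht).const_mul _)
        (continuousOn_integrable hgc ⟨ht.1, ht.2.trans hτT⟩), intervalIntegral.integral_const_mul]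
    have hgm := hmono _ hgc (fun _ => sq_nonneg _) t ht
    rw [hi] at ha hb
    rw [abs_le]
    constructor
    · linarith [neg_abs_le (F 0)]
    · linarith [le_abs_self (F 0)]
  have hmain : ∀ t ∈ Icc 0 τ, y t ≤ (y 0 + k₁ * (1 + k₂) * Fi + k₁ * k₂ * T * (|F 0| + Gi))
      + (k₁ * (1 + k₂) + k₁ * k₂ * k₃ * T) * ∫ s in (0 : ℝ)..t, y s := by
    intro t ht
    have hsub : Icc 0 t ⊆ Icc 0 τ := Icc_subset_Icc_right ht.2
    -- `B` bounds `|F s|` for all `s ≤ t` at once because the integral of `y` is monotone.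
    -- Integrating it over `[0, t]` therefore costs only a factor `T` instead of producing a double
    -- integral.
    set B := |F 0| + k₃ * (∫ s in (0 : ℝ)..t, y s) + Gi with hB
    have hYt : 0 ≤ ∫ s in (0 : ℝ)..t, y s :=
      intervalIntegral.integral_nonneg ht.1 fun s hs => hy0 s (hsub hs)
    have hB0 : 0 ≤ B := by positivity
    have hc : ContinuousOn (fun s => k₁ * (1 + k₂) * y s + k₁ * (1 + k₂) * f s ^ 2 + k₁ * k₂ * B)
        (Icc 0 t) :=
      (((hyc.mono hsub).const_mul _).add
        ((hfc.mono (Icc_subset_Icc_right (ht.2.trans hτT))).const_mul _)).add continuousOn_const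
    have ha := sub_le_integral_of_hasDerivWithinAt ht.1
      (fun s hs => (hy s (hsub hs)).mono hsub) hc (fun s hs => by
        have e1 := hy' s (hsub hs)
        have e2 := hj s (hsub hs)
        have e3 : |F s| ≤ B := (hFb s (hsub hs)).trans (by
          have := mul_le_mul_of_nonneg_left (hY s t hs.1 hs.2 ht.2) h3
          rw [hB]; linarith)
        have e4 : j s ^ 2 ≤ k₂ * (B + y s + f s ^ 2) := e2.trans (by gcongr)
        calc y' s ≤ k₁ * (y s + k₂ * (B + y s + f s ^ 2) + f s ^ 2) := e1.trans (by gcongr)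
          _ = _ := by ring)
    have hyi := continuousOn_integrable hyc ht
    have hfi := continuousOn_integrable hfc ⟨ht.1, ht.2.trans hτT⟩
    rw [intervalIntegral.integral_add ((hyi.const_mul _).add (hfi.const_mul _))
      intervalIntegrable_const, intervalIntegral.integral_add (hyi.const_mul _) (hfi.const_mul _),
      intervalIntegral.integral_const_mul, intervalIntegral.integral_const_mul,
      intervalIntegral.integral_const, smul_eq_mul, sub_zero] at ha
    have hfm := hmono _ hfc (fun _ => sq_nonneg _) t ht
    have e5 : k₁ * (1 + k₂) * (∫ s in (0 : ℝ)..t, f s ^ 2) ≤ k₁ * (1 + k₂) * Fi := by gcongr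
    have e6 : t * (k₁ * k₂ * B) ≤ T * (k₁ * k₂ * B) :=
      mul_le_mul_of_nonneg_right (ht.2.trans hτT) (by positivity)
    have e7 : T * (k₁ * k₂ * B) = k₁ * k₂ * T * (|F 0| + Gi)
        + k₁ * k₂ * k₃ * T * ∫ s in (0 : ℝ)..t, y s := by rw [hB]; ring
    linarith
  have hfin := gronwall_integral hτ hyc (by positivity) hmain
  have hy00 := hy0 0 ⟨le_rfl, hτ⟩
  refine hfin.trans ?_
  gcongr

/-! ### The energy method in an abstract collocation space -/

/-- A Hilbert space with a skew operator `J`, a commuting skew isometry `h`, and point evaluations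
for which a quadrature rule reproduces the inner product. -/
structure Colloc (V : Type*) [NormedAddCommGroup V] [InnerProductSpace ℝ V] (ι : Type*)
    [Fintype ι] where
  J : V →L[ℝ] V
  h : V →L[ℝ] V
  ev : ι → V →L[ℝ] ℝ
  w : ι → ℝ
  Q : (ι → ℝ) → V
  J_skew : ∀ a b, inner ℝ (J a) b = -inner ℝ a (J b)
  h_skew : ∀ a b, inner ℝ (h a) b = -inner ℝ a (h b)
  h_norm : ∀ a, ‖h a‖ = ‖a‖
  J_h : ∀ a, J (h a) = h (J a)
  w_nonneg : ∀ i, 0 ≤ w i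
  sum_ev : ∀ a b, ∑ i, w i * (ev i a * ev i b) = inner ℝ a b
  inner_Q : ∀ f a, inner ℝ (Q f) a = ∑ i, w i * f i * ev i a

namespace Colloc

variable {V : Type*} [NormedAddCommGroup V] [InnerProductSpace ℝ V] {ι : Type*} [Fintype ι]
  (S : Colloc V ι) (P : Params)

/-- The energy of the error. -/
def energy (e U Δ : V) : ℝ :=
  1 / 2 * (P.α * inner ℝ e e - P.β * inner ℝ e (S.h (S.J e)) + P.γ * inner ℝ (S.J e) (S.J e))
    - P.δ / 3 * ∑ i, S.w i * S.ev i e ^ 3 + P.δ * ∑ i, S.w i * (S.ev i U * S.ev i e ^ 2)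
    + inner ℝ e Δ

/-- The gradient of the energy. -/
def field (e U Δ : V) : V :=
  P.α • e - P.β • S.h (S.J e) - P.γ • S.J (S.J e)
    + (2 * P.δ) • S.Q (fun i => S.ev i U * S.ev i e) - P.δ • S.Q (fun i => S.ev i e ^ 2) + Δ

lemma inner_J_self (a : V) : inner ℝ a (S.J a) = 0 := by
  have := S.J_skew a a
  rw [real_inner_comm] at this
  linarith

lemma inner_h_self (a : V) : inner ℝ a (S.h a) = 0 := by
  have := S.h_skew a a
  rw [real_inner_comm] at this
  linarith

/-- `h` and `J` are skew and commute, so `h J` is symmetric; this is why the `β` term of the energy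
has gradient `-β h J e`. -/
lemma inner_hJ (a b : V) : inner ℝ a (S.h (S.J b)) = inner ℝ (S.h (S.J a)) b := by
  rw [← S.J_h a, S.J_skew, S.h_skew, neg_neg]

lemma inner_field (e U Δ v : V) : inner ℝ (S.field P e U Δ) v =
    P.α * inner ℝ e v - P.β * inner ℝ (S.h (S.J e)) v + P.γ * inner ℝ (S.J e) (S.J v)
    + 2 * P.δ * (∑ i, S.w i * (S.ev i U * S.ev i e) * S.ev i v)
    - P.δ * (∑ i, S.w i * S.ev i e ^ 2 * S.ev i v) + inner ℝ Δ v := by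
  simp only [field, inner_add_left, inner_sub_left, real_inner_smul_left, S.inner_Q, S.J_skew]
  ring

/-- `field` is the gradient of the energy in `e`. Along `e' = J g` with `g` this gradient, the chain
rule contributes `⟨g, J g⟩ = 0`, and only the explicit time dependence through `U` and `Δ` survives.
-/
lemma hasDerivWithinAt_energy {e U Δ : ℝ → V} {U' Δ' : V} {s : Set ℝ} {t : ℝ}
    (he : HasDerivWithinAt e (S.J (S.field P (e t) (U t) (Δ t))) s t)
    (hU : HasDerivWithinAt U U' s t) (hΔ : HasDerivWithinAt Δ Δ' s t) :
    HasDerivWithinAt (fun r => S.energy P (e r) (U r) (Δ r))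
      (P.δ * (∑ i, S.w i * (S.ev i U' * S.ev i (e t) ^ 2)) + inner ℝ (e t) Δ') s t := by
  set g := S.field P (e t) (U t) (Δ t) with hg
  have hzero : inner ℝ g (S.J g) = 0 := S.inner_J_self g
  rw [hg, S.inner_field] at hzero
  rw [← hg] at hzero
  set v := S.J g
  have hJe : HasDerivWithinAt (fun r => S.J (e r)) (S.J v) s t := S.J.hasFDerivAt.comp_hasDerivWithinAt t he
  have hhe : HasDerivWithinAt (fun r => S.h (S.J (e r))) (S.h (S.J v)) s t :=
    S.h.hasFDerivAt.comp_hasDerivWithinAt t hJe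
  have hev : ∀ i, HasDerivWithinAt (fun r => S.ev i (e r)) (S.ev i v) s t := fun i =>
    (S.ev i).hasFDerivAt.comp_hasDerivWithinAt t he
  have hevU : ∀ i, HasDerivWithinAt (fun r => S.ev i (U r)) (S.ev i U') s t := fun i =>
    (S.ev i).hasFDerivAt.comp_hasDerivWithinAt t hU
  have h1 := (he.inner ℝ he).const_mul P.α
  have h2 := (he.inner ℝ hhe).const_mul P.β
  have h3 := (hJe.inner ℝ hJe).const_mul P.γ
  have h4 := (HasDerivWithinAt.fun_sum (u := Finset.univ)
    fun i _ => ((hev i).pow 3).const_mul (S.w i)).const_mul (P.δ / 3)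
  have h5 := (HasDerivWithinAt.fun_sum (u := Finset.univ)
    fun i _ => ((hevU i).mul ((hev i).pow 2)).const_mul (S.w i)).const_mul P.δ
  have h6 := he.inner ℝ hΔ
  refine ((((((h1.sub h2).add h3).const_mul (1 / 2)).sub h4).add h5).add h6).congr_deriv ?_
  simp only [Pi.pow_apply]
  have s4 : ∑ i, S.w i * ((3 : ℕ) * S.ev i (e t) ^ (3 - 1) * S.ev i v) =
      3 * ∑ i, S.w i * S.ev i (e t) ^ 2 * S.ev i v := by
    rw [Finset.mul_sum]
    exact Finset.sum_congr rfl fun i _ => by push_cast; ring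
  have s5 : ∑ i, S.w i * (S.ev i U' * S.ev i (e t) ^ 2 +
        S.ev i (U t) * ((2 : ℕ) * S.ev i (e t) ^ (2 - 1) * S.ev i v)) =
      ∑ i, S.w i * (S.ev i U' * S.ev i (e t) ^ 2) +
        2 * ∑ i, S.w i * (S.ev i (U t) * S.ev i (e t)) * S.ev i v := by
    rw [Finset.mul_sum, ← Finset.sum_add_distrib]
    exact Finset.sum_congr rfl fun i _ => by push_cast; ring
  have c1 : inner ℝ v (e t) = inner ℝ (e t) v := real_inner_comm _ _
  have c2 : inner ℝ v (S.h (S.J (e t))) = inner ℝ (S.h (S.J (e t))) v := real_inner_comm _ _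
  have c3 : inner ℝ (S.J v) (S.J (e t)) = inner ℝ (S.J (e t)) (S.J v) := real_inner_comm _ _
  have c4 : inner ℝ v (Δ t) = inner ℝ (Δ t) v := real_inner_comm _ _
  rw [s4, s5, S.inner_hJ (e t) v, c1, c2, c3, c4]
  linear_combination hzero

/-- The quadrature rule reproduces the norm, so this is Cauchy–Schwarz for the weighted values at
the nodes. -/
lemma abs_sum_le {f : ι → ℝ} {B : ℝ} (hf : ∀ i, |f i| ≤ B) (hB : 0 ≤ B) (a b : V) :
    |∑ i, S.w i * (f i * S.ev i a * S.ev i b)| ≤ B * ‖a‖ * ‖b‖ := by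
  have hn : ∀ a : V, ‖a‖ ^ 2 = ∑ i, (√(S.w i) * |S.ev i a|) ^ 2 := fun a => by
    rw [← real_inner_self_eq_norm_sq, ← S.sum_ev]
    refine Finset.sum_congr rfl fun i _ => ?_
    rw [mul_pow, Real.sq_sqrt (S.w_nonneg i), sq_abs]; ring
  have h1 : |∑ i, S.w i * (f i * S.ev i a * S.ev i b)| ≤
      B * ∑ i, (√(S.w i) * |S.ev i a|) * (√(S.w i) * |S.ev i b|) := by
    rw [Finset.mul_sum]
    refine (Finset.abs_sum_le_sum_abs _ _).trans (Finset.sum_le_sum fun i _ => ?_)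
    rw [abs_mul, abs_mul, abs_mul, abs_of_nonneg (S.w_nonneg i)]
    have e : B * (√(S.w i) * |S.ev i a| * (√(S.w i) * |S.ev i b|)) =
        S.w i * (B * |S.ev i a| * |S.ev i b|) := by
      rw [show B * (√(S.w i) * |S.ev i a| * (√(S.w i) * |S.ev i b|)) =
        (√(S.w i) * √(S.w i)) * (B * |S.ev i a| * |S.ev i b|) by ring,
        Real.mul_self_sqrt (S.w_nonneg i)]
    rw [e]
    have := S.w_nonneg i
    have := hf i
    gcongr
  have h2 : ∑ i, (√(S.w i) * |S.ev i a|) * (√(S.w i) * |S.ev i b|) ≤ ‖a‖ * ‖b‖ := by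
    refine le_of_abs_le (abs_le_of_sq_le_sq ?_ (by positivity))
    rw [mul_pow, hn a, hn b]
    exact Finset.sum_mul_sq_le_sq_mul_sq _ _ _
  calc _ ≤ _ := h1
    _ ≤ B * (‖a‖ * ‖b‖) := mul_le_mul_of_nonneg_left h2 hB
    _ = _ := by ring

end Colloc

end MTC
end

noncomputable section
namespace MTC

/-- Growth constant of the squared error. -/
def kNorm (P : Params) (C : ℝ) : ℝ := 2 * |P.δ| * C + 3 * |P.δ| + 1

/-- Coercivity constant of the energy. -/
def kCoer (P : Params) (C : ℝ) : ℝ :=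
  4 / |P.γ| * (3 / 2 + |P.α| / 2 + |P.δ| / 3 + |P.δ| * C + (|P.β| / 2 + |P.δ| / 3) ^ 2 / |P.γ|)

/-- Growth constant of the energy. -/
def kEner (P : Params) (C : ℝ) : ℝ := |P.δ| * C + 1

/-- The stability constant of the squared error. -/
def stabK (P : Params) (C T : ℝ) : ℝ :=
  (1 + kNorm P C * (1 + kCoer P C) + kNorm P C * kCoer P C * T) *
    Real.exp ((kNorm P C * (1 + kCoer P C) + kNorm P C * kCoer P C * kEner P C * T) * T)

lemma kNorm_nonneg (P : Params) {C : ℝ} (hC : 0 ≤ C) : 0 ≤ kNorm P C := by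
  unfold kNorm; positivity

lemma kCoer_nonneg (P : Params) {C : ℝ} (hC : 0 ≤ C) : 0 ≤ kCoer P C := by
  unfold kCoer; positivity

lemma kEner_nonneg (P : Params) {C : ℝ} (hC : 0 ≤ C) : 0 ≤ kEner P C := by
  unfold kEner; positivity

lemma one_le_stabK (P : Params) {C T : ℝ} (hC : 0 ≤ C) (hT : 0 ≤ T) : 1 ≤ stabK P C T := by
  have h1 := kNorm_nonneg P hC
  have h2 := kCoer_nonneg P hC
  have h3 := kEner_nonneg P hC
  unfold stabK
  refine one_le_mul_of_one_le_of_one_le ?_ (Real.one_le_exp (by positivity))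
  have : 0 ≤ kNorm P C * (1 + kCoer P C) := by positivity
  have : 0 ≤ kNorm P C * kCoer P C * T := by positivity
  linarith

namespace Colloc

variable {V : Type*} [NormedAddCommGroup V] [InnerProductSpace ℝ V] {ι : Type*} [Fintype ι]
  (S : Colloc V ι) (P : Params)

/-- The discrete Sobolev inequality bounds one factor `e` pointwise; its constant `M` is absorbed by
the norm of the other factor. This is the only place where smallness of `e` is needed. -/
lemma abs_cubic_le {M : ℝ} (hM : 0 ≤ M) (hsup : ∀ a i, |S.ev i a| ≤ M * (‖a‖ + ‖S.J a‖)) {e : V}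
    (he : M * ‖e‖ ≤ 1) (b : V) :
    |∑ i, S.w i * (S.ev i e * S.ev i e * S.ev i b)| ≤ (‖e‖ + ‖S.J e‖) * ‖b‖ := by
  refine (S.abs_sum_le (hsup e) (by positivity) e b).trans ?_
  calc M * (‖e‖ + ‖S.J e‖) * ‖e‖ * ‖b‖ = (M * ‖e‖) * ((‖e‖ + ‖S.J e‖) * ‖b‖) := by ring
    _ ≤ 1 * ((‖e‖ + ‖S.J e‖) * ‖b‖) := by gcongr
    _ = _ := one_mul _

/-- Pairing with `e` moves `J` across and leaves the pairing of `field` with `J e`. The terms with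
`α`, `β` and `γ` then vanish by skewness of `J` and `h`, so only the quadratic nonlinearity and `Δ`
contribute. -/
lemma inner_field_le {C M : ℝ} (hC : 0 ≤ C) (hM : 0 ≤ M)
    (hsup : ∀ a i, |S.ev i a| ≤ M * (‖a‖ + ‖S.J a‖)) {e U Δ : V}
    (hU : ∀ i, |S.ev i U| ≤ C) (he : M * ‖e‖ ≤ 1) :
    2 * inner ℝ e (S.J (S.field P e U Δ)) ≤
      kNorm P C * (‖e‖ ^ 2 + ‖S.J e‖ ^ 2 + ‖Δ‖ ^ 2) := by
  have e1 : inner ℝ e (S.J (S.field P e U Δ)) = -inner ℝ (S.field P e U Δ) (S.J e) := by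
    have := S.J_skew e (S.field P e U Δ)
    rw [real_inner_comm (S.J e)]
    linarith
  have z1 := S.inner_J_self e
  have z2 : inner ℝ (S.h (S.J e)) (S.J e) = 0 := by
    rw [real_inner_comm]; exact S.inner_h_self _
  have z3 := S.inner_J_self (S.J e)
  rw [e1, S.inner_field, z1, z2, z3]
  have b1 : |∑ i, S.w i * (S.ev i U * S.ev i e) * S.ev i (S.J e)| ≤ C * ‖e‖ * ‖S.J e‖ := by
    have := S.abs_sum_le hU hC e (S.J e)
    simpa only [mul_assoc] using this
  have b2 : |∑ i, S.w i * S.ev i e ^ 2 * S.ev i (S.J e)| ≤ (‖e‖ + ‖S.J e‖) * ‖S.J e‖ := by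
    have := S.abs_cubic_le hM hsup he (S.J e)
    simpa only [mul_assoc, sq] using this
  have b3 : |inner ℝ Δ (S.J e)| ≤ ‖Δ‖ * ‖S.J e‖ := abs_real_inner_le_norm _ _
  set s1 := ∑ i, S.w i * (S.ev i U * S.ev i e) * S.ev i (S.J e)
  set s2 := ∑ i, S.w i * S.ev i e ^ 2 * S.ev i (S.J e)
  set s3 := inner ℝ Δ (S.J e)
  have c1 : -(P.δ * s1) ≤ |P.δ| * (C * ‖e‖ * ‖S.J e‖) := by
    refine (neg_le_abs _).trans ?_
    rw [abs_mul]; gcongr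
  have c2 : P.δ * s2 ≤ |P.δ| * ((‖e‖ + ‖S.J e‖) * ‖S.J e‖) := by
    refine (le_abs_self _).trans ?_
    rw [abs_mul]; gcongr
  have c3 : -s3 ≤ ‖Δ‖ * ‖S.J e‖ := (neg_le_abs _).trans b3
  set n := ‖e‖
  set j := ‖S.J e‖
  set f := ‖Δ‖
  have d1 : 2 * (n * j) ≤ n ^ 2 + j ^ 2 := by nlinarith [sq_nonneg (n - j)]
  have d2 : 2 * (f * j) ≤ f ^ 2 + j ^ 2 := by nlinarith [sq_nonneg (f - j)]
  have hδ := abs_nonneg P.δ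
  have g1 : |P.δ| * C * (2 * (n * j)) ≤ |P.δ| * C * (n ^ 2 + j ^ 2) := by gcongr
  have g2 : |P.δ| * (2 * (n * j)) ≤ |P.δ| * (n ^ 2 + j ^ 2) := by gcongr
  have g3 : 0 ≤ |P.δ| * C * f ^ 2 := by positivity
  have g4 : 0 ≤ |P.δ| * f ^ 2 := by positivity
  have g5 : 0 ≤ |P.δ| * n ^ 2 := by positivity
  have g6 : 0 ≤ n ^ 2 := by positivity
  unfold kNorm
  nlinarith

/-- Solving the energy for its `γ` term leaves expressions at most linear in `‖J e‖`, since the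
cubic term is tamed by `abs_cubic_le`. Absolute values make the argument independent of the sign of
`γ`. -/
lemma norm_J_sq_le (hγ : P.γ ≠ 0) {C M : ℝ} (hC : 0 ≤ C) (hM : 0 ≤ M)
    (hsup : ∀ a i, |S.ev i a| ≤ M * (‖a‖ + ‖S.J a‖)) {e U Δ : V}
    (hU : ∀ i, |S.ev i U| ≤ C) (he : M * ‖e‖ ≤ 1) :
    ‖S.J e‖ ^ 2 ≤ kCoer P C * (|S.energy P e U Δ| + ‖e‖ ^ 2 + ‖Δ‖ ^ 2) := by
  have hγ' : 0 < |P.γ| := abs_pos.2 hγ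
  have b1 : |inner ℝ e (S.h (S.J e))| ≤ ‖e‖ * ‖S.J e‖ := by
    have := abs_real_inner_le_norm e (S.h (S.J e))
    rwa [S.h_norm] at this
  have b2 : |∑ i, S.w i * S.ev i e ^ 3| ≤ (‖e‖ + ‖S.J e‖) * ‖e‖ := by
    have := S.abs_cubic_le hM hsup he e
    simpa only [pow_succ, pow_zero, one_mul] using this
  have b3 : |∑ i, S.w i * (S.ev i U * S.ev i e ^ 2)| ≤ C * ‖e‖ * ‖e‖ := by
    have := S.abs_sum_le hU hC e e
    simpa only [mul_assoc, sq] using this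
  have b4 : |inner ℝ e Δ| ≤ ‖e‖ * ‖Δ‖ := abs_real_inner_le_norm _ _
  have hE : P.γ / 2 * ‖S.J e‖ ^ 2 = S.energy P e U Δ - P.α / 2 * ‖e‖ ^ 2
      + P.β / 2 * inner ℝ e (S.h (S.J e)) + P.δ / 3 * (∑ i, S.w i * S.ev i e ^ 3)
      - P.δ * (∑ i, S.w i * (S.ev i U * S.ev i e ^ 2)) - inner ℝ e Δ := by
    rw [energy, real_inner_self_eq_norm_sq, real_inner_self_eq_norm_sq]
    ring
  set s0 := inner ℝ e (S.h (S.J e))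
  set s1 := ∑ i, S.w i * S.ev i e ^ 3
  set s2 := ∑ i, S.w i * (S.ev i U * S.ev i e ^ 2)
  set s3 := inner ℝ e Δ
  set F := S.energy P e U Δ
  set n := ‖e‖
  set j := ‖S.J e‖
  set f := ‖Δ‖
  have hA : |P.γ| / 2 * j ^ 2 ≤ |F| + |P.α| / 2 * n ^ 2 + |P.β| / 2 * (n * j)
      + |P.δ| / 3 * ((n + j) * n) + |P.δ| * (C * n * n) + n * f := by
    have h1 : |P.γ / 2 * j ^ 2| = |P.γ| / 2 * j ^ 2 := by
      rw [abs_mul, abs_div, abs_of_nonneg (sq_nonneg j), abs_two]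
    rw [← h1, hE]
    have a1 : |P.α / 2 * n ^ 2| = |P.α| / 2 * n ^ 2 := by
      rw [abs_mul, abs_div, abs_of_nonneg (sq_nonneg n), abs_two]
    have a2 : |P.β / 2 * s0| ≤ |P.β| / 2 * (n * j) := by
      rw [abs_mul, abs_div, abs_two]; gcongr
    have a3 : |P.δ / 3 * s1| ≤ |P.δ| / 3 * ((n + j) * n) := by
      rw [abs_mul, abs_div, abs_of_pos (show (0 : ℝ) < 3 by norm_num)]; gcongr
    have a4 : |P.δ * s2| ≤ |P.δ| * (C * n * n) := by
      rw [abs_mul]; gcongr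
    have t1 := abs_sub (F - P.α / 2 * n ^ 2 + P.β / 2 * s0 + P.δ / 3 * s1 - P.δ * s2) s3
    have t2 := abs_sub (F - P.α / 2 * n ^ 2 + P.β / 2 * s0 + P.δ / 3 * s1) (P.δ * s2)
    have t3 := abs_add_le (F - P.α / 2 * n ^ 2 + P.β / 2 * s0) (P.δ / 3 * s1)
    have t4 := abs_add_le (F - P.α / 2 * n ^ 2) (P.β / 2 * s0)
    have t5 := abs_sub F (P.α / 2 * n ^ 2)
    linarith
  set b := |P.β| / 2 + |P.δ| / 3 with hb
  -- Young's inequality, weighted so that half of the leading term `|γ|/2 * j²` absorbs the mixed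
  -- terms.
  have hY : b * (n * j) ≤ |P.γ| / 4 * j ^ 2 + b ^ 2 / |P.γ| * n ^ 2 := by
    have : 0 ≤ |P.γ| * (j / 2 - b * n / |P.γ|) ^ 2 := by positivity
    have e : |P.γ| * (j / 2 - b * n / |P.γ|) ^ 2 =
        |P.γ| / 4 * j ^ 2 - b * (n * j) + b ^ 2 / |P.γ| * n ^ 2 := by
      field_simp
      ring
    linarith
  have hnf : n * f ≤ 1 / 2 * n ^ 2 + 1 / 2 * f ^ 2 := by nlinarith [sq_nonneg (n - f)]
  have hB : |P.γ| / 4 * j ^ 2 ≤ |F| + (|P.α| / 2 + |P.δ| / 3 + |P.δ| * C + 1 / 2 + b ^ 2 / |P.γ|) * n ^ 2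
      + 1 / 2 * f ^ 2 := by
    have : |P.β| / 2 * (n * j) + |P.δ| / 3 * ((n + j) * n) = b * (n * j) + |P.δ| / 3 * n ^ 2 := by
      rw [hb]; ring
    nlinarith
  have hX : 0 ≤ |P.α| / 2 + |P.δ| / 3 + |P.δ| * C + b ^ 2 / |P.γ| := by positivity
  set X := |P.α| / 2 + |P.δ| / 3 + |P.δ| * C + b ^ 2 / |P.γ| with hXd
  have hC2 : |P.γ| / 4 * j ^ 2 ≤ (3 / 2 + X) * (|F| + n ^ 2 + f ^ 2) := by
    have h0 : |P.γ| / 4 * j ^ 2 ≤ |F| + (X + 1 / 2) * n ^ 2 + 1 / 2 * f ^ 2 := by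
      rw [hXd]; linarith
    have h1 := mul_nonneg hX (abs_nonneg F)
    have h2 := mul_nonneg hX (sq_nonneg f)
    nlinarith [abs_nonneg F, sq_nonneg f, sq_nonneg n]
  have hk : kCoer P C = 4 / |P.γ| * (3 / 2 + X) := by rw [kCoer, hXd, hb]; ring
  rw [hk]
  calc j ^ 2 = 4 / |P.γ| * (|P.γ| / 4 * j ^ 2) := by field_simp
    _ ≤ 4 / |P.γ| * ((3 / 2 + X) * (|F| + n ^ 2 + f ^ 2)) := by gcongr
    _ = _ := by ring

/-- Stability of the error as long as it is small. -/
lemma norm_sq_le (hγ : P.γ ≠ 0) {C M τ T : ℝ} (hC : 0 ≤ C) (hM : 0 ≤ M) (hτ : 0 ≤ τ) (hτT : τ ≤ T)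
    (hsup : ∀ a i, |S.ev i a| ≤ M * (‖a‖ + ‖S.J a‖)) {e U U' Δ Δ' : ℝ → V} {f g : ℝ → ℝ}
    (he : ∀ t ∈ Icc 0 τ, HasDerivWithinAt e (S.J (S.field P (e t) (U t) (Δ t))) (Icc 0 τ) t)
    (hU : ∀ t ∈ Icc 0 τ, HasDerivWithinAt U (U' t) (Icc 0 τ) t)
    (hΔ : ∀ t ∈ Icc 0 τ, HasDerivWithinAt Δ (Δ' t) (Icc 0 τ) t)
    (hUC : ∀ t ∈ Icc 0 τ, ∀ i, |S.ev i (U t)| ≤ C)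
    (hU'C : ∀ t ∈ Icc 0 τ, ∀ i, |S.ev i (U' t)| ≤ C)
    (hf : ContinuousOn f (Icc 0 T)) (hg : ContinuousOn g (Icc 0 T))
    (hΔf : ∀ t ∈ Icc 0 τ, ‖Δ t‖ ≤ f t) (hΔg : ∀ t ∈ Icc 0 τ, ‖Δ' t‖ ≤ g t)
    (hsmall : ∀ t ∈ Icc 0 τ, M * ‖e t‖ ≤ 1) :
    ‖e τ‖ ^ 2 ≤ stabK P C T * (‖e 0‖ ^ 2 + |S.energy P (e 0) (U 0) (Δ 0)|
      + (∫ t in (0 : ℝ)..T, f t ^ 2) + ∫ t in (0 : ℝ)..T, g t ^ 2) := by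
  have hT : 0 ≤ T := hτ.trans hτT
  have h1 := kNorm_nonneg P hC
  have h2 := kCoer_nonneg P hC
  have h3 := kEner_nonneg P hC
  have hΔf2 : ∀ t ∈ Icc 0 τ, ‖Δ t‖ ^ 2 ≤ f t ^ 2 := fun t ht => by
    have := hΔf t ht; gcongr
  have key := coupled_gronwall (y := fun t => ‖e t‖ ^ 2)
    (F := fun t => S.energy P (e t) (U t) (Δ t)) (j := fun t => ‖S.J (e t)‖) hτ hτT h1 h2 h3
    (fun t _ => sq_nonneg _) (fun t ht => (he t ht).norm_sq)
    (fun t ht => S.hasDerivWithinAt_energy P (he t ht) (hU t ht) (hΔ t ht)) hf hg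
    (fun t ht => (S.inner_field_le P hC hM hsup (hUC t ht) (hsmall t ht)).trans (by
      have := hΔf2 t ht; gcongr))
    (fun t ht => by
      have b1 : |∑ i, S.w i * (S.ev i (U' t) * S.ev i (e t) ^ 2)| ≤ C * ‖e t‖ * ‖e t‖ := by
        have := S.abs_sum_le (hU'C t ht) hC (e t) (e t)
        simpa only [mul_assoc, sq] using this
      have b2 : |inner ℝ (e t) (Δ' t)| ≤ ‖e t‖ * g t :=
        (abs_real_inner_le_norm _ _).trans (by have := hΔg t ht; gcongr)
      have b3 := abs_add_le (P.δ * ∑ i, S.w i * (S.ev i (U' t) * S.ev i (e t) ^ 2))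
        (inner ℝ (e t) (Δ' t))
      rw [abs_mul] at b3
      have b4 := mul_le_mul_of_nonneg_left b1 (abs_nonneg P.δ)
      unfold kEner
      nlinarith [sq_nonneg (‖e t‖ - g t), sq_nonneg (‖e t‖), sq_nonneg (g t)])
    (fun t ht => (S.norm_J_sq_le P hγ hC hM hsup (hUC t ht) (hsmall t ht)).trans (by
      have := hΔf2 t ht; gcongr))
  refine key.trans ?_
  set Fi := ∫ t in (0 : ℝ)..T, f t ^ 2
  set Gi := ∫ t in (0 : ℝ)..T, g t ^ 2
  have hFi0 : 0 ≤ Fi := intervalIntegral.integral_nonneg hT fun t _ => sq_nonneg _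
  have hGi0 : 0 ≤ Gi := intervalIntegral.integral_nonneg hT fun t _ => sq_nonneg _
  set F0 := |S.energy P (e 0) (U 0) (Δ 0)| with hF0
  have hF00 : 0 ≤ F0 := abs_nonneg _
  set y0 := ‖e 0‖ ^ 2 with hy0
  have hy00 : 0 ≤ y0 := sq_nonneg _
  unfold stabK
  rw [mul_right_comm (1 + kNorm P C * (1 + kCoer P C) + kNorm P C * kCoer P C * T)]
  refine mul_le_mul_of_nonneg_right ?_ (Real.exp_nonneg _)
  set A := kNorm P C * (1 + kCoer P C)
  set B := kNorm P C * kCoer P C * T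
  have hA : 0 ≤ A := by positivity
  have hB : 0 ≤ B := by positivity
  have e : (1 + A + B) * (y0 + F0 + Fi + Gi) - (y0 + A * Fi + B * (F0 + Gi)) =
      (A + B) * y0 + (1 + B) * Fi + (1 + A) * (F0 + Gi) := by ring
  have : 0 ≤ (A + B) * y0 + (1 + B) * Fi + (1 + A) * (F0 + Gi) := by positivity
  linarith

/-- The error remains small on the whole interval if its data are small. -/
lemma bootstrap (hγ : P.γ ≠ 0) {C M T ρ R : ℝ} (hC : 0 ≤ C) (hM : 0 ≤ M) (hT : 0 ≤ T)
    (hρ : 0 ≤ ρ) (hMρ : M * ρ ≤ 1)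
    (hsup : ∀ a i, |S.ev i a| ≤ M * (‖a‖ + ‖S.J a‖)) {e U U' Δ Δ' : ℝ → V} {f g : ℝ → ℝ}
    (hec : ContinuousOn e (Icc 0 T))
    (he : ∀ t ∈ Icc 0 T, ‖e t‖ ≤ ρ →
      HasDerivWithinAt e (S.J (S.field P (e t) (U t) (Δ t))) (Icc 0 T) t)
    (hU : ∀ t ∈ Icc 0 T, HasDerivWithinAt U (U' t) (Icc 0 T) t)
    (hΔ : ∀ t ∈ Icc 0 T, HasDerivWithinAt Δ (Δ' t) (Icc 0 T) t)
    (hUC : ∀ t ∈ Icc 0 T, ∀ i, |S.ev i (U t)| ≤ C)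
    (hU'C : ∀ t ∈ Icc 0 T, ∀ i, |S.ev i (U' t)| ≤ C)
    (hf : ContinuousOn f (Icc 0 T)) (hg : ContinuousOn g (Icc 0 T))
    (hΔf : ∀ t ∈ Icc 0 T, ‖Δ t‖ ≤ f t) (hΔg : ∀ t ∈ Icc 0 T, ‖Δ' t‖ ≤ g t)
    (hR : ‖e 0‖ ^ 2 + |S.energy P (e 0) (U 0) (Δ 0)|
      + (∫ t in (0 : ℝ)..T, f t ^ 2) + (∫ t in (0 : ℝ)..T, g t ^ 2) ≤ R)
    (hsmall : stabK P C T * R < ρ ^ 2) :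
    ∀ t ∈ Icc 0 T, ‖e t‖ ^ 2 ≤ stabK P C T * R := by
  have hK := one_le_stabK P hC hT
  have step : ∀ τ ∈ Icc 0 T, (∀ t ∈ Icc 0 τ, ‖e t‖ ≤ ρ) → ‖e τ‖ ^ 2 ≤ stabK P C T * R := by
    intro τ hτ hle
    have hsub : Icc 0 τ ⊆ Icc 0 T := Icc_subset_Icc_right hτ.2
    refine (S.norm_sq_le P hγ hC hM hτ.1 hτ.2 hsup
      (fun t ht => (he t (hsub ht) (hle t ht)).mono hsub)
      (fun t ht => (hU t (hsub ht)).mono hsub) (fun t ht => (hΔ t (hsub ht)).mono hsub)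
      (fun t ht => hUC t (hsub ht)) (fun t ht => hU'C t (hsub ht)) hf hg
      (fun t ht => hΔf t (hsub ht)) (fun t ht => hΔg t (hsub ht))
      (fun t ht => (mul_le_mul_of_nonneg_left (hle t ht) hM).trans hMρ)).trans ?_
    gcongr
  -- Continuity argument: if the error reached `ρ`, there would be a first such time `τ`. Up to `τ`
  -- the error is at most `ρ`, so the stability estimate applies and gives a value strictly below
  -- `ρ` at `τ`.
  have hlt : ∀ t ∈ Icc 0 T, ‖e t‖ < ρ := by
    by_contra hcon
    push Not at hcon
    obtain ⟨t₁, ht₁, hρt₁⟩ := hcon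
    have hcl : IsCompact (Icc 0 T ∩ (fun t => ‖e t‖) ⁻¹' Ici ρ) :=
      isCompact_Icc.of_isClosed_subset
        (hec.norm.preimage_isClosed_of_isClosed isClosed_Icc isClosed_Ici) inter_subset_left
    obtain ⟨τ, hτ, hmin⟩ := hcl.exists_isLeast ⟨t₁, ht₁, hρt₁⟩
    have hbelow : ∀ t ∈ Icc 0 τ, t < τ → ‖e t‖ < ρ := fun t ht htτ => by
      by_contra h
      exact absurd (hmin ⟨⟨ht.1, ht.2.trans hτ.1.2⟩, not_lt.1 h⟩) (not_le.2 htτ)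
    have hτle : ‖e τ‖ ≤ ρ := by
      -- At `τ = 0` there are no earlier times to take a limit from; the bound comes from the
      -- initial data, using that the stability constant is at least one.
      rcases hτ.1.1.eq_or_lt with h0 | h0
      · have hFi : 0 ≤ ∫ t in (0 : ℝ)..T, f t ^ 2 :=
          intervalIntegral.integral_nonneg hT fun t _ => sq_nonneg _
        have hGi : 0 ≤ ∫ t in (0 : ℝ)..T, g t ^ 2 :=
          intervalIntegral.integral_nonneg hT fun t _ => sq_nonneg _
        have h1 : ‖e 0‖ ^ 2 ≤ R := by linarith [abs_nonneg (S.energy P (e 0) (U 0) (Δ 0))]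
        have h2 : R ≤ stabK P C T * R :=
          le_mul_of_one_le_left ((sq_nonneg _).trans h1) hK
        rw [← h0]
        exact (pow_le_pow_iff_left₀ (norm_nonneg _) hρ two_ne_zero).1 (by linarith)
      · have hcw : ContinuousWithinAt (fun t => ‖e t‖) (Ioo 0 τ) τ :=
          (hec τ hτ.1).norm.mono fun t ht => ⟨ht.1.le, ht.2.le.trans hτ.1.2⟩
        have hmem : τ ∈ closure (Ioo 0 τ) := by
          rw [closure_Ioo h0.ne]; exact ⟨h0.le, le_rfl⟩
        exact hcw.closure_le hmem continuousWithinAt_const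
          (fun t ht => (hbelow t ⟨ht.1.le, ht.2.le⟩ ht.2).le)
    have h3 := step τ hτ.1 fun t ht => by
      rcases ht.2.eq_or_lt with h | h
      · rw [h]; exact hτle
      · exact (hbelow t ht h).le
    have h4 : ρ ≤ ‖e τ‖ := hτ.2
    have h5 : ρ ^ 2 ≤ ‖e τ‖ ^ 2 := by gcongr
    linarith
  intro t ht
  exact step t ht fun s hs => (hlt s ⟨hs.1, hs.2.trans ht.2⟩).le

end Colloc

/-! ### Solutions of a differential equation as long as they stay in a ball -/

/-- Multiplication by a bump function equal to one on the ball makes the field bounded and globally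
Lipschitz without changing it there. The solution of the modified equation exists on the whole
interval and solves the original one whenever it lies in the ball. -/
lemma exists_solution_in_ball {V : Type*} [NormedAddCommGroup V] [InnerProductSpace ℝ V]
    [FiniteDimensional ℝ V] {X : V → V} (hX : ContDiff ℝ 1 X) {R T : ℝ} (hR : 0 < R) (hT : 0 ≤ T)
    (x₀ : V) :
    ∃ x : ℝ → V, x 0 = x₀ ∧ ContinuousOn x (Icc 0 T) ∧
      ∀ t ∈ Icc 0 T, ‖x t‖ ≤ R → HasDerivWithinAt x (X (x t)) (Icc 0 T) t := by
  let χ : ContDiffBump (0 : V) := ⟨R, R + 1, hR, by linarith⟩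
  set Y : V → V := fun v => χ v • X v with hY
  have hYc : ContDiff ℝ 1 Y := (χ.contDiff).smul hX
  have hYs : HasCompactSupport Y := χ.hasCompactSupport.smul_right
  obtain ⟨K, hK⟩ := hYc.lipschitzWith_of_hasCompactSupport hYs (by norm_num)
  obtain ⟨L, hL⟩ := hYs.exists_bound_of_continuous hYc.continuous
  have hL0 : 0 ≤ L := (norm_nonneg _).trans (hL 0)
  -- The radius `L * T` is the farthest a curve of speed at most `L` can travel in time `T`, so no
  -- restriction on `T` arises.
  have hpl : IsPicardLindelof (fun _ => Y) (⟨0, le_rfl, hT⟩ : Icc 0 T) x₀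
      (⟨L * T, by positivity⟩ : NNReal) 0 (⟨L, hL0⟩ : NNReal) K :=
    IsPicardLindelof.of_time_independent (fun v _ => hL v) hK.lipschitzOnWith (by
      simp only [sub_zero, NNReal.coe_zero, sub_self, max_eq_left hT]
      exact le_rfl)
  obtain ⟨x, hx0, hx⟩ := hpl.exists_eq_forall_mem_Icc_hasDerivWithinAt₀
  refine ⟨x, hx0, fun t ht => (hx t ht).continuousWithinAt, fun t ht hxt => ?_⟩
  have h1 : χ (x t) = 1 := χ.one_of_mem_closedBall (by simpa using hxt)
  have := hx t ht
  simpa [hY, h1] using this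

end MTC
end

noncomputable section
namespace MTC

variable {ℓ : ℝ} {p : ℕ}

/-! ### Synthesis and projection as bounded operators -/

lemma continuous_phi (hℓ : 0 < ℓ) (k : ℕ) : Continuous (phi ℓ k) := by
  rw [continuous_iff_continuousAt]
  intro x
  obtain ⟨m, rfl | rfl⟩ := Nat.even_or_odd' k
  · exact (deriv_phi_even hℓ m x).continuousAt
  · exact (deriv_phi_odd hℓ m x).continuousAt

lemma memLp_phi (hℓ : 0 < ℓ) (k : ℕ) : MemLp (phi ℓ k) 2 volume := by
  rw [memLp_two_iff_integrable_sq (continuous_phi hℓ k).aestronglyMeasurable]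
  simpa only [sq] using integrable_phi_mul hℓ k k

lemma memLp_syn (hℓ : 0 < ℓ) (a : Coeff p) : MemLp (syn ℓ a) 2 volume := by
  have : MemLp (fun x => ∑ k : Fin (2 * p), a k * phi ℓ k x) 2 volume :=
    memLp_finsetSum _ fun k _ => (memLp_phi hℓ k).const_mul (a k)
  exact this

lemma inner_toL2 {f g : ℝ → ℝ} (hf : MemLp f 2 volume) (hg : MemLp g 2 volume) :
    inner ℝ (toL2 f) (toL2 g) = ∫ x, f x * g x := by
  rw [L2.inner_def]
  refine integral_congr_ae ?_
  filter_upwards [coeFn_toL2 hf, coeFn_toL2 hg] with x h1 h2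
  simp [h1, h2, mul_comm]

/-- Synthesis as a bounded operator into `L²(ℝ)`. -/
def synL (hℓ : 0 < ℓ) (p : ℕ) : Coeff p →L[ℝ] Lp ℝ 2 (volume : Measure ℝ) :=
  LinearMap.toContinuousLinearMap
    { toFun := fun a => toL2 (syn ℓ a)
      map_add' := fun a b => by
        rw [← toL2_add (memLp_syn hℓ a) (memLp_syn hℓ b)]
        congr 1
        ext x
        exact (evL ℓ p x).map_add a b
      map_smul' := fun c a => by
        rw [RingHom.id_apply, ← toL2_const_mul c (memLp_syn hℓ a)]
        congr 1
        ext x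
        exact (evL ℓ p x).map_smul c a }

@[simp] lemma synL_apply (hℓ : 0 < ℓ) (a : Coeff p) : synL hℓ p a = toL2 (syn ℓ a) := rfl

lemma inner_synL (hℓ : 0 < ℓ) (a b : Coeff p) :
    inner ℝ (synL hℓ p a) (synL hℓ p b) = inner ℝ a b := by
  rw [synL_apply, synL_apply, inner_toL2 (memLp_syn hℓ a) (memLp_syn hℓ b), integral_syn_mul hℓ]

lemma norm_toL2_syn (hℓ : 0 < ℓ) (a : Coeff p) : ‖toL2 (syn ℓ a)‖ = ‖a‖ := by
  have : ‖toL2 (syn ℓ a)‖ ^ 2 = ‖a‖ ^ 2 := by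
    rw [← real_inner_self_eq_norm_sq, ← real_inner_self_eq_norm_sq, ← inner_synL hℓ]
    rfl
  exact (pow_left_inj₀ (norm_nonneg _) (norm_nonneg _) two_ne_zero).1 this

/-- The projection as a bounded operator on `L²(ℝ)`. -/
def projL (hℓ : 0 < ℓ) (p : ℕ) : Lp ℝ 2 (volume : Measure ℝ) →L[ℝ] Coeff p :=
  ContinuousLinearMap.adjoint (synL hℓ p)

lemma inner_projL (hℓ : 0 < ℓ) (F : Lp ℝ 2 (volume : Measure ℝ)) (a : Coeff p) :
    inner ℝ a (projL hℓ p F) = inner ℝ (toL2 (syn ℓ a)) F := by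
  rw [projL, ContinuousLinearMap.adjoint_inner_right]; rfl

lemma norm_projL_le (hℓ : 0 < ℓ) (F : Lp ℝ 2 (volume : Measure ℝ)) : ‖projL hℓ p F‖ ≤ ‖F‖ := by
  have h := inner_projL hℓ F (projL hℓ p F)
  rw [real_inner_self_eq_norm_sq] at h
  have h2 := real_inner_le_norm (toL2 (syn ℓ (projL hℓ p F))) F
  rw [← h, norm_toL2_syn hℓ, sq] at h2
  by_contra hcon
  push Not at hcon
  have h3 : 0 < ‖projL hℓ p F‖ := (norm_nonneg _).trans_lt hcon
  exact absurd (le_of_mul_le_mul_left h2 h3) (not_le.2 hcon)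

lemma projL_toL2 (hℓ : 0 < ℓ) {f : ℝ → ℝ} (hf : MemLp f 2 volume) :
    projL hℓ p (toL2 f) = proj ℓ p f := by
  refine ext_inner_left ℝ fun a => ?_
  rw [inner_projL, inner_toL2 (memLp_syn hℓ a) hf, coeff_inner]
  simp_rw [syn, Finset.sum_mul]
  rw [integral_finsetSum]
  · refine Finset.sum_congr rfl fun k _ => ?_
    change _ = a k * ∫ x, f x * phi ℓ k x
    rw [← integral_const_mul]
    exact integral_congr_ae (Eventually.of_forall fun x => by ring)
  · intro k _
    have := (((memLp_phi hℓ k).integrable_mul hf)).const_mul (a k)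
    exact this.congr (Eventually.of_forall fun x => by simp; ring)

lemma projL_syn (hℓ : 0 < ℓ) (a : Coeff p) : projL hℓ p (toL2 (syn ℓ a)) = a := by
  refine ext_inner_left ℝ fun b => ?_
  rw [inner_projL]
  exact inner_synL hℓ b a

/-! ### The discrete Hamiltonian in coordinates -/

/-- The collocation structure of the coordinate space. -/
def colloc (hℓ : 0 < ℓ) {ϑ : ℝ}
    (hc : ∀ i < 2 * p, Real.cos (ϑ + i * Real.pi / (2 * p)) ≠ 0) :
    Colloc (Coeff p) (Fin (2 * p)) where
  J := JL ℓ p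
  h := hil p
  ev := fun i => evL ℓ p (node ℓ p ϑ i)
  w := fun i => qw ℓ p (node ℓ p ϑ i)
  Q := fun f => WithLp.toLp 2 fun k =>
    ∑ i : Fin (2 * p), qw ℓ p (node ℓ p ϑ i) * phi ℓ k (node ℓ p ϑ i) * f i
  J_skew := inner_J_left hℓ
  h_skew := inner_hil_left
  h_norm := norm_hil
  J_h := J_hil hℓ
  w_nonneg := fun i => qw_nonneg hℓ _
  sum_ev := sum_qw_syn_mul hℓ hc
  inner_Q := fun f a => by
    rw [coeff_inner]
    simp only [evL_apply, syn, Finset.sum_mul, Finset.mul_sum]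
    rw [Finset.sum_comm]
    exact Finset.sum_congr rfl fun i _ => Finset.sum_congr rfl fun k _ => by ring

variable {ϑ : ℝ}

lemma interp_eq_Q (hℓ : 0 < ℓ) (hc : ∀ i < 2 * p, Real.cos (ϑ + i * Real.pi / (2 * p)) ≠ 0)
    (f : ℝ → ℝ) : interp ℓ p ϑ f = (colloc hℓ hc).Q fun i => f (node ℓ p ϑ i) := by
  ext k
  rw [interp_apply hℓ hc]
  rfl

/-- The gradient of the discrete Hamiltonian. -/
def gradG (P : Params) (ℓ : ℝ) {p : ℕ} (ϑ : ℝ) (a : Coeff p) : Coeff p :=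
  P.α • a - P.β • hil p (J ℓ a) - P.γ • J ℓ (J ℓ a)
    + P.δ • interp ℓ p ϑ fun y => syn ℓ a y ^ 2

/-- Orthonormality turns the integrals into inner products of coordinates, `hilbert_syn` replaces
the Hilbert transform by `hil`, and exact quadrature turns the interpolated cubic term into a sum of
cubes at the nodes. -/
lemma G_eq (P : Params) (hℓ : 0 < ℓ)
    (hc : ∀ i < 2 * p, Real.cos (ϑ + i * Real.pi / (2 * p)) ≠ 0) (a : Coeff p) :
    G P ℓ ϑ a = 1 / 2 * (P.α * inner ℝ a a - P.β * inner ℝ a (hil p (J ℓ a))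
      + P.γ * inner ℝ (J ℓ a) (J ℓ a))
      + P.δ / 3 * ∑ i : Fin (2 * p), qw ℓ p (node ℓ p ϑ i) * syn ℓ a (node ℓ p ϑ i) ^ 3 := by
  have hI : inner ℝ a (interp ℓ p ϑ fun y => syn ℓ a y ^ 2) =
      ∑ i : Fin (2 * p), qw ℓ p (node ℓ p ϑ i) * syn ℓ a (node ℓ p ϑ i) ^ 3 := by
    rw [real_inner_comm, inner_interp hℓ hc]
    exact Finset.sum_congr rfl fun i _ => by ring
  unfold G
  have e : ∀ᵐ x, (P.α * syn ℓ a x ^ 2 - P.β * (syn ℓ a x * hilbert (syn ℓ (J ℓ a)) x)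
      + P.γ * syn ℓ (J ℓ a) x ^ 2
      + 2 * P.δ / 3 * (syn ℓ a x * syn ℓ (interp ℓ p ϑ fun y => syn ℓ a y ^ 2) x)) =
      P.α * (syn ℓ a x * syn ℓ a x) - P.β * (syn ℓ a x * syn ℓ (hil p (J ℓ a)) x)
      + P.γ * (syn ℓ (J ℓ a) x * syn ℓ (J ℓ a) x)
      + 2 * P.δ / 3 * (syn ℓ a x * syn ℓ (interp ℓ p ϑ fun y => syn ℓ a y ^ 2) x) := by
    filter_upwards [hilbert_syn hℓ (J ℓ a)] with x hx
    rw [hx]; ring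
  rw [integral_congr_ae e]
  have i1 := (integrable_syn_mul hℓ a a).const_mul P.α
  have i2 := (integrable_syn_mul hℓ a (hil p (J ℓ a))).const_mul P.β
  have i3 := (integrable_syn_mul hℓ (J ℓ a) (J ℓ a)).const_mul P.γ
  have i4 := (integrable_syn_mul hℓ a (interp ℓ p ϑ fun y => syn ℓ a y ^ 2)).const_mul (2 * P.δ / 3)
  have e1 := integral_add ((i1.sub i2).add i3) i4
  have e2 := integral_add (i1.sub i2) i3
  have e3 := integral_sub i1 i2
  simp only [Pi.add_apply, Pi.sub_apply] at e1 e2 e3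
  rw [e1, e2, e3, integral_const_mul, integral_const_mul, integral_const_mul, integral_const_mul,
    integral_syn_mul hℓ, integral_syn_mul hℓ, integral_syn_mul hℓ, integral_syn_mul hℓ, hI]
  ring

lemma gradient_G (P : Params) (hℓ : 0 < ℓ)
    (hc : ∀ i < 2 * p, Real.cos (ϑ + i * Real.pi / (2 * p)) ≠ 0) (a : Coeff p) :
    gradient (G P ℓ ϑ) a = gradG P ℓ ϑ a := by
  have hG : (G P ℓ ϑ : Coeff p → ℝ) = fun a => 1 / 2 * (P.α * inner ℝ a a
      - P.β * inner ℝ a (((hil p).comp (JL ℓ p)) a) + P.γ * inner ℝ (JL ℓ p a) (JL ℓ p a))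
      + P.δ / 3 * ∑ i : Fin (2 * p), qw ℓ p (node ℓ p ϑ i) * (evL ℓ p (node ℓ p ϑ i) a) ^ 3 :=
    funext fun a => G_eq P hℓ hc a
  have hid := hasFDerivAt_id (𝕜 := ℝ) a
  have hJd := (JL ℓ p).hasFDerivAt (x := a)
  have hhd := ((hil p).comp (JL ℓ p)).hasFDerivAt (x := a)
  have h1 := (hid.inner ℝ hid).const_mul P.α
  have h2 := (hid.inner ℝ hhd).const_mul P.β
  have h3 := (hJd.inner ℝ hJd).const_mul P.γ
  have h4 := (HasFDerivAt.fun_sum (u := Finset.univ) fun (i : Fin (2 * p)) _ =>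
    (((evL ℓ p (node ℓ p ϑ i)).hasFDerivAt (x := a)).pow 3).const_mul
      (qw ℓ p (node ℓ p ϑ i))).const_mul (P.δ / 3)
  have hall := (((h1.sub h2).add h3).const_mul (1 / 2)).add h4
  refine HasGradientAt.gradient ?_
  rw [hasGradientAt_iff_hasFDerivAt, hG]
  refine hall.congr_fderiv ?_
  ext v
  have hhJ : inner ℝ a (hil p (J ℓ v)) = inner ℝ (hil p (J ℓ a)) v := (colloc hℓ hc).inner_hJ a v
  have hJJ : inner ℝ (J ℓ (J ℓ a)) v = -inner ℝ (J ℓ a) (J ℓ v) := inner_J_left hℓ _ _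
  have c1 : inner ℝ v a = inner ℝ a v := real_inner_comm _ _
  have c2 : inner ℝ v (hil p (J ℓ a)) = inner ℝ (hil p (J ℓ a)) v := real_inner_comm _ _
  have c3 : inner ℝ (J ℓ v) (J ℓ a) = inner ℝ (J ℓ a) (J ℓ v) := real_inner_comm _ _
  have hs : ∑ i : Fin (2 * p), qw ℓ p (node ℓ p ϑ i) *
      (3 * syn ℓ a (node ℓ p ϑ i) ^ 2 * syn ℓ v (node ℓ p ϑ i)) =
      3 * inner ℝ (interp ℓ p ϑ fun y => syn ℓ a y ^ 2) v := by
    rw [inner_interp hℓ hc, Finset.mul_sum]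
    exact Finset.sum_congr rfl fun i _ => by ring
  simp [gradG, fderivInnerCLM_apply, hhJ, hJJ,
    c1, c2, c3, ← mul_assoc]
  simp only [mul_assoc] at hs ⊢
  rw [hs]
  ring

end MTC
end

noncomputable section
namespace MTC

/-! ### Products of functions with square integrable derivative -/

/-- The kernel `e^{y-x}` on `y ≤ x`, which recovers `f x` from the sum of `f` and its derivative. -/
def expKer (x : ℝ) : ℝ → ℝ := indicator (Iic x) fun y => Real.exp (y - x)

lemma integrable_exp_mul_two (x : ℝ) : IntegrableOn (fun y => Real.exp (2 * (y - x))) (Iic x) := by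
  have h := (integrableOn_exp_mul_Iic (a := 2) (by norm_num) x).const_mul (Real.exp (-(2 * x)))
  refine h.congr (Eventually.of_forall fun y => ?_)
  simp only
  rw [← Real.exp_add]
  ring_nf

lemma expKer_sq (x y : ℝ) :
    expKer x y ^ 2 = indicator (Iic x) (fun y => Real.exp (2 * (y - x))) y := by
  by_cases hy : y ∈ Iic x
  · simp only [expKer, indicator_of_mem hy]
    rw [← Real.exp_nat_mul]; norm_num
  · simp only [expKer, indicator_of_notMem hy]; norm_num

lemma measurable_expKer (x : ℝ) : Measurable (expKer x) :=
  (by fun_prop : Measurable fun y => Real.exp (y - x)).indicator measurableSet_Iic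

lemma memLp_expKer (x : ℝ) : MemLp (expKer x) 2 volume := by
  rw [memLp_two_iff_integrable_sq (measurable_expKer x).aestronglyMeasurable]
  simp_rw [expKer_sq]
  rw [integrable_indicator_iff measurableSet_Iic]
  exact integrable_exp_mul_two x

lemma norm_expKer_le (x : ℝ) : ‖toL2 (expKer x)‖ ≤ 1 := by
  have h : ‖toL2 (expKer x)‖ ^ 2 = 1 / 2 := by
    rw [← real_inner_self_eq_norm_sq, inner_toL2 (memLp_expKer x) (memLp_expKer x)]
    simp_rw [← sq, expKer_sq]
    rw [integral_indicator measurableSet_Iic]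
    have e : ∀ y, Real.exp (2 * (y - x)) = Real.exp (-(2 * x)) * Real.exp (2 * y) := fun y => by
      rw [← Real.exp_add]; ring_nf
    simp_rw [e]
    rw [integral_const_mul, integral_exp_mul_Iic (by norm_num), ← mul_div_assoc, ← Real.exp_add]
    norm_num
  nlinarith [norm_nonneg (toL2 (expKer x))]

lemma measurable_inner_expKer (F : Lp ℝ 2 (volume : Measure ℝ)) :
    StronglyMeasurable fun x => inner ℝ (toL2 (expKer x)) F := by
  have h1 : ∀ x, inner ℝ (toL2 (expKer x)) F = ∫ y, expKer x y * F y := fun x => by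
    have := inner_toL2 (memLp_expKer x) (Lp.memLp F)
    rwa [toL2_coe] at this
  simp_rw [h1]
  have h2 : StronglyMeasurable (Function.uncurry fun x y => expKer x y * F y) := by
    refine StronglyMeasurable.mul ?_ ((Lp.stronglyMeasurable F).comp_measurable measurable_snd)
    have e : (fun q : ℝ × ℝ => expKer q.1 q.2) =
        indicator {q : ℝ × ℝ | q.2 ≤ q.1} fun q => Real.exp (q.2 - q.1) := by
      ext q; simp [expKer, indicator]
    rw [e]
    refine StronglyMeasurable.indicator ?_ (measurableSet_le measurable_snd measurable_fst)
    exact (by fun_prop : Continuous fun q : ℝ × ℝ => Real.exp (q.2 - q.1)).stronglyMeasurable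
  exact h2.integral_prod_right

lemma abs_inner_expKer_le (F : Lp ℝ 2 (volume : Measure ℝ)) (x : ℝ) :
    |inner ℝ (toL2 (expKer x)) F| ≤ ‖F‖ :=
  (abs_real_inner_le_norm _ _).trans (mul_le_of_le_one_left (norm_nonneg _) (norm_expKer_le x))

lemma memLp_expKer_mul (F G : Lp ℝ 2 (volume : Measure ℝ)) :
    MemLp (fun x => inner ℝ (toL2 (expKer x)) F * G x) 2 volume := by
  refine (Lp.memLp G).of_le_mul (c := ‖F‖)
    ((measurable_inner_expKer F).aestronglyMeasurable.mul (Lp.aestronglyMeasurable G))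
    (Eventually.of_forall fun x => ?_)
  rw [norm_mul]
  exact mul_le_mul_of_nonneg_right (abs_inner_expKer_le F x) (norm_nonneg _)

/-- The bounded bilinear map `(f + ∂f, g) ↦ f g` on `L²(ℝ)`. -/
def mulL : Lp ℝ 2 (volume : Measure ℝ) →L[ℝ] Lp ℝ 2 (volume : Measure ℝ) →L[ℝ]
    Lp ℝ 2 (volume : Measure ℝ) :=
  LinearMap.mkContinuous₂
    (LinearMap.mk₂ ℝ (fun F G => toL2 fun x => inner ℝ (toL2 (expKer x)) F * G x)
      (fun F F' G => by
        rw [← toL2_add (memLp_expKer_mul F G) (memLp_expKer_mul F' G)]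
        congr 1; ext x; rw [inner_add_right, add_mul])
      (fun c F G => by
        rw [← toL2_const_mul c (memLp_expKer_mul F G)]
        congr 1; ext x; rw [real_inner_smul_right, mul_assoc])
      (fun F G G' => by
        rw [← toL2_add (memLp_expKer_mul F G) (memLp_expKer_mul F G')]
        refine toL2_congr ?_
        filter_upwards [Lp.coeFn_add G G'] with x hx
        rw [hx, Pi.add_apply, mul_add])
      (fun c F G => by
        rw [← toL2_const_mul c (memLp_expKer_mul F G)]
        refine toL2_congr ?_
        filter_upwards [Lp.coeFn_smul c G] with x hx
        rw [hx, Pi.smul_apply, smul_eq_mul]; ring)) 1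
    (fun F G => by
      rw [one_mul, LinearMap.mk₂_apply]
      refine Lp.norm_le_mul_norm_of_ae_le_mul ?_
      filter_upwards [coeFn_toL2 (memLp_expKer_mul F G)] with x hx
      rw [hx, norm_mul]
      exact mul_le_mul_of_nonneg_right (abs_inner_expKer_le F x) (norm_nonneg _))

lemma mulL_apply (F G : Lp ℝ 2 (volume : Measure ℝ)) :
    mulL F G = toL2 fun x => inner ℝ (toL2 (expKer x)) F * G x := rfl

/-- `exp (y - x) * (f + f')` is the derivative of `exp (y - x) * f`, so integrating up to `x`
returns `f x`. Point values thereby become L² pairings, bounded uniformly in `x`. -/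
lemma inner_expKer_eq {f : ℝ → ℝ} (hd : ∀ x, HasDerivAt f (deriv f x) x)
    (hf : MemLp f 2 volume) (hf' : MemLp (deriv f) 2 volume) (x : ℝ) :
    inner ℝ (toL2 (expKer x)) (toL2 f + toL2 (deriv f)) = f x := by
  have hm : MemLp (fun y => f y + deriv f y) 2 volume := hf.add hf'
  rw [← toL2_add hf hf', inner_toL2 (memLp_expKer x) hm]
  have hi : ∀ g : ℝ → ℝ, MemLp g 2 volume → IntegrableOn (fun y => Real.exp (y - x) * g y) (Iic x) := by
    intro g hg
    have := (memLp_expKer x).integrable_mul hg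
    rw [← integrable_indicator_iff measurableSet_Iic]
    refine this.congr (Eventually.of_forall fun y => ?_)
    by_cases hy : y ∈ Iic x <;> simp [expKer, hy]
  have e : ∀ y, expKer x y * (f y + deriv f y) =
      indicator (Iic x) (fun y => Real.exp (y - x) * (f y + deriv f y)) y := fun y => by
    by_cases hy : y ∈ Iic x <;> simp [expKer, hy]
  simp_rw [e]
  rw [integral_indicator measurableSet_Iic]
  have hder : ∀ y ∈ Iic x, HasDerivAt (fun y => Real.exp (y - x) * f y)
      (Real.exp (y - x) * (f y + deriv f y)) y := fun y _ => by
    have h1 : HasDerivAt (fun y => Real.exp (y - x)) (Real.exp (y - x) * 1) y :=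
      ((hasDerivAt_id y).sub_const x).exp
    refine (h1.mul (hd y)).congr_deriv ?_
    ring
  -- There is no boundary term at `-∞` because the function and its derivative are both integrable
  -- on the half-line.
  have ht : Tendsto (fun y => Real.exp (y - x) * f y) atBot (𝓝 0) :=
    tendsto_zero_of_hasDerivAt_of_integrableOn_Iic hder (hi _ hm) (hi _ hf)
  rw [integral_Iic_of_hasDerivAt_of_tendsto' hder (hi _ hm) ht]
  simp

lemma memLp_mul {f g : ℝ → ℝ} (hd : ∀ x, HasDerivAt f (deriv f x) x)
    (hf : MemLp f 2 volume) (hf' : MemLp (deriv f) 2 volume) (hg : MemLp g 2 volume) :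
    MemLp (fun x => f x * g x) 2 volume := by
  have h := memLp_expKer_mul (toL2 f + toL2 (deriv f)) (toL2 g)
  refine (memLp_congr_ae ?_).1 h
  filter_upwards [coeFn_toL2 hg] with x hx
  rw [hx, inner_expKer_eq hd hf hf']

/-- With the product written as a bounded bilinear map of classes, time differentiability of `u²`
and `u u_x` in L² follows from that of `u` and `u_x`. -/
lemma toL2_mul {f g : ℝ → ℝ} (hd : ∀ x, HasDerivAt f (deriv f x) x)
    (hf : MemLp f 2 volume) (hf' : MemLp (deriv f) 2 volume) (hg : MemLp g 2 volume) :
    toL2 (fun x => f x * g x) = mulL (toL2 f + toL2 (deriv f)) (toL2 g) := by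
  rw [mulL_apply]
  refine toL2_congr ?_
  filter_upwards [coeFn_toL2 hg] with x hx
  rw [hx, inner_expKer_eq hd hf hf']

end MTC
end

noncomputable section
namespace MTC

variable {ℓ : ℝ} {p : ℕ} {ϑ : ℝ}

/-! ### The consistency terms as elements of `L²(ℝ)` -/

/-- A function of class `C³ ∩ H³`. -/
structure Reg (v : ℝ → ℝ) : Prop where
  contDiff : ContDiff ℝ 3 v
  memLp : ∀ j ≤ 3, MemLp (iteratedDeriv j v) 2 volume

namespace Reg

variable {v : ℝ → ℝ}

lemma mem0 (hv : Reg v) : MemLp v 2 volume := by simpa using hv.memLp 0 (by norm_num)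
lemma mem1 (hv : Reg v) : MemLp (deriv v) 2 volume := by
  simpa [iteratedDeriv_one] using hv.memLp 1 (by norm_num)
lemma mem2 (hv : Reg v) : MemLp (iteratedDeriv 2 v) 2 volume := hv.memLp 2 (by norm_num)
lemma mem3 (hv : Reg v) : MemLp (iteratedDeriv 3 v) 2 volume := hv.memLp 3 le_rfl

lemma hasDerivAt (hv : Reg v) (x : ℝ) : HasDerivAt v (deriv v x) x :=
  (hv.contDiff.differentiable (by norm_num) x).hasDerivAt

lemma hasDerivAt_two (hv : Reg v) (x : ℝ) :
    HasDerivAt (iteratedDeriv 2 v) (iteratedDeriv 3 v x) x := by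
  have h := (hv.contDiff.differentiable_iteratedDeriv 2 (by norm_num) x).hasDerivAt
  rwa [← iteratedDeriv_succ] at h

lemma mem_sq (hv : Reg v) : MemLp (fun x => v x ^ 2) 2 volume := by
  simpa only [sq] using memLp_mul hv.hasDerivAt hv.mem0 hv.mem1 hv.mem0

lemma toL2_sq (hv : Reg v) : toL2 (fun x => v x ^ 2) = mulL (toL2 v + toL2 (deriv v)) (toL2 v) := by
  simpa only [sq] using toL2_mul hv.hasDerivAt hv.mem0 hv.mem1 hv.mem0

lemma memLp_gradHam (hv : Reg v) (P : Params) : MemLp (gradHam P v) 2 volume :=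
  (((hv.mem0.const_mul P.α).add ((memLp_hilbert (deriv v)).const_mul P.β)).sub
    (hv.mem2.const_mul P.γ)).add (hv.mem_sq.const_mul P.δ)

lemma toL2_gradHam (hv : Reg v) (P : Params) :
    toL2 (gradHam P v) = P.α • toL2 v + P.β • hilR (toL2 (deriv v))
    - P.γ • toL2 (iteratedDeriv 2 v) + P.δ • mulL (toL2 v + toL2 (deriv v)) (toL2 v) := by
  have i1 := hv.mem0.const_mul P.α
  have i2 := (memLp_hilbert (deriv v)).const_mul P.β
  have i3 := hv.mem2.const_mul P.γ
  have i4 := hv.mem_sq.const_mul P.δ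
  have h := toL2_add ((i1.add i2).sub i3) i4
  have h2 := toL2_sub (i1.add i2) i3
  have h3 := toL2_add i1 i2
  rw [toL2_const_mul _ hv.mem0, toL2_const_mul _ (memLp_hilbert _)] at h3
  rw [toL2_const_mul _ hv.mem2] at h2
  rw [toL2_const_mul _ hv.mem_sq] at h
  rw [← toL2_hilbert hv.mem1, ← hv.toL2_sq, ← h3]
  exact h.trans (congrArg (· + _) h2)

lemma memLp_rhs (hv : Reg v) (P : Params) : MemLp (benjaminRHS P v) 2 volume := by
  have i4 := (memLp_mul hv.hasDerivAt hv.mem0 hv.mem1 hv.mem1).const_mul (2 * P.δ)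
  have h := ((((hv.mem1.const_mul P.α).add
    ((memLp_hilbert (iteratedDeriv 2 v)).const_mul P.β)).sub (hv.mem3.const_mul P.γ)).add i4).neg
  refine (memLp_congr_ae (Eventually.of_forall fun x => ?_)).1 h
  simp only [Pi.neg_apply, Pi.add_apply, Pi.sub_apply, benjaminRHS]
  ring

lemma toL2_rhs (hv : Reg v) (P : Params) : toL2 (benjaminRHS P v) = -(P.α • toL2 (deriv v)
    + P.β • hilR (toL2 (iteratedDeriv 2 v)) - P.γ • toL2 (iteratedDeriv 3 v)
    + (2 * P.δ) • mulL (toL2 v + toL2 (deriv v)) (toL2 (deriv v))) := by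
  have hm := memLp_mul hv.hasDerivAt hv.mem0 hv.mem1 hv.mem1
  rw [← toL2_hilbert hv.mem2, ← toL2_mul hv.hasDerivAt hv.mem0 hv.mem1 hv.mem1]
  have i1 := hv.mem1.const_mul P.α
  have i2 := (memLp_hilbert (iteratedDeriv 2 v)).const_mul P.β
  have i3 := hv.mem3.const_mul P.γ
  refine Lp.ext ?_
  filter_upwards [coeFn_toL2 (hv.memLp_rhs P),
    Lp.coeFn_neg (P.α • toL2 (deriv v) + P.β • toL2 (hilbert (iteratedDeriv 2 v))
      - P.γ • toL2 (iteratedDeriv 3 v) + (2 * P.δ) • toL2 (fun x => v x * deriv v x)),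
    Lp.coeFn_add (P.α • toL2 (deriv v) + P.β • toL2 (hilbert (iteratedDeriv 2 v))
      - P.γ • toL2 (iteratedDeriv 3 v)) ((2 * P.δ) • toL2 (fun x => v x * deriv v x)),
    Lp.coeFn_sub (P.α • toL2 (deriv v) + P.β • toL2 (hilbert (iteratedDeriv 2 v)))
      (P.γ • toL2 (iteratedDeriv 3 v)),
    Lp.coeFn_add (P.α • toL2 (deriv v)) (P.β • toL2 (hilbert (iteratedDeriv 2 v))),
    Lp.coeFn_smul P.α (toL2 (deriv v)), Lp.coeFn_smul P.β (toL2 (hilbert (iteratedDeriv 2 v))),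
    Lp.coeFn_smul P.γ (toL2 (iteratedDeriv 3 v)),
    Lp.coeFn_smul (2 * P.δ) (toL2 (fun x => v x * deriv v x)),
    coeFn_toL2 hv.mem1, coeFn_toL2 (memLp_hilbert (iteratedDeriv 2 v)), coeFn_toL2 hv.mem3,
    coeFn_toL2 hm] with x h1 h2 h3 h4 h5 h6 h7 h8 h9 h10 h11 h12 h13
  rw [h1, h2, Pi.neg_apply, h3, Pi.add_apply, h4, Pi.sub_apply, h5, Pi.add_apply, h6, h7, h8, h9]
  simp only [Pi.smul_apply, smul_eq_mul, h10, h11, h12, h13, benjaminRHS]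
  ring

end Reg

lemma memLp_deriv_phi (hℓ : 0 < ℓ) (k : ℕ) : MemLp (deriv (phi ℓ k)) 2 volume := by
  obtain ⟨m, rfl | rfl⟩ := Nat.even_or_odd' k
  · rw [funext fun x => (deriv_phi_even hℓ m x).deriv]
    exact ((((memLp_phi hℓ _).const_mul _).add ((memLp_phi hℓ _).const_mul _)).add
      ((memLp_phi hℓ _).const_mul _)).const_mul _
  · rw [funext fun x => (deriv_phi_odd hℓ m x).deriv]
    exact ((((memLp_phi hℓ _).const_mul _).add ((memLp_phi hℓ _).const_mul _)).add
      ((memLp_phi hℓ _).const_mul _)).const_mul _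

lemma hasDerivAt_phi (hℓ : 0 < ℓ) (k : ℕ) (x : ℝ) :
    HasDerivAt (phi ℓ k) (deriv (phi ℓ k) x) x := by
  obtain ⟨m, rfl | rfl⟩ := Nat.even_or_odd' k
  · exact (deriv_phi_even hℓ m x).differentiableAt.hasDerivAt
  · exact (deriv_phi_odd hℓ m x).differentiableAt.hasDerivAt

/-- Integration by parts moves one derivative onto the basis function. In time, `u` is only C¹ with
values in H², so the third derivative must be expressed through the second before differentiating in
`t`. -/
lemma Reg.proj_three {v : ℝ → ℝ} (hv : Reg v) (hℓ : 0 < ℓ) (k : Fin (2 * p)) :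
    proj ℓ p (iteratedDeriv 3 v) k =
      -inner ℝ (toL2 (deriv (phi ℓ k))) (toL2 (iteratedDeriv 2 v)) := by
  rw [inner_toL2 (memLp_deriv_phi hℓ k) hv.mem2]
  change ∫ x, iteratedDeriv 3 v x * phi ℓ k x = _
  have := integral_mul_deriv_eq_deriv_mul_of_integrable (u := phi ℓ k) (v := iteratedDeriv 2 v)
    (u' := deriv (phi ℓ k)) (v' := iteratedDeriv 3 v) (fun x _ => hasDerivAt_phi hℓ k x)
    (fun x _ => hv.hasDerivAt_two x) ((memLp_phi hℓ k).integrable_mul hv.mem3)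
    ((memLp_deriv_phi hℓ k).integrable_mul hv.mem2) ((memLp_phi hℓ k).integrable_mul hv.mem2)
  rw [← this]
  exact integral_congr_ae (Eventually.of_forall fun x => mul_comm _ _)

/-- The operator `Jinv` as a continuous linear map. -/
def JinvL (ℓ : ℝ) (p : ℕ) : Coeff p →L[ℝ] Coeff p :=
  LinearMap.toContinuousLinearMap
    { toFun := fun a => Jinv ℓ a
      map_add' := fun a b => by
        simp only [Jinv, WithLp.ofLp_add, Matrix.mulVec_add]; rfl
      map_smul' := fun c a => by
        simp only [Jinv, WithLp.ofLp_smul, Matrix.mulVec_smul]; rfl }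

lemma Reg.memLp_residual {v : ℝ → ℝ} (hv : Reg v) (hℓ : 0 < ℓ) (P : Params) :
    MemLp (residual P ℓ p ϑ v) 2 volume :=
  ((((hv.mem0.sub (memLp_syn hℓ _)).const_mul P.α).add ((memLp_hilbert _).const_mul P.β)).sub
    ((hv.mem2.sub (memLp_syn hℓ _)).const_mul P.γ)).add
    ((hv.mem_sq.sub (memLp_syn hℓ _)).const_mul P.δ)

lemma Reg.toL2_residual {v : ℝ → ℝ} (hv : Reg v) (hℓ : 0 < ℓ) (P : Params) :
    toL2 (residual P ℓ p ϑ v) =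
      P.α • (toL2 v - synL hℓ p (proj ℓ p v))
      + P.β • hilR (toL2 (deriv v) + synL hℓ p (J ℓ (proj ℓ p v)))
      - P.γ • (toL2 (iteratedDeriv 2 v) - synL hℓ p (J ℓ (J ℓ (proj ℓ p v))))
      + P.δ • (mulL (toL2 v + toL2 (deriv v)) (toL2 v)
        - synL hℓ p (interp ℓ p ϑ fun y => syn ℓ (proj ℓ p v) y ^ 2)) := by
  have m1 := hv.mem0.sub (memLp_syn hℓ (proj ℓ p v))
  have m2 := memLp_hilbert fun y => deriv v y + syn ℓ (J ℓ (proj ℓ p v)) y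
  have m3 := hv.mem2.sub (memLp_syn hℓ (J ℓ (J ℓ (proj ℓ p v))))
  have m4 := hv.mem_sq.sub (memLp_syn hℓ (interp ℓ p ϑ fun y => syn ℓ (proj ℓ p v) y ^ 2))
  have h4 := toL2_add (((m1.const_mul P.α).add (m2.const_mul P.β)).sub (m3.const_mul P.γ))
    (m4.const_mul P.δ)
  have h3 := toL2_sub ((m1.const_mul P.α).add (m2.const_mul P.β)) (m3.const_mul P.γ)
  have h2 := toL2_add (m1.const_mul P.α) (m2.const_mul P.β)
  rw [toL2_const_mul _ m1, toL2_const_mul _ m2] at h2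
  rw [toL2_const_mul _ m3] at h3
  rw [toL2_const_mul _ m4] at h4
  have n1 : toL2 (v - syn ℓ (proj ℓ p v)) = _ := toL2_sub hv.mem0 (memLp_syn hℓ (proj ℓ p v))
  have n3 : toL2 (iteratedDeriv 2 v - syn ℓ (J ℓ (J ℓ (proj ℓ p v)))) = _ :=
    toL2_sub hv.mem2 (memLp_syn hℓ (J ℓ (J ℓ (proj ℓ p v))))
  have n4 : toL2 ((fun x => v x ^ 2) - syn ℓ (interp ℓ p ϑ fun y => syn ℓ (proj ℓ p v) y ^ 2)) = _ :=
    toL2_sub hv.mem_sq (memLp_syn hℓ (interp ℓ p ϑ fun y => syn ℓ (proj ℓ p v) y ^ 2))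
  have n2 := toL2_hilbert (f := fun y => deriv v y + syn ℓ (J ℓ (proj ℓ p v)) y)
    (hv.mem1.add (memLp_syn hℓ (J ℓ (proj ℓ p v))))
  rw [toL2_add hv.mem1 (memLp_syn hℓ (J ℓ (proj ℓ p v)))] at n2
  rw [n1, n2] at h2
  rw [n3] at h3
  rw [n4, hv.toL2_sq] at h4
  simp only [synL_apply]
  rw [← h2]
  exact h4.trans (congrArg (· + _) h3)

lemma Reg.memLp_gradD {v : ℝ → ℝ} (hv : Reg v) (hℓ : 0 < ℓ) (P : Params) :
    MemLp (gradD P ℓ p ϑ v) 2 volume :=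
  (hv.memLp_residual hℓ P).add (memLp_syn hℓ _)

lemma Reg.toL2_gradD {v : ℝ → ℝ} (hv : Reg v) (hℓ : 0 < ℓ) (P : Params) :
    toL2 (gradD P ℓ p ϑ v) =
      toL2 (residual P ℓ p ϑ v) + synL hℓ p (commutator P ℓ p v) :=
  toL2_add (hv.memLp_residual hℓ P) (memLp_syn hℓ _)

/-- The consistency error of the projected solution. -/
lemma Reg.J_projL_gradD {v : ℝ → ℝ} (hv : Reg v) (hℓ : 0 < ℓ) (P : Params) :
    J ℓ (projL hℓ p (toL2 (gradD P ℓ p ϑ v))) =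
      proj ℓ p (benjaminRHS P v) - J ℓ (gradG P ℓ ϑ (proj ℓ p v)) := by
  have hs : ∀ a : Coeff p, projL hℓ p (synL hℓ p a) = a := projL_syn hℓ
  have hh : ∀ a : Coeff p, hilR (synL hℓ p a) = synL hℓ p (hil p a) := fun a => by
    rw [synL_apply, synL_apply, ← toL2_hilbert (memLp_syn hℓ a)]
    exact toL2_congr (hilbert_syn hℓ a)
  -- The discrete terms of the residual lie in ℙ_n, where the projection is the identity and the
  -- Hilbert transform acts as `hil`. They assemble to the discrete gradient, the remaining terms to
  -- the projection of `w`.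
  have h1 : projL hℓ p (toL2 (gradD P ℓ p ϑ v)) =
      proj ℓ p (gradHam P v) - gradG P ℓ ϑ (proj ℓ p v) + commutator P ℓ p v := by
    rw [hv.toL2_gradD hℓ P, hv.toL2_residual hℓ P, ← projL_toL2 hℓ (hv.memLp_gradHam P),
      hv.toL2_gradHam P]
    simp only [map_add, map_sub, map_smul, hh, hs, gradG]
    rw [projL_toL2 hℓ hv.mem0]
    module
  -- Applying `J` to `commutator` gives `𝒫_n 𝒥 w - 𝒥_n 𝒫_n w`; its second part cancels `J` of the
  -- projected `w`.
  rw [h1, ← JL_apply, map_add, map_sub, JL_apply, JL_apply, JL_apply, commutator, J_Jinv hℓ]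
  abel

end MTC
end

noncomputable section
namespace MTC

variable {ℓ : ℝ} {p : ℕ} {ϑ : ℝ} {P : Params} {T : ℝ} {u : ℝ → ℝ → ℝ}

/-! ### Regularity in time of the consistency terms -/

lemma contDiff_interp_sq (ℓ : ℝ) (p : ℕ) (ϑ : ℝ) :
    ContDiff ℝ 1 fun a : Coeff p => interp ℓ p ϑ fun y => syn ℓ a y ^ 2 := by
  rw [contDiff_euclidean]
  intro k
  simp only [interp, Matrix.mulVec, dotProduct]
  exact ContDiff.sum fun i _ =>
    contDiff_const.mul ((evL ℓ p (node ℓ p ϑ i)).contDiff.pow 2)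

lemma contDiff_gradG (P : Params) (ℓ : ℝ) (p : ℕ) (ϑ : ℝ) :
    ContDiff ℝ 1 (gradG P ℓ ϑ : Coeff p → Coeff p) := by
  have h1 : ContDiff ℝ 1 fun a : Coeff p => hil p (J ℓ a) := ((hil p).comp (JL ℓ p)).contDiff
  have h2 : ContDiff ℝ 1 fun a : Coeff p => J ℓ (J ℓ a) := ((JL ℓ p).comp (JL ℓ p)).contDiff
  exact (((contDiff_id.const_smul P.α).sub (h1.const_smul P.β)).sub (h2.const_smul P.γ)).add
    ((contDiff_interp_sq ℓ p ϑ).const_smul P.δ)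

namespace IsClassicalSolution

lemma reg (hu : IsClassicalSolution P T u) {t : ℝ} (ht : t ∈ Icc 0 T) :
    Reg (u t) := ⟨hu.contDiff t ht, hu.memLp t ht⟩

lemma contDiffOn_zero (hu : IsClassicalSolution P T u) :
    ContDiffOn ℝ 1 (fun t => toL2 (u t)) (Icc 0 T) := by
  simpa using hu.contDiffOn_time 0 (by norm_num)

lemma contDiffOn_one (hu : IsClassicalSolution P T u) :
    ContDiffOn ℝ 1 (fun t => toL2 (deriv (u t))) (Icc 0 T) := by
  simpa [iteratedDeriv_one] using hu.contDiffOn_time 1 (by norm_num)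

lemma contDiffOn_two (hu : IsClassicalSolution P T u) :
    ContDiffOn ℝ 1 (fun t => toL2 (iteratedDeriv 2 (u t))) (Icc 0 T) :=
  hu.contDiffOn_time 2 le_rfl

lemma contDiffOn_mulL (hu : IsClassicalSolution P T u) {f : ℝ → Lp ℝ 2 (volume : Measure ℝ)}
    (hf : ContDiffOn ℝ 1 f (Icc 0 T)) :
    ContDiffOn ℝ 1 (fun t => mulL (toL2 (u t) + toL2 (deriv (u t))) (f t)) (Icc 0 T) :=
  (mulL.contDiff.comp_contDiffOn (hu.contDiffOn_zero.add hu.contDiffOn_one)).clm_apply hf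

lemma contDiffOn_proj (hu : IsClassicalSolution P T u) (hℓ : 0 < ℓ) :
    ContDiffOn ℝ 1 (fun t => proj ℓ p (u t)) (Icc 0 T) :=
  ((projL hℓ p).contDiff.comp_contDiffOn hu.contDiffOn_zero).congr fun _ ht =>
    (projL_toL2 hℓ (hu.reg ht).mem0).symm

lemma contDiffOn_proj_three (hu : IsClassicalSolution P T u) (hℓ : 0 < ℓ) :
    ContDiffOn ℝ 1 (fun t => proj ℓ p (iteratedDeriv 3 (u t))) (Icc 0 T) := by
  rw [contDiffOn_euclidean]
  intro k
  have h : ContDiffOn ℝ 1 (fun t => -inner ℝ (toL2 (deriv (phi ℓ k)))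
      (toL2 (iteratedDeriv 2 (u t)))) (Icc 0 T) :=
    (contDiffOn_const.inner ℝ hu.contDiffOn_two).neg
  exact h.congr fun t ht => (hu.reg ht).proj_three hℓ k

lemma contDiffOn_toL2_gradHam (hu : IsClassicalSolution P T u) :
    ContDiffOn ℝ 1 (fun t => toL2 (gradHam P (u t))) (Icc 0 T) := by
  have h := ((((hu.contDiffOn_zero.const_smul P.α).add
    ((hilR.contDiff.comp_contDiffOn hu.contDiffOn_one).const_smul P.β)).sub
    (hu.contDiffOn_two.const_smul P.γ)).add
    ((hu.contDiffOn_mulL hu.contDiffOn_zero).const_smul P.δ))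
  exact h.congr fun t ht => (hu.reg ht).toL2_gradHam P

lemma contDiffOn_proj_rhs (hu : IsClassicalSolution P T u) (hℓ : 0 < ℓ) :
    ContDiffOn ℝ 1 (fun t => proj ℓ p (benjaminRHS P (u t))) (Icc 0 T) := by
  have hp := (projL hℓ p).contDiff (n := 1)
  have h := ((((hp.comp_contDiffOn hu.contDiffOn_one).const_smul P.α).add
    ((hp.comp_contDiffOn (hilR.contDiff.comp_contDiffOn hu.contDiffOn_two)).const_smul P.β)).sub
    ((hu.contDiffOn_proj_three hℓ (p := p)).const_smul P.γ)).add
    ((hp.comp_contDiffOn (hu.contDiffOn_mulL hu.contDiffOn_one)).const_smul (2 * P.δ)) |>.neg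
  refine h.congr fun t ht => ?_
  have hv := hu.reg ht
  change proj ℓ p (benjaminRHS P (u t)) = _
  rw [← projL_toL2 hℓ (hv.memLp_rhs P), hv.toL2_rhs P]
  simp only [map_add, map_sub, map_smul, map_neg]
  rw [projL_toL2 hℓ hv.mem3]
  rfl

/-- Every term is a bounded linear or bilinear map, or a C¹ map between coordinate spaces, applied
to curves that are C¹ in time. The third space derivative enters only through the finite-dimensional
projection of the equation. -/
lemma contDiffOn_toL2_gradD (hu : IsClassicalSolution P T u) (hℓ : 0 < ℓ) :
    ContDiffOn ℝ 1 (fun t => toL2 (gradD P ℓ p ϑ (u t))) (Icc 0 T) := by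
  have hs := (synL hℓ p).contDiff (n := 1)
  have hp := hu.contDiffOn_proj hℓ (p := p)
  have hJ := (JL ℓ p).contDiff.comp_contDiffOn hp
  have hI := (contDiff_interp_sq ℓ p ϑ).comp_contDiffOn hp
  have hres := ((((hu.contDiffOn_zero.sub (hs.comp_contDiffOn hp)).const_smul P.α).add
    ((hilR.contDiff.comp_contDiffOn
      (hu.contDiffOn_one.add (hs.comp_contDiffOn hJ))).const_smul P.β)).sub
    ((hu.contDiffOn_two.sub (hs.comp_contDiffOn
      ((JL ℓ p).contDiff.comp_contDiffOn hJ))).const_smul P.γ)).add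
    (((hu.contDiffOn_mulL hu.contDiffOn_zero).sub (hs.comp_contDiffOn hI)).const_smul P.δ)
  have hcom := (JinvL ℓ p).contDiff.comp_contDiffOn ((hu.contDiffOn_proj_rhs hℓ (p := p)).sub
    ((JL ℓ p).contDiff.comp_contDiffOn
      ((projL hℓ p).contDiff.comp_contDiffOn hu.contDiffOn_toL2_gradHam)))
  refine (hres.add (hs.comp_contDiffOn hcom)).congr fun t ht => ?_
  have hv := hu.reg ht
  change toL2 (gradD P ℓ p ϑ (u t)) = _
  rw [hv.toL2_gradD hℓ P, hv.toL2_residual hℓ P, commutator, ← projL_toL2 hℓ (hv.memLp_gradHam P)]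
  rfl

lemma hasDerivWithinAt_proj (hu : IsClassicalSolution P T u) (hℓ : 0 < ℓ) {t : ℝ}
    (ht : t ∈ Icc 0 T) :
    HasDerivWithinAt (fun s => proj ℓ p (u s)) (proj ℓ p (benjaminRHS P (u t))) (Icc 0 T) t := by
  have h := (projL hℓ p).hasFDerivAt.comp_hasDerivWithinAt t (hu.equation t ht)
  rw [projL_toL2 hℓ ((hu.reg ht).memLp_rhs P)] at h
  exact h.congr (fun s hs => (projL_toL2 hℓ (hu.reg hs).mem0).symm)
    (projL_toL2 hℓ (hu.reg ht).mem0).symm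

/-- Translates the pointwise assumption on the time derivative of the projected solution into a
bound on the values of the coordinate curve's derivative at the nodes. -/
lemma derivWithin_syn_proj (hu : IsClassicalSolution P T u) (hℓ : 0 < ℓ) (hT : 0 < T) {t : ℝ}
    (ht : t ∈ Icc 0 T) (x : ℝ) :
    derivWithin (fun s => syn ℓ (proj ℓ p (u s)) x) (Icc 0 T) t =
      syn ℓ (proj ℓ p (benjaminRHS P (u t))) x :=
  ((evL ℓ p x).hasFDerivAt.comp_hasDerivWithinAt t (hu.hasDerivWithinAt_proj hℓ ht)).derivWithin
    (uniqueDiffOn_Icc hT t ht)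

end IsClassicalSolution

end MTC
end

noncomputable section
namespace MTC

variable {ℓ : ℝ} {p : ℕ} {ϑ : ℝ}

/-! ### The error equation and the error bound for a fixed number of basis functions -/

namespace Colloc

variable {V : Type*} [NormedAddCommGroup V] [InnerProductSpace ℝ V] {ι : Type*} [Fintype ι]
  (S : Colloc V ι)

lemma Q_sq_sub (a b : V) : S.Q (fun i => S.ev i a ^ 2) - S.Q (fun i => S.ev i b ^ 2) =
    (2 : ℝ) • S.Q (fun i => S.ev i a * S.ev i (a - b)) - S.Q (fun i => S.ev i (a - b) ^ 2) := by
  refine ext_inner_right ℝ fun v => ?_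
  simp only [inner_sub_left, inner_smul_left, S.inner_Q, map_sub, Finset.mul_sum,
    ← Finset.sum_sub_distrib]
  refine Finset.sum_congr rfl fun i _ => ?_
  simp only [conj_trivial]
  ring

end Colloc

/-- From `a² - b² = 2a(a - b) - (a - b)²` at the nodes: the difference of the discrete gradients is
the gradient of an energy in `a - b` alone, with `a` as coefficient. -/
lemma field_sub (P : Params) (hℓ : 0 < ℓ)
    (hc : ∀ i < 2 * p, Real.cos (ϑ + i * Real.pi / (2 * p)) ≠ 0) (a b d : Coeff p) :
    (colloc hℓ hc).field P (a - b) a d = gradG P ℓ ϑ a - gradG P ℓ ϑ b + d := by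
  have h := (colloc hℓ hc).Q_sq_sub a b
  have ha : (interp ℓ p ϑ fun y => syn ℓ a y ^ 2) =
    (colloc hℓ hc).Q fun i => (colloc hℓ hc).ev i a ^ 2 := interp_eq_Q hℓ hc _
  have hb : (interp ℓ p ϑ fun y => syn ℓ b y ^ 2) =
    (colloc hℓ hc).Q fun i => (colloc hℓ hc).ev i b ^ 2 := interp_eq_Q hℓ hc _
  have h1 : (colloc hℓ hc).h ((colloc hℓ hc).J (a - b)) = hil p (J ℓ a) - hil p (J ℓ b) :=
    ((hil p).comp (JL ℓ p)).map_sub a b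
  have h2 : (colloc hℓ hc).J ((colloc hℓ hc).J (a - b)) = J ℓ (J ℓ a) - J ℓ (J ℓ b) :=
    ((JL ℓ p).comp (JL ℓ p)).map_sub a b
  rw [Colloc.field, gradG, gradG, ha, hb, h1, h2, sub_eq_iff_eq_add.1 h]
  module

/-- The error equation. -/
lemma Reg.J_field {v : ℝ → ℝ} (hv : Reg v) (P : Params) (hℓ : 0 < ℓ)
    (hc : ∀ i < 2 * p, Real.cos (ϑ + i * Real.pi / (2 * p)) ≠ 0) (b : Coeff p) :
    (colloc hℓ hc).J ((colloc hℓ hc).field P (proj ℓ p v - b) (proj ℓ p v)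
      (projL hℓ p (toL2 (gradD P ℓ p ϑ v)))) =
      proj ℓ p (benjaminRHS P v) - J ℓ (gradG P ℓ ϑ b) := by
  rw [field_sub]
  change JL ℓ p _ = _
  rw [map_add, map_sub, JL_apply, JL_apply, JL_apply, hv.J_projL_gradD hℓ P]
  abel

/-- The argument `-e` of `G` supplies the negative sign of the cubic term, `½ E` the term quadratic
in `e` with coefficient the projected solution, and `D` the linear term. -/
lemma Reg.energy_eq {v : ℝ → ℝ} (hv : Reg v) (P : Params) (hℓ : 0 < ℓ)
    (hc : ∀ i < 2 * p, Real.cos (ϑ + i * Real.pi / (2 * p)) ≠ 0) (e : Coeff p) :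
    (colloc hℓ hc).energy P e (proj ℓ p v) (projL hℓ p (toL2 (gradD P ℓ p ϑ v))) =
      G P ℓ ϑ (-e) + 1 / 2 * E P ℓ ϑ e v + D P ℓ ϑ e v := by
  have hD : D P ℓ ϑ e v = inner ℝ e (projL hℓ p (toL2 (gradD P ℓ p ϑ v))) := by
    rw [inner_projL, inner_toL2 (memLp_syn hℓ e) (hv.memLp_gradD hℓ P)]
    rfl
  have hE : E P ℓ ϑ e v = 2 * P.δ * ∑ i : Fin (2 * p), qw ℓ p (node ℓ p ϑ i) *
      (syn ℓ (proj ℓ p v) (node ℓ p ϑ i) * syn ℓ e (node ℓ p ϑ i) ^ 2) := by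
    rw [E, integral_syn_mul hℓ, real_inner_comm, inner_interp hℓ hc]
    congr 1
    exact Finset.sum_congr rfl fun i _ => by ring
  have hJ : J ℓ (-e) = -J ℓ e := (JL ℓ p).map_neg e
  have hs : ∀ x, syn ℓ (-e) x = -syn ℓ e x := fun x => (evL ℓ p x).map_neg e
  have h3 : ∑ i : Fin (2 * p), qw ℓ p (node ℓ p ϑ i) * syn ℓ (-e) (node ℓ p ϑ i) ^ 3 =
      -∑ i : Fin (2 * p), qw ℓ p (node ℓ p ϑ i) * syn ℓ e (node ℓ p ϑ i) ^ 3 := by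
    rw [← Finset.sum_neg_distrib]
    exact Finset.sum_congr rfl fun i _ => by rw [hs]; ring
  rw [hD, hE, G_eq P hℓ hc, h3, hJ, map_neg, inner_neg_neg, inner_neg_neg, inner_neg_neg]
  change 1 / 2 * (P.α * inner ℝ e e - P.β * inner ℝ e (hil p (J ℓ e))
    + P.γ * inner ℝ (J ℓ e) (J ℓ e))
    - P.δ / 3 * ∑ i : Fin (2 * p), qw ℓ p (node ℓ p ϑ i) * syn ℓ e (node ℓ p ϑ i) ^ 3
    + P.δ * ∑ i : Fin (2 * p), qw ℓ p (node ℓ p ϑ i) *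
      (syn ℓ (proj ℓ p v) (node ℓ p ϑ i) * syn ℓ e (node ℓ p ϑ i) ^ 2) + _ = _
  ring

/-- For nonnegative numbers the sum of squares is at most the square of the sum; the square roots in
`totalError` make each energy contribution such a square. -/
lemma Reg.error_data_le {T : ℝ} (hT : 0 ≤ T) {u : ℝ → ℝ → ℝ} (hv : Reg (u 0)) (P : Params)
    (hℓ : 0 < ℓ) (hc : ∀ i < 2 * p, Real.cos (ϑ + i * Real.pi / (2 * p)) ≠ 0) :
    ‖initialError ℓ p ϑ (u 0)‖ ^ 2
      + |(colloc hℓ hc).energy P (initialError ℓ p ϑ (u 0)) (proj ℓ p (u 0))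
          (projL hℓ p (toL2 (gradD P ℓ p ϑ (u 0))))|
      + (∫ t in (0 : ℝ)..T, ‖toL2 (gradD P ℓ p ϑ (u t))‖ ^ 2)
      + (∫ t in (0 : ℝ)..T,
          ‖derivWithin (fun s => toL2 (gradD P ℓ p ϑ (u s))) (Icc 0 T) t‖ ^ 2)
      ≤ totalError P ℓ p ϑ T u ^ 2 := by
  have hI1 : 0 ≤ ∫ t in (0 : ℝ)..T, ‖toL2 (gradD P ℓ p ϑ (u t))‖ ^ 2 :=
    intervalIntegral.integral_nonneg hT fun _ _ => by positivity
  have hI2 : 0 ≤ ∫ t in (0 : ℝ)..T,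
      ‖derivWithin (fun s => toL2 (gradD P ℓ p ϑ (u s))) (Icc 0 T) t‖ ^ 2 :=
    intervalIntegral.integral_nonneg hT fun _ _ => by positivity
  rw [totalError, norm_toL2_syn hℓ, hv.energy_eq P hℓ hc]
  set e := initialError ℓ p ϑ (u 0)
  have hF : |G P ℓ ϑ (-e) + 1 / 2 * E P ℓ ϑ e (u 0) + D P ℓ ϑ e (u 0)| ≤
      |G P ℓ ϑ (-e)| + |E P ℓ ϑ e (u 0)| + |D P ℓ ϑ e (u 0)| := by
    refine (abs_add_three _ _ _).trans ?_
    rw [abs_mul, abs_of_pos (by norm_num : (0 : ℝ) < 1 / 2)]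
    linarith [abs_nonneg (E P ℓ ϑ e (u 0))]
  have key : ∀ x₁ x₂ x₃ x₄ x₅ x₆ : ℝ, 0 ≤ x₁ → 0 ≤ x₂ → 0 ≤ x₃ → 0 ≤ x₄ → 0 ≤ x₅ → 0 ≤ x₆ →
      x₁ ^ 2 + (x₂ ^ 2 + x₃ ^ 2 + x₄ ^ 2) + x₅ ^ 2 + x₆ ^ 2 ≤ (x₁ + x₂ + x₃ + x₄ + x₅ + x₆) ^ 2 := by
    intro x₁ x₂ x₃ x₄ x₅ x₆ h₁ h₂ h₃ h₄ h₅ h₆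
    have : 0 ≤ x₁ * (x₂ + x₃ + x₄ + x₅ + x₆) + x₂ * (x₃ + x₄ + x₅ + x₆) + x₃ * (x₄ + x₅ + x₆)
      + x₄ * (x₅ + x₆) + x₅ * x₆ := by positivity
    nlinarith
  have := key ‖e‖ √|G P ℓ ϑ (-e)| √|E P ℓ ϑ e (u 0)| √|D P ℓ ϑ e (u 0)| _ _ (norm_nonneg _)
    (Real.sqrt_nonneg _) (Real.sqrt_nonneg _) (Real.sqrt_nonneg _)
    (Real.sqrt_nonneg (∫ t in (0 : ℝ)..T, ‖toL2 (gradD P ℓ p ϑ (u t))‖ ^ 2))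
    (Real.sqrt_nonneg (∫ t in (0 : ℝ)..T,
      ‖derivWithin (fun s => toL2 (gradD P ℓ p ϑ (u s))) (Icc 0 T) t‖ ^ 2))
  rw [Real.sq_sqrt (abs_nonneg _), Real.sq_sqrt (abs_nonneg _), Real.sq_sqrt (abs_nonneg _),
    Real.sq_sqrt hI1, Real.sq_sqrt hI2] at this
  linarith

lemma totalError_nonneg (P : Params) (ℓ : ℝ) (p : ℕ) (ϑ T : ℝ) (u : ℝ → ℝ → ℝ) :
    0 ≤ totalError P ℓ p ϑ T u := by
  unfold totalError; positivity

lemma supC_pos (hℓ : 0 < ℓ) (hp : 0 < p) : 0 < supC ℓ p := by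
  unfold supC
  have : (0 : ℝ) < p := by exact_mod_cast hp
  positivity

/-- The bound of the error of every curve that solves the scheme as long as the error is small. -/
lemma IsClassicalSolution.norm_error_le {P : Params} (hγ : P.γ ≠ 0) {C T : ℝ} (hC : 0 < C)
    (hT : 0 < T) {u : ℝ → ℝ → ℝ} (hu : IsClassicalSolution P T u) (hℓ : 0 < ℓ) (hp : 0 < p)
    (hc : ∀ i < 2 * p, Real.cos (ϑ + i * Real.pi / (2 * p)) ≠ 0)
    (hb : ∀ t ∈ Icc 0 T, ∀ x : ℝ, |syn ℓ (proj ℓ p (u t)) x| ≤ C ∧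
      |derivWithin (fun s => syn ℓ (proj ℓ p (u s)) x) (Icc 0 T) t| ≤ C)
    (hsmall : stabK P C T * totalError P ℓ p ϑ T u ^ 2 < (supC ℓ p)⁻¹ ^ 2)
    {b : ℝ → Coeff p} (hb0 : b 0 = interp ℓ p ϑ (u 0)) (hbc : ContinuousOn b (Icc 0 T))
    (hbd : ∀ t ∈ Icc 0 T, ‖proj ℓ p (u t) - b t‖ ≤ (supC ℓ p)⁻¹ →
      HasDerivWithinAt b (J ℓ (gradG P ℓ ϑ (b t))) (Icc 0 T) t) :
    ∀ t ∈ Icc 0 T, ‖proj ℓ p (u t) - b t‖ ^ 2 ≤ stabK P C T * totalError P ℓ p ϑ T u ^ 2 := by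
  have hM := supC_pos hℓ hp
  have hD := hu.contDiffOn_toL2_gradD hℓ (p := p) (ϑ := ϑ)
  have h0 : (0 : ℝ) ∈ Icc 0 T := ⟨le_rfl, hT.le⟩
  have hdata := (hu.reg h0).error_data_le hT.le P hℓ hc
  rw [initialError, ← hb0] at hdata
  refine (colloc hℓ hc).bootstrap P hγ (M := supC ℓ p) (ρ := (supC ℓ p)⁻¹) hC.le hM.le hT.le
    (inv_nonneg.2 hM.le) (mul_inv_cancel₀ hM.ne').le (fun a i => abs_syn_le hℓ a _)
    (e := fun t => proj ℓ p (u t) - b t) (U := fun t => proj ℓ p (u t))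
    (U' := fun t => proj ℓ p (benjaminRHS P (u t)))
    (Δ := fun t => projL hℓ p (toL2 (gradD P ℓ p ϑ (u t))))
    (Δ' := fun t => projL hℓ p (derivWithin (fun s => toL2 (gradD P ℓ p ϑ (u s))) (Icc 0 T) t))
    ((hu.contDiffOn_proj hℓ).continuousOn.sub hbc) ?_ (fun t ht => hu.hasDerivWithinAt_proj hℓ ht)
    (fun t ht => ?_) (fun t ht i => (hb t ht _).1) (fun t ht i => ?_)
    (f := fun t => ‖toL2 (gradD P ℓ p ϑ (u t))‖)
    (g := fun t => ‖derivWithin (fun s => toL2 (gradD P ℓ p ϑ (u s))) (Icc 0 T) t‖)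
    hD.continuousOn.norm
    (hD.continuousOn_derivWithin (uniqueDiffOn_Icc hT) le_rfl).norm
    (fun t _ => norm_projL_le hℓ _) (fun t _ => norm_projL_le hℓ _) hdata hsmall
  · intro t ht hle
    rw [(hu.reg ht).J_field P hℓ hc]
    exact (hu.hasDerivWithinAt_proj hℓ ht).sub (hbd t ht hle)
  · exact (projL hℓ p).hasFDerivAt.comp_hasDerivWithinAt t
      ((hD.differentiableOn one_ne_zero) t ht).hasDerivWithinAt
  · have := (hb t ht (node ℓ p ϑ i)).2
    rwa [hu.derivWithin_syn_proj hℓ hT ht] at this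

/-- The scheme is solved with a cut-off vector field. The error bound already applies to this curve,
and it shows that the curve never leaves the region where the cut-off is inactive. -/
lemma IsClassicalSolution.exists_semiDiscrete {P : Params} (hγ : P.γ ≠ 0) {C T : ℝ} (hC : 0 < C)
    (hT : 0 < T) {u : ℝ → ℝ → ℝ} (hu : IsClassicalSolution P T u) (hℓ : 0 < ℓ) (hp : 0 < p)
    (hc : ∀ i < 2 * p, Real.cos (ϑ + i * Real.pi / (2 * p)) ≠ 0)
    (hb : ∀ t ∈ Icc 0 T, ∀ x : ℝ, |syn ℓ (proj ℓ p (u t)) x| ≤ C ∧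
      |derivWithin (fun s => syn ℓ (proj ℓ p (u s)) x) (Icc 0 T) t| ≤ C)
    (hsmall : stabK P C T * totalError P ℓ p ϑ T u ^ 2 < (supC ℓ p)⁻¹ ^ 2) :
    ∃ ubar : ℝ → Coeff p, IsSemiDiscreteSolution P ℓ ϑ T (u 0) ubar := by
  have hM := supC_pos hℓ hp
  obtain ⟨B, hB⟩ := isCompact_Icc.exists_bound_of_continuousOn
    (hu.contDiffOn_proj hℓ (p := p)).continuousOn
  have hX : ContDiff ℝ 1 fun a : Coeff p => J ℓ (gradG P ℓ ϑ a) :=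
    (JL ℓ p).contDiff.comp (contDiff_gradG P ℓ p ϑ)
  have hB0 : 0 ≤ B := (norm_nonneg _).trans (hB 0 ⟨le_rfl, hT.le⟩)
  -- `B` bounds the projected solution, so an error of at most `(supC ℓ p)⁻¹` keeps the discrete
  -- curve in the ball of this radius.
  have hR : 0 < B + (supC ℓ p)⁻¹ := by positivity
  obtain ⟨b, hb0, hbc, hbd⟩ := exists_solution_in_ball hX hR hT.le (interp ℓ p ϑ (u 0))
  have hbd' : ∀ t ∈ Icc 0 T, ‖proj ℓ p (u t) - b t‖ ≤ (supC ℓ p)⁻¹ →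
      HasDerivWithinAt b (J ℓ (gradG P ℓ ϑ (b t))) (Icc 0 T) t := fun t ht hle =>
    hbd t ht <| by
      have := norm_sub_norm_le (b t) (proj ℓ p (u t))
      rw [norm_sub_rev] at this
      linarith [hB t ht]
  have hle := hu.norm_error_le hγ hC hT hℓ hp hc hb hsmall hb0 hbc hbd'
  refine ⟨b, hb0, fun t ht => ?_⟩
  rw [gradient_G P hℓ hc]
  exact hbd' t ht ((pow_le_pow_iff_left₀ (norm_nonneg _) (inv_nonneg.2 hM.le) two_ne_zero).1
    ((hle t ht).trans hsmall.le))

/-! ### The smallness condition for large `p`, and the stability theorem -/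

lemma eventually_small {ε : ℝ} (hℓ : 0 < ℓ) (hε : 0 < ε) {s : ℕ → ℝ} (hs : ∀ p, 0 ≤ s p)
    (hO : s =O[atTop] fun p : ℕ => (ℓ * (2 * (p : ℝ) - 1) / 2) ^ (-((1 + ε) / 4))) (K : ℝ)
    (hK : 0 ≤ K) : ∀ᶠ p : ℕ in atTop, K * s p ^ 2 < (supC ℓ p)⁻¹ ^ 2 := by
  obtain ⟨A, hA, hbd⟩ := hO.exists_pos
  rw [Asymptotics.isBigOWith_iff] at hbd
  set B : ℝ := K * (A * (ℓ / 2) ^ (-((1 + ε) / 4))) ^ 2 * (5 * (1 + ℓ) / (Real.pi * ℓ)) with hB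
  have hlim : Tendsto (fun p : ℕ => B * (p : ℝ) ^ (-(ε / 2))) atTop (𝓝 0) := by
    have := ((tendsto_rpow_neg_atTop (half_pos hε)).comp tendsto_natCast_atTop_atTop).const_mul B
    rw [mul_zero] at this
    exact this
  filter_upwards [hbd, eventually_gt_atTop 0, hlim.eventually (gt_mem_nhds one_pos)]
    with p h1 hp h2
  have hp0 : (0 : ℝ) < p := by exact_mod_cast hp
  have hp1 : (1 : ℝ) ≤ p := by exact_mod_cast hp
  have hM := supC_pos hℓ hp
  -- Since `2p - 1 ≥ p` and the exponent is negative, `ℓ(2p - 1)/2` may be replaced by `(ℓ/2) p`.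
  have hsp : s p ≤ A * (ℓ / 2) ^ (-((1 + ε) / 4)) * (p : ℝ) ^ (-((1 + ε) / 4)) := by
    rw [Real.norm_of_nonneg (hs p), Real.norm_of_nonneg (by
      have : 0 ≤ 2 * (p : ℝ) - 1 := by linarith
      positivity)] at h1
    refine h1.trans ?_
    rw [mul_assoc, ← Real.mul_rpow (by positivity) hp0.le]
    refine mul_le_mul_of_nonneg_left ?_ hA.le
    refine Real.rpow_le_rpow_of_nonpos (by positivity) ?_ (by linarith)
    nlinarith
  have hsq : supC ℓ p ^ 2 = 5 * (1 + ℓ) / (Real.pi * ℓ) * (p : ℝ) ^ (1 / 2 : ℝ) := by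
    rw [supC, Real.sq_sqrt (by positivity), Real.sqrt_eq_rpow]
  -- The balance of exponents: the square of the decay rate beats the growth `p^(1/2)` of `supC ℓ p
  -- ^ 2` by exactly `p^(-ε/2)`.
  have hpow : ((p : ℝ) ^ (-((1 + ε) / 4))) ^ 2 * (p : ℝ) ^ (1 / 2 : ℝ) = (p : ℝ) ^ (-(ε / 2)) := by
    rw [← Real.rpow_natCast, ← Real.rpow_mul hp0.le, ← Real.rpow_add hp0]
    congr 1
    push_cast
    ring
  have hfin : K * s p ^ 2 * supC ℓ p ^ 2 < 1 := by
    refine lt_of_le_of_lt ?_ h2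
    have h3 := pow_le_pow_left₀ (hs p) hsp 2
    calc K * s p ^ 2 * supC ℓ p ^ 2
        ≤ K * (A * (ℓ / 2) ^ (-((1 + ε) / 4)) * (p : ℝ) ^ (-((1 + ε) / 4))) ^ 2 * supC ℓ p ^ 2 := by
          gcongr
      _ = B * (((p : ℝ) ^ (-((1 + ε) / 4))) ^ 2 * (p : ℝ) ^ (1 / 2 : ℝ)) := by rw [hsq, hB]; ring
      _ = _ := by rw [hpow]
  rw [inv_pow, ← one_div, lt_div_iff₀ (by positivity)]
  exact hfin

end MTC
end

theorem theorem4p5 (P : MTC.Params) (hγ : P.γ ≠ 0) (C T : ℝ) (hC : 0 < C) (hT : 0 < T) :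
    ∃ c : ℝ, 0 < c ∧
      ∀ (ℓ ε : ℝ), 0 < ℓ → 0 < ε →
      ∀ ϑ : ℕ → ℝ,
        (∀ p : ℕ, ∀ i < 2 * p, Real.cos (ϑ p + i * Real.pi / (2 * p)) ≠ 0) →
      ∀ u : ℝ → ℝ → ℝ, MTC.IsClassicalSolution P T u →
        (∀ᶠ p : ℕ in Filter.atTop, ∀ t ∈ Set.Icc 0 T, ∀ x : ℝ,
          |MTC.syn ℓ (MTC.proj ℓ p (u t)) x| ≤ C ∧
          |derivWithin (fun s => MTC.syn ℓ (MTC.proj ℓ p (u s)) x) (Set.Icc 0 T) t| ≤ C) →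
        ((fun p : ℕ => MTC.totalError P ℓ p (ϑ p) T u) =O[Filter.atTop]
          fun p : ℕ => (ℓ * (2 * (p : ℝ) - 1) / 2) ^ (-((1 + ε) / 4))) →
        ∀ᶠ p : ℕ in Filter.atTop,
          (∃ ubar : ℝ → MTC.Coeff p,
            MTC.IsSemiDiscreteSolution P ℓ (ϑ p) T (u 0) ubar) ∧
          ∀ ubar : ℝ → MTC.Coeff p,
            MTC.IsSemiDiscreteSolution P ℓ (ϑ p) T (u 0) ubar →
            ∀ t ∈ Set.Icc 0 T,
              ‖MTC.toL2 fun x => MTC.syn ℓ (MTC.proj ℓ p (u t)) x - MTC.syn ℓ (ubar t) x‖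
                ≤ c * MTC.totalError P ℓ p (ϑ p) T u := by
  have hK := MTC.one_le_stabK P hC.le hT.le
  -- The stability estimate is for squared norms, so the constant is the square root of `stabK`,
  -- fixed before `ℓ`, `ε`, the shifts and `u`.
  refine ⟨√(MTC.stabK P C T), Real.sqrt_pos.2 (by linarith), ?_⟩
  intro ℓ ε hℓ hε ϑ hc u hu hb hO
  filter_upwards [hb, eventually_gt_atTop 0, MTC.eventually_small hℓ hε
    (fun p => MTC.totalError_nonneg P ℓ p (ϑ p) T u) hO (MTC.stabK P C T) (by linarith)]
    with p hbp hp hsmall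
  refine ⟨hu.exists_semiDiscrete hγ hC hT hℓ hp (hc p) hbp hsmall, fun ubar hs t ht => ?_⟩
  -- An arbitrary solution of the scheme satisfies the conditional hypothesis of the error bound
  -- outright, so uniqueness is not needed.
  have hle := hu.norm_error_le hγ hC hT hℓ hp (hc p) hbp hsmall hs.1
    (fun t ht => (hs.2 t ht).continuousWithinAt) (fun t ht _ => by
      have := hs.2 t ht
      rwa [MTC.gradient_G P hℓ (hc p)] at this) t ht
  have he : (fun x => MTC.syn ℓ (MTC.proj ℓ p (u t)) x - MTC.syn ℓ (ubar t) x) =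
      MTC.syn ℓ (MTC.proj ℓ p (u t) - ubar t) :=
    funext fun x => ((MTC.evL ℓ p x).map_sub _ _).symm
  rw [he, MTC.norm_toL2_syn hℓ, ← Real.sqrt_sq (MTC.totalError_nonneg P ℓ p (ϑ p) T u),
    ← Real.sqrt_mul (by linarith)]
  exact Real.le_sqrt_of_sq_le hle
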